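/- Let $\mathbb F$ be a finite field, $m\ge 0$ an integer, $S_1,\dots,S_m\subseteq\mathbb F$, $\mathcal S=S_1\times\cdots\times S_m$, and $\vec d=(d_1,\dots,d_m)\in\mathbb N^m$ with $d_i\ge 2(|S_i|-1)$ for all $i$. For $f:\mathcal S\to\mathbb F$ let $\mathsf{LD}_{\vec d}[f]$ be the (finite, nonempty) set of polynomials in $\mathbb F[X_1,\dots,X_m]$ of degree at most $d_i$ in $X_i$ for each $i$ that agree with $f$ on $\mathcal S$, and let $\mathsf{ENC}(f):\mathbb F^m\to\mathbb F$ be the table of values of a uniformly random element of $\mathsf{LD}_{\vec d}[f]$. Algorithms receive as part of their input a description of the parameters: $\mathbb F=\mathbb F_p(g)$ is given by $p$ and the minimal polynomial of $g$ over $\mathbb F_p$ (its elements are represented by their coordinates in the basis $1,g,g^2,\dots$), the $d_i$ are given as numbers, and the $S_i$ as lists of their elements. Running time is measured in bit operations; randomised algorithms may draw exactly uniform elements of $\{0,\dots,N\}$ for a computed number $N$. The algorithms and the polynomials below do not depend on $\mathbb F,m,\vec d,S_1,\dots,S_m$. **Theorem.** $\mathsf{ENC}$ is a linear randomised encoding: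 for some $r$ there is a linear map $(f,\mu)\mapsto\mathsf{ENC}(f;\mu)$, $\mu \in \mathbb F^r$, such that $\mathsf{ENC}(f)$ is distributed as $\mathsf{ENC}(f;\mu)$ for uniform $\mu$. It has an $n$-constraint locator running in time $\mathrm{poly}(\log|\mathbb F|,m,\max_i d_i,n)$: there is a deterministic algorithm which, given a finite set $I\subseteq\mathbb F^m$ with $|I|=n$, runs within that time and outputs a set $R\subseteq\mathcal S$ with $|R|\le n$ and a matrix $Z\in\mathbb F^{k\times(R\sqcup I)}$ (for some $k$) such that for all $f:\mathcal S\to\mathbb F$ and $\beta\in\mathbb F^I$ we have $(f|_R,\beta)^T\in\ker Z$ if and only if $\Pr[\mathsf{ENC}(f)|_I=\beta]>0$. **Corollary.** $\mathsf{ENC}$ is locally simulatable in time $\mathrm{poly}(\log|\mathbb F|,m,\max_i d_i,n)$ with at most $n+1$ queries: there is a probabilistic algorithm $\mathcal A$ which, given oracle access to $f:\mathcal S\to\mathbb F$, a list $T\in(\mathbb F^m\times\mathbb F)^n$ of query-answer pairs and a new query $\alpha\in\mathbb F^m$, always runs within that time, makes at most $n+1$ queries to $f$, and satisfies $$\Pr[\mathcal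 A^f(T,\alpha)=\beta]=\Pr\big[\mathsf{ENC}(f)_\alpha=\beta\ \big|\ \mathsf{ENC}(f)_x=y\ \ \forall (x,y)\in T\big]$$ for all $\beta\in\mathbb F$, whenever the conditioning event has positive probability. -/

import Mathlib

namespace LocalSim

/-! ### A model of computation

Programs act on binary trees whose leaves are natural numbers (written in binary). Every basic
operation is charged the total bit size of its input and of its output, so the number of bits a
program ever touches is bounded by its running time, and the model is polynomially equivalent to
(oracle, probabilistic) Turing machines with exact uniform sampling from `{0, …, n}`. -/

/-- Data: natural numbers and ordered pairs. -/
inductive Val : Type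
  | atom (n : ℕ) : Val
  | pair (a b : Val) : Val

namespace Val

/-- Bit size. -/
def size : Val → ℕ
  | atom n => Nat.size n + 1
  | pair a b => a.size + b.size + 1

def fst : Val → Val
  | atom _ => atom 0
  | pair a _ => a

def snd : Val → Val
  | atom _ => atom 0
  | pair _ b => b

def toNat : Val → ℕ
  | atom n => n
  | pair _ _ => 0

/-- `1` on pairs and `0` on numbers. -/
def isPair : Val → ℕ
  | atom _ => 0
  | pair _ _ => 1

/-- Apply a binary arithmetic operation to the two components of a pair. -/
def arith (op : ℕ → ℕ → ℕ) (x : Val) : Val :=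
  atom (op x.fst.toNat x.snd.toNat)

/-- Lists are right-nested pairs ending in the number `0`. -/
def ofList : List Val → Val
  | [] => atom 0
  | a :: l => pair a (ofList l)

end Val

/-- Programs. `query` calls the oracle, `rand` draws a uniformly random element of `{0, …, n}`
on input `n`, `fold f` maps `(l, s)` to the left fold of `f` over the list `l` from the initial
state `s`, and `iter f` maps `(n, s)` to the `n`-fold iterate of `f` on `s`. -/
inductive Prog : Type
  | id : Prog
  | const (v : Val) : Prog
  | fst : Prog
  | snd : Prog
  | isPair : Prog
  | size : Prog
  | add : Prog
  | sub : Prog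
  | mul : Prog
  | div : Prog
  | mod : Prog
  | le : Prog
  | query : Prog
  | rand : Prog
  | pair (f g : Prog) : Prog
  | comp (g f : Prog) : Prog
  | ite (c f g : Prog) : Prog
  | fold (f : Prog) : Prog
  | iter (f : Prog) : Prog

/-- The outcome of a run: the output, the time used and the number of oracle queries made. -/
structure Result : Type where
  out : Val
  time : ℕ
  queries : ℕ

/-- One basic operation with input `x` and output `y`. -/
noncomputable def basic (x y : Val) : PMF Result :=
  PMF.pure ⟨y, x.size + y.size, 0⟩

/-- Charge `n` additional steps. -/
noncomputable def charge (n : ℕ) (r : PMF Result) : PMF Result :=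
  r.map fun a => ⟨a.out, a.time + n, a.queries⟩

/-- Run `r`, then run `k` on its output; time and queries add up. -/
noncomputable def andThen (r : PMF Result) (k : Val → PMF Result) : PMF Result :=
  r.bind fun a => (k a.out).map fun b => ⟨b.out, a.time + b.time, a.queries + b.queries⟩

/-- Fold the body over a list, one extra step for each iteration. -/
noncomputable def foldRun (body : Val → PMF Result) : Val → Val → PMF Result
  | .atom _, s => PMF.pure ⟨s, 1, 0⟩
  | .pair a l, s => charge 1 (andThen (body (.pair a s)) (foldRun body l))

/-- Iterate the body, one extra step for each iteration. -/
noncomputable def iterRun (body : Val → PMF Result) : ℕ → Val → PMF Result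
  | 0, s => PMF.pure ⟨s, 1, 0⟩
  | n + 1, s => charge 1 (andThen (body s) (iterRun body n))

/-- The joint distribution of output, time and number of queries of a program, with oracle `O`,
on a given input. Natural subtraction is truncated and `a / 0 = 0`, `a % 0 = a`. -/
noncomputable def Prog.run (O : Val → Val) : Prog → Val → PMF Result
  | .id => fun x => basic x x
  | .const v => fun x => basic x v
  | .fst => fun x => basic x x.fst
  | .snd => fun x => basic x x.snd
  | .isPair => fun x => basic x (.atom x.isPair)
  | .size => fun x => basic x (.atom x.size)
  | .add => fun x => basic x (x.arith (· + ·))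
  | .sub => fun x => basic x (x.arith (· - ·))
  | .mul => fun x => basic x (x.arith (· * ·))
  | .div => fun x => basic x (x.arith (· / ·))
  | .mod => fun x => basic x (x.arith (· % ·))
  | .le => fun x => basic x (x.arith fun a b => if a ≤ b then 1 else 0)
  | .query => fun x => PMF.pure ⟨O x, x.size + (O x).size, 1⟩
  | .rand => fun x => (PMF.uniformOfFintype (Fin (x.toNat + 1))).bind fun i =>
      basic x (.atom (i : ℕ))
  | .pair f g => fun x => charge (x.size + 1)
      (andThen (f.run O x) fun y => andThen (g.run O x) fun z =>
        PMF.pure ⟨.pair y z, 0, 0⟩)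
  | .comp g f => fun x => andThen (f.run O x) fun y => g.run O y
  | .ite c f g => fun x => charge x.size
      (andThen (c.run O x) fun b => if b.toNat ≠ 0 then f.run O x else g.run O x)
  | .fold f => fun x => charge x.size (foldRun (fun y => f.run O y) x.fst x.snd)
  | .iter f => fun x => charge x.size (iterRun (fun y => f.run O y) x.fst.toNat x.snd)

/-! ### Randomised encodings, constraint locators and local simulators -/

/-- A randomised encoding function with message space `X → A` and alphabet `A`: each message is
sent to a random word indexed by `D`. -/
abbrev RandEnc (X D A : Type) : Type := (X → A) → PMF (D → A)

/-- `ENC(f)` is distributed as `L(f, μ)` for a linear map `L` and uniformly random `μ`. -/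
def IsLinear {X D F : Type} [Field F] [Fintype F] (ENC : RandEnc X D F) : Prop :=
  ∃ (r : ℕ) (L : ((X → F) × (Fin r → F)) →ₗ[F] (D → F)),
    ∀ f, ENC f = (PMF.uniformOfFintype (Fin r → F)).map fun μ => L (f, μ)

/-- For all messages `f` and all `β`, the vector `(f|_R, β)` is in the kernel of `Z` if and only
if `β` is a possible value of `ENC(f)|_I`. The sets `R`, `I` are given by lists. -/
def IsConstraintSystem {X D F : Type} [Field F] (ENC : RandEnc X D F) (I : List D) (R : List X)
    {k : ℕ} (Z : Matrix (Fin k) (Fin R.length ⊕ Fin I.length) F) : Prop :=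
  ∀ (f : X → F) (β : Fin I.length → F),
    Z.mulVec (Sum.elim (fun j => f (R.get j)) β) = 0 ↔
      ∃ c ∈ (ENC f).support, ∀ j, c (I.get j) = β j

/-- The list `R` followed by the list of rows of `Z`. -/
def encodeSystem {X F : Type} (eX : X → Val) (eF : F → Val) (R : List X) (n k : ℕ)
    (Z : Matrix (Fin k) (Fin R.length ⊕ Fin n) F) : Val :=
  .pair (.ofList (R.map eX)) (.ofList (List.ofFn fun i => Val.ofList
    ((List.ofFn fun j => eF (Z i (.inl j))) ++ List.ofFn fun j => eF (Z i (.inr j)))))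

/-- The program `CL`, which is given the parameters `par` of the encoding and a subdomain `I`
(listed in any order), deterministically and without oracle queries outputs, within time
`t |I|`, a set `R` of at most `ℓ |I|` message locations and a matrix `Z` describing the possible
values of `ENC(f)|_I` in terms of `f|_R`. -/
def IsConstraintLocator {X D F : Type} [Field F] (ENC : RandEnc X D F)
    (eX : X → Val) (eD : D → Val) (eF : F → Val) (par : Val)
    (CL : Prog) (t ℓ : ℕ → ℕ) : Prop :=
  ∀ I : List D, I.Nodup →
    ∃ (R : List X) (k : ℕ) (Z : Matrix (Fin k) (Fin R.length ⊕ Fin I.length) F) (τ : ℕ),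
      R.Nodup ∧ R.length ≤ ℓ I.length ∧ τ ≤ t I.length ∧
      (∀ O : Val → Val, CL.run O (.pair par (.ofList (I.map eD))) =
        PMF.pure ⟨encodeSystem eX eF R I.length k Z, τ, 0⟩) ∧
      IsConstraintSystem ENC I R Z

/-- The words that are consistent with a list of query-answer pairs. -/
def consistent {D A : Type} (T : List (D × A)) : Set (D → A) :=
  {c | ∀ xy ∈ T, c xy.1 = xy.2}

/-- The probabilistic program `SIM`, which is given the parameters `par` of the encoding, a list
`T` of query-answer pairs and a new query `α`, and has oracle access to the message `f`, always
runs in time `t |T|` and makes at most `ℓ |T|` oracle queries, and, whenever `T` is consistent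
with some possible value of `ENC(f)`, its output is distributed exactly as `ENC(f)_α` conditioned
on `ENC(f)_x = y` for all `(x, y) ∈ T`. -/
def IsLocalSimulator {X D A : Type} (ENC : RandEnc X D A)
    (eX : X → Val) (eD : D → Val) (eA : A → Val) (par : Val)
    (SIM : Prog) (t ℓ : ℕ → ℕ) : Prop :=
  ∀ (f : X → A) (O : Val → Val), (∀ x, O (eX x) = eA (f x)) →
    ∀ (T : List (D × A)) (α : D),
      let out := SIM.run O
        (.pair par (.pair (.ofList (T.map fun xy => .pair (eD xy.1) (eA xy.2))) (eD α)))
      (∀ r ∈ out.support, r.time ≤ t T.length ∧ r.queries ≤ ℓ T.length) ∧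
      ∀ hT : ∃ c ∈ consistent T, c ∈ (ENC f).support,
        out.map Result.out = ((ENC f).filter (consistent T) hT).map fun c => eA (c α)

/-! ### Random low-degree extensions -/

section LDE

variable {F : Type} [Field F] {m : ℕ}

/-- The product set `S₁ × ⋯ × Sₘ`. -/
abbrev Grid (S : Fin m → Finset F) : Type := {x : Fin m → F // ∀ i, x i ∈ S i}

/-- The polynomials of degree at most `d i` in the `i`-th variable that extend `f`. -/
def LD (d : Fin m → ℕ) (S : Fin m → Finset F) (f : Grid S → F) : Set (MvPolynomial (Fin m) F) :=
  {q | (∀ i, q.degreeOf i ≤ d i) ∧ ∀ x : Grid S, MvPolynomial.eval x.1 q = f x}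

theorem LD_finite [Finite F] (d : Fin m → ℕ) (S : Fin m → Finset F) (f : Grid S → F) :
    (LD d S f).Finite := by
  let s : Set (Fin m →₀ ℕ) := {e | ∀ i, e i ≤ d i}
  have hs : s.Finite := by
    refine Set.Finite.subset (Set.finite_Iic (Finsupp.equivFunOnFinite.symm d)) ?_
    intro e he i
    exact he i
  have : Finite s := hs
  have : Module.Finite F (MvPolynomial.restrictSupport F s) :=
    Module.Finite.of_basis (MvPolynomial.basisRestrictSupport F s)
  have : Finite (MvPolynomial.restrictSupport F s) := Module.finite_of_finite F
  refine Set.Finite.subset (Set.toFinite (MvPolynomial.restrictSupport F s : Set _)) ?_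
  intro q hq
  rw [SetLike.mem_coe, MvPolynomial.mem_restrictSupport_iff]
  intro e he i
  exact MvPolynomial.degreeOf_le_iff.1 (hq.1 i) e he

theorem LD_nonempty [Finite F] (d : Fin m → ℕ) (S : Fin m → Finset F)
    (hd : ∀ i, 2 * ((S i).card - 1) ≤ d i) (f : Grid S → F) : (LD d S f).Nonempty := by
  classical
  have := Fintype.ofFinite F
  let fac (w : Grid S) (i : Fin m) (z : F) : MvPolynomial (Fin m) F :=
    MvPolynomial.C (w.1 i - z)⁻¹ * (MvPolynomial.X i - MvPolynomial.C z)
  have hfac : ∀ w i z j, (fac w i z).degreeOf j ≤ if i = j then 1 else 0 := by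
    intro w i z j
    refine (MvPolynomial.degreeOf_C_mul_le _ _ _).trans ?_
    refine (MvPolynomial.degreeOf_sub_le _ _ _).trans ?_
    rw [MvPolynomial.degreeOf_C, MvPolynomial.degreeOf_X]
    by_cases h : i = j
    · subst h; simp
    · simp [h, Ne.symm h]
  refine ⟨∑ w : Grid S, MvPolynomial.C (f w) *
    ∏ i, ∏ z ∈ (S i).erase (w.1 i), fac w i z, ?_, ?_⟩
  · intro j
    refine (MvPolynomial.degreeOf_sum_le _ _ _).trans (Finset.sup_le fun w _ => ?_)
    refine (MvPolynomial.degreeOf_C_mul_le _ _ _).trans ?_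
    refine (MvPolynomial.degreeOf_prod_le _ _ _).trans ?_
    calc ∑ i, MvPolynomial.degreeOf j (∏ z ∈ (S i).erase (w.1 i), fac w i z)
        ≤ ∑ i, if i = j then (S j).card - 1 else 0 := by
          refine Finset.sum_le_sum fun i _ => ?_
          refine (MvPolynomial.degreeOf_prod_le _ _ _).trans ?_
          refine (Finset.sum_le_sum fun z _ => hfac w i z j).trans ?_
          by_cases h : i = j
          · subst h
            simp [Finset.card_erase_of_mem (w.2 i)]
          · simp [h]
      _ = (S j).card - 1 := by simp
      _ ≤ d j := by have := hd j; omega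
  · intro x
    rw [map_sum, Finset.sum_eq_single x]
    · simp only [map_mul, map_prod, MvPolynomial.eval_C, fac, map_sub, MvPolynomial.eval_X]
      rw [Finset.prod_eq_one, mul_one]
      intro i _
      refine Finset.prod_eq_one fun z hz => ?_
      exact inv_mul_cancel₀ (sub_ne_zero.2 (Finset.ne_of_mem_erase hz).symm)
    · intro w _ hw
      have : ∃ i, x.1 i ≠ w.1 i := by
        by_contra h
        push Not at h
        exact hw (Subtype.ext (funext fun i => (h i).symm))
      obtain ⟨i, hi⟩ := this
      simp only [map_mul, map_prod, MvPolynomial.eval_C, fac, map_sub, MvPolynomial.eval_X]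
      rw [Finset.prod_eq_zero (Finset.mem_univ i), mul_zero]
      refine Finset.prod_eq_zero (Finset.mem_erase.2 ⟨hi, x.2 i⟩) ?_
      simp
    · simp

/-- The encoding that sends `f : S₁ × ⋯ × Sₘ → F` to the table of values on `Fᵐ` of a uniformly
random element of `LD d S f`. -/
noncomputable def rmEnc [Finite F] (d : Fin m → ℕ) (S : Fin m → Finset F)
    (hd : ∀ i, 2 * ((S i).card - 1) ≤ d i) : RandEnc (Grid S) (Fin m → F) F := fun f =>
  (PMF.uniformOfFinset (LD_finite d S f).toFinset
    ((LD_finite d S f).toFinset_nonempty.2 (LD_nonempty d S hd f))).map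
    fun q x => MvPolynomial.eval x q

/-! ### Binary representation of field elements, points and parameters -/

variable {p : ℕ} [Algebra (ZMod p) F]

/-- An element `∑ i, a i * g ^ i` of `F = 𝔽ₚ(g)` is represented by the list of the residues
`a i ∈ {0, …, p - 1}`. -/
noncomputable def encField (pb : PowerBasis (ZMod p) F) (x : F) : Val :=
  .ofList (List.ofFn fun i => .atom (pb.basis.repr x i).val)

/-- A point of `Fᵐ` is represented by the list of its coordinates. -/
noncomputable def encPoint (pb : PowerBasis (ZMod p) F) (x : Fin m → F) : Val :=
  .ofList (List.ofFn fun i => encField pb (x i))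

/-- The description of the field: the prime `p` and the coefficients of the minimal polynomial
over `𝔽ₚ` of the generator `g`. -/
noncomputable def descField (pb : PowerBasis (ZMod p) F) : Val :=
  .pair (.atom p) (.ofList (List.ofFn fun i : Fin (pb.dim + 1) =>
    .atom ((minpoly (ZMod p) pb.gen).coeff i).val))

/-- The parameters: the field, the degrees `d₁, …, dₘ`, and listings of the sets `S₁, …, Sₘ`. -/
noncomputable def encParams (pb : PowerBasis (ZMod p) F) (d : Fin m → ℕ) (L : Fin m → List F) :
    Val :=
  .pair (descField pb) (.pair (.ofList (List.ofFn fun i => .atom (d i)))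
    (.ofList (List.ofFn fun i => .ofList ((L i).map (encField pb)))))

/-- The value `P(log |F|, m, maxᵢ dᵢ, n)`. -/
noncomputable def timeBound (P : MvPolynomial (Fin 4) ℕ) (F : Type) [Fintype F] {m : ℕ}
    (d : Fin m → ℕ) (n : ℕ) : ℕ :=
  MvPolynomial.eval ![Nat.log 2 (Fintype.card F), m, Finset.univ.sup d, n] P

end LDE

end LocalSim

open LocalSim

/-! The supports of the distributions `ENC(f)` are described by linear algebra in two phases.

*Message locations.* To each point `s` of the grid belongs the polynomial `gridDelta S s` of degree
at most `|S i| - 1` in the `i`-th variable that vanishes on the rest of the grid. Its values on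
the `n` points of `I` are the pointwise product of one vector for each coordinate. A basis of the
span of these vectors is found by taking products coordinate by coordinate, and reducing the list to
a basis of its span after each step (`tensorReduce`), so that never more than `n` vectors survive.
The surviving vectors are those of a set `R` of at most `n` grid points. For each other grid point
`s` a linear relation yields a polynomial `h`, again of degree at most `|S i| - 1`, that vanishes on
`I` and not at `s` (`tensorReduce_deltaMults`). The product `h * gridDelta S s` has degree at most
`2 (|S i| - 1) ≤ d i`, and with its multiples the value of a polynomial at `s` can be changed
without affecting the rest of the grid or `I`. Hence a polynomial of degree at most `d` with given
values on `I` that agrees with the message on `R` can be made to agree with it everywhere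
(`exists_mem_LD_iff`).

*Constraints.* It remains to describe the values on `R` and `I` of all polynomials of degree at
most `d`. They are spanned by the values of the monomials, which are products of powers of the
coordinates, so the same reduction applies. It is carried out by elimination on the dual side: it
starts with the identity matrix, and makes the rows orthogonal to one vector after the other, each
time at the cost of at most one row. The rows that remain are the matrix `Z` (`reduceList_spec`, `rowKer_powMults`).

*Simulation.* For the previous queries together with the new one, the simulator computes `R` and
`Z` and asks for the message on `R`. If some row of `Z` involves the new query, the row determines
the answer. Otherwise there are two extensions of the message with the same previous answers and
different values at the new query; as the law of the encoding is invariant under translation by the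
multiples of their difference, the answer is uniformly distributed (`filter_rmEnc_map_of_unique`,
`filter_rmEnc_map_of_ne`, `SimInput.map_solve_eq`).

*Running times.* `Computes` says of a family of inputs, indexed by all fields and parameters at
once, that a fixed program gives the right output in time polynomial in a weight on the index set.
Since a program is charged for reading its input and writing its output, this notion is closed
under composition without any size estimates. Loops require an invariant that bounds the size of the
state (`Computes.foldEnv`, `Computes.iterEnv`); here these bounds come from the fact that the
reduced lists have at most as many items as there are points. -/

namespace LocalSim

universe u v w

/-! ### Polynomial domination -/

/-- `f` is bounded by a fixed power of `σ + 2`, uniformly over the index set. -/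
def PolyBd {ι : Type u} (f σ : ι → ℕ) : Prop := ∃ c : ℕ, ∀ i, f i ≤ (σ i + 2) ^ c

namespace PolyBd

variable {ι : Type u} {ι' : Type v} {f g h σ : ι → ℕ}

theorem of_le (hg : PolyBd g σ) (hfg : ∀ i, f i ≤ g i) : PolyBd f σ := by
  obtain ⟨c, hc⟩ := hg
  exact ⟨c, fun i => (hfg i).trans (hc i)⟩

theorem refl (σ : ι → ℕ) : PolyBd σ σ := ⟨1, fun i => by simp⟩

theorem const (a : ℕ) : PolyBd (fun _ => a) σ :=
  ⟨a, fun i => (Nat.lt_pow_self (by omega)).le⟩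

theorem add (hf : PolyBd f σ) (hg : PolyBd g σ) : PolyBd (fun i => f i + g i) σ := by
  obtain ⟨a, ha⟩ := hf
  obtain ⟨b, hb⟩ := hg
  refine ⟨max a b + 1, fun i => ?_⟩
  have h2 : 2 ≤ σ i + 2 := by omega
  calc f i + g i ≤ (σ i + 2) ^ max a b + (σ i + 2) ^ max a b :=
        add_le_add ((ha i).trans (Nat.pow_le_pow_right (by omega) (le_max_left _ _)))
          ((hb i).trans (Nat.pow_le_pow_right (by omega) (le_max_right _ _)))
    _ = (σ i + 2) ^ max a b * 2 := by ring
    _ ≤ (σ i + 2) ^ max a b * (σ i + 2) := Nat.mul_le_mul_left _ h2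
    _ = (σ i + 2) ^ (max a b + 1) := by ring

theorem mul (hf : PolyBd f σ) (hg : PolyBd g σ) : PolyBd (fun i => f i * g i) σ := by
  obtain ⟨a, ha⟩ := hf
  obtain ⟨b, hb⟩ := hg
  refine ⟨a + b, fun i => ?_⟩
  rw [pow_add]
  exact Nat.mul_le_mul (ha i) (hb i)

theorem trans (hf : PolyBd f g) (hg : PolyBd g σ) : PolyBd f σ := by
  obtain ⟨a, ha⟩ := hf
  obtain ⟨b, hb⟩ := hg.add (const 2)
  refine ⟨b * a, fun i => (ha i).trans ?_⟩
  rw [pow_mul]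
  exact Nat.pow_le_pow_left (hb i) a

theorem pull (hf : PolyBd f σ) (k : ι' → ι) : PolyBd (fun j => f (k j)) (fun j => σ (k j)) := by
  obtain ⟨a, ha⟩ := hf
  exact ⟨a, fun j => ha (k j)⟩

end PolyBd

/-! ### Deterministic evaluation of programs -/

/-- The result of folding `g` over the list coded by a value. -/
def foldOut (g : Val → Val) : Val → Val → Val
  | .atom _, s => s
  | .pair a l, s => foldOut g l (g (.pair a s))

/-- The sum of the costs `t` of the calls of `g` in a fold, with an overhead `e` for each step. -/
def foldCost (e : ℕ) (g : Val → Val) (t : Val → ℕ) : Val → Val → ℕ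
  | .atom _, _ => e
  | .pair a l, s => t (.pair a s) + foldCost e g t l (g (.pair a s)) + e

/-- The sum of the costs `t` of the calls of `g` in an iteration, with an overhead `e` for each
step. -/
def iterCost (e : ℕ) (g : Val → Val) (t : Val → ℕ) : ℕ → Val → ℕ
  | 0, _ => e
  | n + 1, s => t s + iterCost e g t n (g s) + e

namespace Prog

/-- The output of a program, for programs without `rand`. -/
def out (O : Val → Val) : Prog → Val → Val
  | .id => fun x => x
  | .const v => fun _ => v
  | .fst => fun x => x.fst
  | .snd => fun x => x.snd
  | .isPair => fun x => .atom x.isPair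
  | .size => fun x => .atom x.size
  | .add => fun x => x.arith (· + ·)
  | .sub => fun x => x.arith (· - ·)
  | .mul => fun x => x.arith (· * ·)
  | .div => fun x => x.arith (· / ·)
  | .mod => fun x => x.arith (· % ·)
  | .le => fun x => x.arith fun a b => if a ≤ b then 1 else 0
  | .query => fun x => O x
  | .rand => fun x => x
  | .pair f g => fun x => .pair (f.out O x) (g.out O x)
  | .comp g f => fun x => g.out O (f.out O x)
  | .ite c f g => fun x => if (c.out O x).toNat ≠ 0 then f.out O x else g.out O x
  | .fold f => fun x => foldOut (fun y => f.out O y) x.fst x.snd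
  | .iter f => fun x => (fun y => f.out O y)^[x.fst.toNat] x.snd

/-- The running time of a program, for programs without `rand`. The summands are grouped as in
`Prog.run`. -/
def time (O : Val → Val) : Prog → Val → ℕ
  | .id => fun x => x.size + x.size
  | .const v => fun x => x.size + v.size
  | .fst => fun x => x.size + x.fst.size
  | .snd => fun x => x.size + x.snd.size
  | .isPair => fun x => x.size + (Val.atom x.isPair).size
  | .size => fun x => x.size + (Val.atom x.size).size
  | .add => fun x => x.size + (x.arith (· + ·)).size
  | .sub => fun x => x.size + (x.arith (· - ·)).size
  | .mul => fun x => x.size + (x.arith (· * ·)).size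
  | .div => fun x => x.size + (x.arith (· / ·)).size
  | .mod => fun x => x.size + (x.arith (· % ·)).size
  | .le => fun x => x.size + (x.arith fun a b => if a ≤ b then 1 else 0).size
  | .query => fun x => x.size + (O x).size
  | .rand => fun x => x.size + x.size
  | .pair f g => fun x => f.time O x + (g.time O x + 0) + (x.size + 1)
  | .comp g f => fun x => f.time O x + g.time O (f.out O x)
  | .ite c f g => fun x =>
      c.time O x + (if (c.out O x).toNat ≠ 0 then f.time O x else g.time O x) + x.size
  | .fold f => fun x => foldCost 1 (fun y => f.out O y) (fun y => f.time O y) x.fst x.snd + x.size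
  | .iter f => fun x =>
      iterCost 1 (fun y => f.out O y) (fun y => f.time O y) x.fst.toNat x.snd + x.size

/-- The number of oracle queries of a program, for programs without `rand`. -/
def queries (O : Val → Val) : Prog → Val → ℕ
  | .query => fun _ => 1
  | .pair f g => fun x => f.queries O x + (g.queries O x + 0)
  | .comp g f => fun x => f.queries O x + g.queries O (f.out O x)
  | .ite c f g => fun x =>
      c.queries O x + (if (c.out O x).toNat ≠ 0 then f.queries O x else g.queries O x)
  | .fold f => fun x => foldCost 0 (fun y => f.out O y) (fun y => f.queries O y) x.fst x.snd
  | .iter f => fun x =>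
      iterCost 0 (fun y => f.out O y) (fun y => f.queries O y) x.fst.toNat x.snd
  | _ => fun _ => 0

/-- The program makes no random choices. -/
def randFree : Prog → Bool
  | .rand => false
  | .pair f g => f.randFree && g.randFree
  | .comp g f => g.randFree && f.randFree
  | .ite c f g => c.randFree && (f.randFree && g.randFree)
  | .fold f => f.randFree
  | .iter f => f.randFree
  | _ => true

/-- The program makes no oracle queries. -/
def queryFree : Prog → Bool
  | .query => false
  | .pair f g => f.queryFree && g.queryFree
  | .comp g f => g.queryFree && f.queryFree
  | .ite c f g => c.queryFree && (f.queryFree && g.queryFree)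
  | .fold f => f.queryFree
  | .iter f => f.queryFree
  | _ => true

/-- The program has no loops, no random choices and no oracle queries. -/
def simple : Prog → Bool
  | .query => false
  | .rand => false
  | .pair f g => f.simple && g.simple
  | .comp g f => g.simple && f.simple
  | .ite c f g => c.simple && (f.simple && g.simple)
  | .fold _ => false
  | .iter _ => false
  | _ => true

end Prog

/-- A fold over a deterministic body is deterministic. -/
theorem foldRun_eq {body : Val → PMF Result} {g : Val → Val} {t q : Val → ℕ}
    (h : ∀ x, body x = PMF.pure ⟨g x, t x, q x⟩) (l s : Val) :
    foldRun body l s = PMF.pure ⟨foldOut g l s, foldCost 1 g t l s, foldCost 0 g q l s⟩ := by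
  induction l generalizing s with
  | atom n => simp [foldRun, foldOut, foldCost]
  | pair a l _ ih =>
    simp [foldRun, foldOut, foldCost, charge, andThen, h, ih, PMF.pure_bind, PMF.pure_map]

theorem iterRun_eq {body : Val → PMF Result} {g : Val → Val} {t q : Val → ℕ}
    (h : ∀ x, body x = PMF.pure ⟨g x, t x, q x⟩) (n : ℕ) (s : Val) :
    iterRun body n s = PMF.pure ⟨g^[n] s, iterCost 1 g t n s, iterCost 0 g q n s⟩ := by
  induction n generalizing s with
  | zero => simp [iterRun, iterCost]
  | succ n ih =>
    simp [iterRun, iterCost, charge, andThen, h, ih, PMF.pure_bind, PMF.pure_map]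

/-- A program without random choices has a deterministic run. -/
theorem Prog.run_eq_pure (O : Val → Val) (pr : Prog) (h : pr.randFree = true) (x : Val) :
    pr.run O x = PMF.pure ⟨pr.out O x, pr.time O x, pr.queries O x⟩ := by
  induction pr generalizing x with
  | rand => simp [Prog.randFree] at h
  | pair f g hf hg =>
    simp only [Prog.randFree, Bool.and_eq_true] at h
    simp [Prog.run, Prog.out, Prog.time, Prog.queries, charge, andThen, hf h.1, hg h.2,
      PMF.pure_bind, PMF.pure_map]
  | comp g f hg hf =>
    simp only [Prog.randFree, Bool.and_eq_true] at h
    simp [Prog.run, Prog.out, Prog.time, Prog.queries, andThen, hf h.2, hg h.1,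
      PMF.pure_bind, PMF.pure_map]
  | ite c f g hc hf hg =>
    simp only [Prog.randFree, Bool.and_eq_true] at h
    by_cases hx : (c.out O x).toNat = 0 <;>
    simp [Prog.run, Prog.out, Prog.time, Prog.queries, charge, andThen, hc h.1, hf h.2.1,
      hg h.2.2, PMF.pure_bind, PMF.pure_map, hx]
  | fold f hf =>
    simp only [Prog.randFree] at h
    simp [Prog.run, Prog.out, Prog.time, Prog.queries, charge,
      foldRun_eq (fun y => hf h y), PMF.pure_map]
  | iter f hf =>
    simp only [Prog.randFree] at h
    simp [Prog.run, Prog.out, Prog.time, Prog.queries, charge,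
      iterRun_eq (fun y => hf h y), PMF.pure_map]
  | _ => simp [Prog.run, basic, Prog.out, Prog.time, Prog.queries]

theorem foldCost_zero_eq_zero {g : Val → Val} {t : Val → ℕ} (h : ∀ x, t x = 0) (l s : Val) :
    foldCost 0 g t l s = 0 := by
  induction l generalizing s with
  | atom n => rfl
  | pair a l _ ih => simp [foldCost, h, ih]

theorem iterCost_zero_eq_zero {g : Val → Val} {t : Val → ℕ} (h : ∀ x, t x = 0) (n : ℕ) (s : Val) :
    iterCost 0 g t n s = 0 := by
  induction n generalizing s with
  | zero => rfl
  | succ n ih => simp [iterCost, h, ih]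

/-- The behaviour of a query-free program does not depend on the oracle. -/
theorem Prog.queryFree_spec (O O' : Val → Val) (pr : Prog) (h : pr.queryFree = true) :
    pr.out O = pr.out O' ∧ pr.time O = pr.time O' ∧ ∀ x, pr.queries O x = 0 := by
  induction pr with
  | query => simp [Prog.queryFree] at h
  | pair f g hf hg =>
    simp only [Prog.queryFree, Bool.and_eq_true] at h
    obtain ⟨h1, h2, h3⟩ := hf h.1
    obtain ⟨k1, k2, k3⟩ := hg h.2
    simp [Prog.out, Prog.time, Prog.queries, h1, h2, h3, k1, k2, k3]
  | comp g f hg hf =>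
    simp only [Prog.queryFree, Bool.and_eq_true] at h
    obtain ⟨h1, h2, h3⟩ := hf h.2
    obtain ⟨k1, k2, k3⟩ := hg h.1
    simp [Prog.out, Prog.time, Prog.queries, h1, h2, h3, k1, k2, k3]
  | ite c f g hc hf hg =>
    simp only [Prog.queryFree, Bool.and_eq_true] at h
    obtain ⟨h1, h2, h3⟩ := hf h.2.1
    obtain ⟨k1, k2, k3⟩ := hg h.2.2
    obtain ⟨l1, l2, l3⟩ := hc h.1
    simp [Prog.out, Prog.time, Prog.queries, h1, h2, h3, k1, k2, k3, l1, l2, l3]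
  | fold f hf =>
    simp only [Prog.queryFree] at h
    obtain ⟨h1, h2, h3⟩ := hf h
    simp [Prog.out, Prog.time, Prog.queries, h1, h2, foldCost_zero_eq_zero h3]
  | iter f hf =>
    simp only [Prog.queryFree] at h
    obtain ⟨h1, h2, h3⟩ := hf h
    simp [Prog.out, Prog.time, Prog.queries, h1, h2, iterCost_zero_eq_zero h3]
  | _ => exact ⟨rfl, rfl, fun _ => rfl⟩

/-! ### Sizes -/

theorem Val.one_le_size (x : Val) : 1 ≤ x.size := by cases x <;> simp [Val.size]

theorem Val.size_fst_le (x : Val) : x.fst.size ≤ x.size := by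
  cases x with
  | atom n => simp [Val.fst, Val.size]
  | pair a b => simp only [Val.fst, Val.size]; omega

theorem Val.size_snd_le (x : Val) : x.snd.size ≤ x.size := by
  cases x with
  | atom n => simp [Val.snd, Val.size]
  | pair a b => simp only [Val.snd, Val.size]; omega

theorem Val.natSize_toNat_le (x : Val) : Nat.size x.toNat ≤ x.size := by
  cases x <;> simp [Val.toNat, Val.size]

theorem natSize_add_le (a b : ℕ) : Nat.size (a + b) ≤ Nat.size a + Nat.size b + 1 := by
  rw [Nat.size_le]
  have ha := Nat.lt_size_self a
  have hb := Nat.lt_size_self b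
  have h1 : 2 ^ a.size ≤ 2 ^ (a.size + b.size) := Nat.pow_le_pow_right (by omega) (by omega)
  have h2 : 2 ^ b.size ≤ 2 ^ (a.size + b.size) := Nat.pow_le_pow_right (by omega) (by omega)
  rw [pow_succ]
  omega

theorem natSize_mul_le (a b : ℕ) : Nat.size (a * b) ≤ Nat.size a + Nat.size b := by
  rw [Nat.size_le, pow_add]
  exact Nat.mul_lt_mul_of_lt_of_lt (Nat.lt_size_self a) (Nat.lt_size_self b)

theorem natSize_le_self (a : ℕ) : Nat.size a ≤ a := by
  rw [Nat.size_le]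
  exact Nat.lt_two_pow_self

theorem Val.size_atom_le (n : ℕ) : (Val.atom n).size ≤ n + 1 := by
  simpa [Val.size] using natSize_le_self n

theorem foldOut_size_le {g : Val → Val} {t : Val → ℕ} (h : ∀ x, (g x).size ≤ t x) (l s : Val) :
    (foldOut g l s).size ≤ foldCost 1 g t l s + s.size := by
  induction l generalizing s with
  | atom n => simp [foldOut]
  | pair a l _ ih =>
    have h1 := ih (g (.pair a s))
    have h2 := h (.pair a s)
    simp only [foldOut, foldCost]
    omega

theorem iterOut_size_le {g : Val → Val} {t : Val → ℕ} (h : ∀ x, (g x).size ≤ t x) (n : ℕ)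
    (s : Val) : (g^[n] s).size ≤ iterCost 1 g t n s + s.size := by
  induction n generalizing s with
  | zero => simp
  | succ n ih =>
    have h1 := ih (g s)
    have h2 := h s
    simp only [iterCost, Function.iterate_succ_apply]
    omega

/-- Every program is charged for reading its input, so a time bound also bounds the input. -/
theorem Prog.size_le_time (O : Val → Val) (pr : Prog) (x : Val) : x.size ≤ pr.time O x := by
  induction pr generalizing x with
  | comp g f hg hf => exact (hf x).trans (Nat.le_add_right _ _)
  | _ => simp only [Prog.time]; omega

/-- Every program is charged for writing its output, so a time bound also bounds the output.
Intermediate results of a composition therefore need no separate size estimates. -/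
theorem Prog.out_size_le_time (O : Val → Val) (pr : Prog) (x : Val) :
    (pr.out O x).size ≤ pr.time O x := by
  induction pr generalizing x with
  | comp g f hg hf => exact (hg _).trans (Nat.le_add_left _ _)
  | pair f g hf hg =>
    have h1 := hf x
    have h2 := hg x
    simp only [Prog.out, Prog.time, Val.size]
    omega
  | ite c f g hc hf hg =>
    simp only [Prog.out, Prog.time]
    split_ifs
    · have := hf x
      omega
    · have := hg x
      omega
  | fold f hf =>
    exact (foldOut_size_le (g := fun y => f.out O y) (t := fun y => f.time O y) hf _ _).trans
      (Nat.add_le_add_left x.size_snd_le _)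
  | iter f hf =>
    exact (iterOut_size_le (g := fun y => f.out O y) (t := fun y => f.time O y) hf _ _).trans
      (Nat.add_le_add_left x.size_snd_le _)
  | _ => simp only [Prog.out, Prog.time]; omega

/-- The output size of an arithmetic operation is polynomial as soon as it is on numbers. -/
theorem Val.size_arith_le {op : ℕ → ℕ → ℕ}
    (h : ∀ a b, Nat.size (op a b) ≤ Nat.size a + Nat.size b + 1) (x : Val) :
    (x.arith op).size ≤ 2 * x.size + 2 := by
  have h1 := h x.fst.toNat x.snd.toNat
  have h2 := x.fst.natSize_toNat_le
  have h3 := x.snd.natSize_toNat_le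
  have h4 := x.size_fst_le
  have h5 := x.size_snd_le
  simp only [Val.arith, Val.size]
  omega

/-- Loop-free programs run in polynomial time. -/
theorem Prog.time_of_simple (pr : Prog) (h : pr.simple = true) :
    PolyBd (fun i : (Val → Val) × Val => pr.time i.1 i.2) (fun i => i.2.size) := by
  have key : PolyBd (fun i : (Val → Val) × Val => 3 * i.2.size + 2) (fun i => i.2.size) :=
    ((PolyBd.const 3).mul (PolyBd.refl _)).add (.const 2)
  induction pr with
  | query => simp [Prog.simple] at h
  | rand => simp [Prog.simple] at h
  | fold f => simp [Prog.simple] at h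
  | iter f => simp [Prog.simple] at h
  | pair f g hf hg =>
    simp only [Prog.simple, Bool.and_eq_true] at h
    exact ((hf h.1).add ((hg h.2).add (.const 0))).add ((PolyBd.refl _).add (.const 1))
  | comp g f hg hf =>
    simp only [Prog.simple, Bool.and_eq_true] at h
    refine (hf h.2).add ?_
    refine ((hg h.1).pull fun i : (Val → Val) × Val => (i.1, f.out i.1 i.2)).trans ?_
    exact (hf h.2).of_le fun i => f.out_size_le_time _ _
  | ite c f g hc hf hg =>
    simp only [Prog.simple, Bool.and_eq_true] at h
    refine (((hc h.1).add ((hf h.2.1).add (hg h.2.2))).add (PolyBd.refl _)).of_le fun i => ?_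
    simp only [Prog.time]
    split_ifs <;> omega
  | id => exact key.of_le fun i => by simp only [Prog.time]; omega
  | const v => exact (PolyBd.refl _).add (.const _)
  | fst => exact key.of_le fun i => by have := i.2.size_fst_le; simp only [Prog.time]; omega
  | snd => exact key.of_le fun i => by have := i.2.size_snd_le; simp only [Prog.time]; omega
  | isPair =>
    refine key.of_le fun i => ?_
    rcases i with ⟨O, _ | _⟩ <;> simp only [Prog.time, Val.isPair, Val.size, Nat.size_zero,
      Nat.size_one] <;> omega
  | size =>
    refine key.of_le fun i => ?_
    have := Val.size_atom_le i.2.size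
    simp only [Prog.time]
    omega
  | add =>
    exact key.of_le fun i => by
      have := i.2.size_arith_le (op := (· + ·)) natSize_add_le; simp only [Prog.time]; omega
  | sub =>
    refine key.of_le fun i => ?_
    have := i.2.size_arith_le (op := (· - ·)) fun a b => by
      have := Nat.size_le_size (Nat.sub_le a b); omega
    simp only [Prog.time]; omega
  | mul =>
    refine key.of_le fun i => ?_
    have := i.2.size_arith_le (op := (· * ·)) fun a b => by
      have := natSize_mul_le a b; omega
    simp only [Prog.time]; omega
  | div =>
    refine key.of_le fun i => ?_
    have := i.2.size_arith_le (op := (· / ·)) fun a b => by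
      have := Nat.size_le_size (Nat.div_le_self a b); omega
    simp only [Prog.time]; omega
  | mod =>
    refine key.of_le fun i => ?_
    have := i.2.size_arith_le (op := (· % ·)) fun a b => by
      have := Nat.size_le_size (Nat.mod_le a b); omega
    simp only [Prog.time]; omega
  | le =>
    refine key.of_le fun i => ?_
    have := i.2.size_arith_le (op := fun a b => if a ≤ b then 1 else 0) fun a b => by
      split_ifs <;> simp
    simp only [Prog.time]; omega

/-! ### Families of computations in polynomial time -/

section

variable {ι : Type u} {ι' : Type v} {O : ι → Val → Val} {σ : ι → ℕ}

/-- The members of a family of values have size polynomial in `σ`. -/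
def Small (σ : ι → ℕ) (x : ι → Val) : Prop := PolyBd (fun i => (x i).size) σ

/-- With oracle `O i` and on input `x i` the program `pr` outputs `y i`, in time polynomial in
`σ i`, uniformly in `i`. -/
structure Computes (O : ι → Val → Val) (σ : ι → ℕ) (x : ι → Val) (pr : Prog) (y : ι → Val) :
    Prop where
  out_eq : ∀ i, pr.out (O i) (x i) = y i
  time_le : PolyBd (fun i => pr.time (O i) (x i)) σ

variable {x y z : ι → Val} {f g pr : Prog}

theorem Small.of_le {b : ι → ℕ} (hb : PolyBd b σ) (h : ∀ i, (x i).size ≤ b i) : Small σ x :=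
  PolyBd.of_le hb h

theorem Small.pair (hx : Small σ x) (hy : Small σ y) : Small σ (fun i => .pair (x i) (y i)) :=
  (PolyBd.add hx hy).add (.const 1)

theorem Small.fst (h : Small σ (fun i => .pair (x i) (y i))) : Small σ x :=
  PolyBd.of_le h fun i => by simp only [Val.size]; omega

theorem Small.snd (h : Small σ (fun i => .pair (x i) (y i))) : Small σ y :=
  PolyBd.of_le h fun i => by simp only [Val.size]; omega

theorem Small.atom {n : ι → ℕ} (h : PolyBd n σ) : Small σ (fun i => .atom (n i)) :=
  (h.add (.const 1)).of_le fun _ => Val.size_atom_le _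

theorem Small.pull (h : Small σ x) (k : ι' → ι) : Small (fun j => σ (k j)) (fun j => x (k j)) :=
  PolyBd.pull h k

namespace Computes

theorem small_in (h : Computes O σ x pr y) : Small σ x :=
  h.time_le.of_le fun _ => pr.size_le_time _ _

theorem small (h : Computes O σ x pr y) : Small σ y :=
  h.time_le.of_le fun i => by rw [← h.out_eq i]; exact pr.out_size_le_time _ _

theorem congr (h : Computes O σ x pr y) (hy : ∀ i, y i = z i) : Computes O σ x pr z :=
  ⟨fun i => (h.out_eq i).trans (hy i), h.time_le⟩

theorem pull (h : Computes O σ x pr y) (k : ι' → ι) :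
    Computes (fun j => O (k j)) (fun j => σ (k j)) (fun j => x (k j)) pr (fun j => y (k j)) :=
  ⟨fun j => h.out_eq (k j), h.time_le.pull k⟩

/-- Loop-free programs. -/
theorem simple (hx : Small σ x) (hp : pr.simple = true)
    (hy : ∀ i, pr.out (O i) (x i) = y i) : Computes O σ x pr y :=
  ⟨hy, ((pr.time_of_simple hp).pull fun i => (O i, x i)).trans hx⟩

/-- The size of `y` needs no separate bound, since all times are measured in `σ`. -/
theorem comp (hf : Computes O σ x f y) (hg : Computes O σ y g z) :
    Computes O σ x (.comp g f) z where
  out_eq i := by simp only [Prog.out, hf.out_eq, hg.out_eq]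
  time_le := (hf.time_le.add hg.time_le).of_le fun i => by simp only [Prog.time, hf.out_eq, le_refl]

theorem pair (hf : Computes O σ x f y) (hg : Computes O σ x g z) :
    Computes O σ x (.pair f g) (fun i => .pair (y i) (z i)) where
  out_eq i := by simp only [Prog.out, hf.out_eq, hg.out_eq]
  time_le := (hf.time_le.add (hg.time_le.add (.const 0))).add (hf.small_in.add (.const 1))

theorem fst (h : Computes O σ x f (fun i => .pair (y i) (z i))) :
    Computes O σ x (.comp .fst f) y :=
  h.comp (.simple h.small rfl fun _ => rfl)

theorem snd (h : Computes O σ x f (fun i => .pair (y i) (z i))) :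
    Computes O σ x (.comp .snd f) z :=
  h.comp (.simple h.small rfl fun _ => rfl)

theorem id (hx : Small σ x) : Computes O σ x .id x :=
  .simple hx rfl fun _ => rfl

theorem const (hx : Small σ x) (v : Val) : Computes O σ x (.const v) (fun _ => v) :=
  .simple hx rfl fun _ => rfl

theorem query (hx : Small σ x) (hy : Small σ y) (h : ∀ i, O i (x i) = y i) :
    Computes O σ x .query y where
  out_eq := h
  time_le := (hx.add hy).of_le fun i => by simp only [Prog.time, h, le_refl]

/-- In a conditional, each branch only has to be right where it is taken. -/
theorem ite {c : Prog} {b : ι → ℕ} (P : ι → Prop) (hc : Computes O σ x c (fun i => .atom (b i)))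
    (hP : ∀ i, b i ≠ 0 ↔ P i)
    (hf : Computes (fun i : {i // P i} => O i) (fun i => σ i) (fun i => x i) f (fun i => y i))
    (hg : Computes (fun i : {i // ¬ P i} => O i) (fun i => σ i) (fun i => x i) g (fun i => y i)) :
    Computes O σ x (.ite c f g) y where
  out_eq i := by
    have hb : (c.out (O i) (x i)).toNat ≠ 0 ↔ P i := by rw [hc.out_eq, ← hP]; rfl
    simp only [Prog.out]
    by_cases h : P i
    · rw [if_pos (hb.2 h)]
      exact hf.out_eq ⟨i, h⟩
    · rw [if_neg (mt hb.1 h)]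
      exact hg.out_eq ⟨i, h⟩
  time_le := by
    obtain ⟨a, ha⟩ := hf.time_le
    obtain ⟨b', hb'⟩ := hg.time_le
    have h1 : PolyBd (fun i => (σ i + 2) ^ a) σ := ⟨a, fun i => le_rfl⟩
    have h2 : PolyBd (fun i => (σ i + 2) ^ b') σ := ⟨b', fun i => le_rfl⟩
    refine ((hc.time_le.add (h1.add h2)).add hc.small_in).of_le fun i => ?_
    have hb : (c.out (O i) (x i)).toNat ≠ 0 ↔ P i := by rw [hc.out_eq, ← hP]; rfl
    simp only [Prog.time]
    by_cases h : P i
    · rw [if_pos (hb.2 h)]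
      have := ha ⟨i, h⟩
      simp only at this
      omega
    · rw [if_neg (mt hb.1 h)]
      have := hb' ⟨i, h⟩
      simp only at this
      omega

end Computes

/-! ### Lists -/

theorem size_ofList_cons (a : Val) (l : List Val) :
    (Val.ofList (a :: l)).size = a.size + (Val.ofList l).size + 1 := rfl

theorem size_ofList_append (l l' : List Val) :
    (Val.ofList (l ++ l')).size + 1 = (Val.ofList l).size + (Val.ofList l').size := by
  induction l with
  | nil => simp [Val.ofList, Val.size]; omega
  | cons a l ih => rw [List.cons_append, size_ofList_cons, size_ofList_cons]; omega

theorem size_ofList_reverse (l : List Val) :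
    (Val.ofList l.reverse).size = (Val.ofList l).size := by
  induction l with
  | nil => rfl
  | cons a l ih =>
    have := size_ofList_append l.reverse [a]
    simp only [List.reverse_cons, size_ofList_cons]
    simp only [Val.ofList, Val.size] at this
    simp at this
    omega

theorem size_ofList_le {l : List Val} {n b : ℕ} (hl : l.length ≤ n) (h : ∀ a ∈ l, a.size ≤ b) :
    (Val.ofList l).size ≤ n * (b + 1) + 1 := by
  induction l generalizing n with
  | nil => simp [Val.ofList, Val.size]
  | cons a l ih =>
    obtain _ | n := n
    · simp at hl
    have h1 := ih (by simpa using hl) fun a' ha' => h a' (by simp [ha'])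
    have h2 := h a (by simp)
    rw [size_ofList_cons, add_mul]
    omega

theorem length_le_size_ofList (l : List Val) : l.length ≤ (Val.ofList l).size := by
  induction l with
  | nil => simp
  | cons a l ih => rw [size_ofList_cons, List.length_cons]; omega

theorem size_le_size_ofList {l : List Val} {a : Val} (h : a ∈ l) :
    a.size ≤ (Val.ofList l).size := by
  induction l with
  | nil => simp at h
  | cons b l ih =>
    rw [size_ofList_cons]
    rcases List.mem_cons.1 h with rfl | h
    · omega
    · have := ih h
      omega

/-- A list is small if its length and the sizes of its items are polynomially bounded. -/
theorem Small.list {l : ι → List Val} {n b : ι → ℕ} (hn : PolyBd n σ) (hb : PolyBd b σ)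
    (h1 : ∀ i, (l i).length ≤ n i) (h2 : ∀ i, ∀ a ∈ l i, a.size ≤ b i) :
    Small σ (fun i => .ofList (l i)) :=
  .of_le ((hn.mul (hb.add (.const 1))).add (.const 1)) fun i => size_ofList_le (h1 i) (h2 i)

theorem Small.length {l : ι → List Val} (h : Small σ (fun i => .ofList (l i))) :
    PolyBd (fun i => (l i).length) σ :=
  PolyBd.of_le h fun _ => length_le_size_ofList _

/-! ### Loops -/

/-- The index set of the calls of the body in a family of folds over the lists `L i`: a state `b`
with the invariant `Inv`, reached after the items `pre`, and the next item `a`. -/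
structure FoldIdx {A : ι → Type v} {B : ι → Type w} (L : ∀ i, List (A i))
    (Inv : ∀ i, List (A i) → B i → Prop) where
  i : ι
  pre : List (A i)
  a : A i
  post : List (A i)
  eq : L i = pre ++ a :: post
  b : B i
  hb : Inv i pre b

theorem FoldIdx.mem {A : ι → Type v} {B : ι → Type w} {L : ∀ i, List (A i)}
    {Inv : ∀ i, List (A i) → B i → Prop} (j : FoldIdx L Inv) : j.a ∈ L j.i := by
  rw [j.eq]
  simp

theorem FoldIdx.prefix {A : ι → Type v} {B : ι → Type w} {L : ∀ i, List (A i)}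
    {Inv : ∀ i, List (A i) → B i → Prop} (j : FoldIdx L Inv) : j.pre <+: L j.i :=
  ⟨_, j.eq.symm⟩

/-- The rule for folds. The body only has to be right, and fast uniformly in the state, on states
that satisfy the invariant `Inv`. Since its time bound is in terms of `σ` and not of the preceding
state, the bounds do not compound over the passes of the loop. -/
theorem Computes.fold {A : ι → Type v} {B : ι → Type w} {body : Prog}
    (eA : ∀ i, A i → Val) (eB : ∀ i, B i → Val)
    (L : ∀ i, List (A i)) (s : ∀ i, B i) (step : ∀ i, B i → A i → B i)
    (Inv : ∀ i, List (A i) → B i → Prop) (h0 : ∀ i, Inv i [] (s i))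
    (hstep : ∀ i pre a b, a ∈ L i → Inv i pre b → Inv i (pre ++ [a]) (step i b a))
    (hx : Small σ (fun i => .pair (.ofList ((L i).map (eA i))) (eB i (s i))))
    (hbody : Computes (fun j : FoldIdx L Inv => O j.i) (fun j => σ j.i)
      (fun j => .pair (eA j.i j.a) (eB j.i j.b)) body (fun j => eB j.i (step j.i j.b j.a))) :
    Computes O σ (fun i => .pair (.ofList ((L i).map (eA i))) (eB i (s i))) (.fold body)
      (fun i => eB i ((L i).foldl (step i) (s i))) := by
  obtain ⟨c, hc⟩ := hbody.time_le
  have key : ∀ i post pre b, L i = pre ++ post → Inv i pre b →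
      foldOut (fun y => body.out (O i) y) (Val.ofList (post.map (eA i))) (eB i b) =
        eB i (post.foldl (step i) b) ∧
      foldCost 1 (fun y => body.out (O i) y) (fun y => body.time (O i) y)
        (Val.ofList (post.map (eA i))) (eB i b) ≤ post.length * ((σ i + 2) ^ c + 1) + 1 := by
    intro i post
    induction post with
    | nil => intro pre b _ _; simp [foldOut, foldCost, Val.ofList]
    | cons a post ih =>
      intro pre b hL hb
      have ho := hbody.out_eq ⟨i, pre, a, post, hL, b, hb⟩
      have ht := hc ⟨i, pre, a, post, hL, b, hb⟩
      simp only at ho ht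
      obtain ⟨h1, h2⟩ := ih (pre ++ [a]) (step i b a) (by simp [hL])
        (hstep i pre a b (by simp [hL]) hb)
      simp only [List.map_cons, Val.ofList, foldOut, foldCost, ho, h1, List.foldl_cons,
        List.length_cons, true_and]
      rw [add_mul]
      omega
  constructor
  · intro i
    exact (key i (L i) [] (s i) rfl (h0 i)).1
  · have h1 : PolyBd (fun i => (σ i + 2) ^ c) σ := ⟨c, fun i => le_rfl⟩
    have h2 := hx.fst.length
    simp only [List.length_map] at h2
    exact (((h2.mul (h1.add (.const 1))).add (.const 1)).add hx).of_le fun i =>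
      Nat.add_le_add_right (key i (L i) [] (s i) rfl (h0 i)).2 _

/-- The index set of the calls of the body in a family of iterations. -/
structure IterIdx {B : ι → Type w} (n : ι → ℕ) (Inv : ∀ i, ℕ → B i → Prop) where
  i : ι
  k : ℕ
  hk : k < n i
  b : B i
  hb : Inv i k b

/-- The rule for iterations, with an invariant as in `Computes.fold`. The number of passes `n i`
itself, and not its bit size, has to be polynomially bounded. -/
theorem Computes.iter {B : ι → Type w} {body : Prog} (eB : ∀ i, B i → Val) (n : ι → ℕ)
    (s : ∀ i, B i) (step : ∀ i, B i → B i)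
    (Inv : ∀ i, ℕ → B i → Prop) (h0 : ∀ i, Inv i 0 (s i))
    (hstep : ∀ i k b, k < n i → Inv i k b → Inv i (k + 1) (step i b))
    (hn : PolyBd n σ) (hx : Small σ (fun i => .pair (.atom (n i)) (eB i (s i))))
    (hbody : Computes (fun j : IterIdx n Inv => O j.i) (fun j => σ j.i)
      (fun j => eB j.i j.b) body (fun j => eB j.i (step j.i j.b))) :
    Computes O σ (fun i => .pair (.atom (n i)) (eB i (s i))) (.iter body)
      (fun i => eB i ((step i)^[n i] (s i))) := by
  obtain ⟨c, hc⟩ := hbody.time_le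
  have key : ∀ i m k b, n i = k + m → Inv i k b →
      (fun y => body.out (O i) y)^[m] (eB i b) = eB i ((step i)^[m] b) ∧
      iterCost 1 (fun y => body.out (O i) y) (fun y => body.time (O i) y) m (eB i b)
        ≤ m * ((σ i + 2) ^ c + 1) + 1 := by
    intro i m
    induction m with
    | zero => intro k b _ _; simp [iterCost]
    | succ m ih =>
      intro k b hL hb
      have ho := hbody.out_eq ⟨i, k, by omega, b, hb⟩
      have ht := hc ⟨i, k, by omega, b, hb⟩
      simp only at ho ht
      obtain ⟨h1, h2⟩ := ih (k + 1) (step i b) (by omega) (hstep i k b (by omega) hb)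
      simp only [Function.iterate_succ_apply, iterCost, ho, h1, true_and]
      rw [add_mul]
      omega
  constructor
  · intro i
    exact (key i (n i) 0 (s i) (by simp) (h0 i)).1
  · have h1 : PolyBd (fun i => (σ i + 2) ^ c) σ := ⟨c, fun i => le_rfl⟩
    exact (((hn.mul (h1.add (.const 1))).add (.const 1)).add hx).of_le fun i =>
      Nat.add_le_add_right (key i (n i) 0 (s i) (by simp) (h0 i)).2 _

end

/-! ### Loops with access to the surrounding variables -/

/-- Fold over the list `l` from the state `s`; the body is run on `(item, (state, input))`. -/
def foldE (body l s : Prog) : Prog :=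
  .comp .snd (.comp (.fold (.pair (.comp .fst .snd)
    (.comp body (.pair .fst (.pair (.comp .snd .snd) (.comp .fst .snd))))))
    (.pair l (.pair .id s)))

/-- Iterate `n` times from the state `s`; the body is run on `(state, input)`. -/
def iterE (body n s : Prog) : Prog :=
  .comp .snd (.comp (.iter (.pair .fst (.comp body (.pair .snd .fst))))
    (.pair n (.pair .id s)))

section

variable {ι : Type u} {O : ι → Val → Val} {σ : ι → ℕ} {x : ι → Val}

/-- The rule for folds whose body also sees the input. The invariant has to imply a polynomial
bound `g` for the size of the state; this makes the input of the body small, as is handed on to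
`hbody`. -/
theorem Computes.foldEnv {A : ι → Type v} {B : ι → Type w} {body l sp : Prog}
    (eA : ∀ i, A i → Val) (eB : ∀ i, B i → Val)
    (L : ∀ i, List (A i)) (s : ∀ i, B i) (step : ∀ i, B i → A i → B i)
    (Inv : ∀ i, List (A i) → B i → Prop)
    (hl : Computes O σ x l (fun i => .ofList ((L i).map (eA i))))
    (hs : Computes O σ x sp (fun i => eB i (s i)))
    (h0 : ∀ i, Inv i [] (s i))
    (hstep : ∀ i pre a b, a ∈ L i → Inv i pre b → Inv i (pre ++ [a]) (step i b a))
    {g : ι → ℕ} (hg : PolyBd g σ)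
    (hB : ∀ i pre b, pre <+: L i → Inv i pre b → (eB i b).size ≤ g i)
    (hbody : Small (fun j : FoldIdx L Inv => σ j.i)
        (fun j => .pair (eA j.i j.a) (.pair (eB j.i j.b) (x j.i))) →
      Computes (fun j : FoldIdx L Inv => O j.i) (fun j => σ j.i)
        (fun j => .pair (eA j.i j.a) (.pair (eB j.i j.b) (x j.i))) body
        (fun j => eB j.i (step j.i j.b j.a))) :
    Computes O σ x (foldE body l sp) (fun i => eB i ((L i).foldl (step i) (s i))) := by
  have hx := hl.small_in
  have hA : Small (fun j : FoldIdx L Inv => σ j.i) (fun j => eA j.i j.a) :=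
    .of_le (hl.small.pull fun j : FoldIdx L Inv => j.i) fun j =>
      size_le_size_ofList (List.mem_map_of_mem j.mem)
  have hB' : Small (fun j : FoldIdx L Inv => σ j.i) (fun j => eB j.i j.b) :=
    .of_le (hg.pull fun j : FoldIdx L Inv => j.i) fun j => hB _ _ _ j.prefix j.hb
  have hxp := hx.pull fun j : FoldIdx L Inv => j.i
  have h1 := hbody (hA.pair (hB'.pair hxp))
  refine Computes.comp ((hl.pair ((Computes.id hx).pair hs)).comp
    (Computes.fold eA (fun i b => .pair (x i) (eB i b)) L s step Inv h0 hstep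
      (hl.small.pair (hx.pair hs.small)) ?_)) ?_
  · have hin := hA.pair (hxp.pair hB')
    exact (Computes.simple hin rfl fun _ => rfl).pair
      ((Computes.simple hin rfl fun _ => rfl).comp h1)
  · refine .simple (hx.pair (.of_le hg fun i => hB i (L i) _ List.prefix_rfl ?_)) rfl fun _ => rfl
    have : ∀ (post pre : List (A i)) (b : B i), (∀ a ∈ post, a ∈ L i) → Inv i pre b →
        Inv i (pre ++ post) (post.foldl (step i) b) := by
      intro post
      induction post with
      | nil => intro pre b _ h; simpa using h
      | cons a post ih =>
        intro pre b hm h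
        have := ih (pre ++ [a]) (step i b a) (fun a' ha' => hm a' (by simp [ha']))
          (hstep i pre a b (hm a (by simp)) h)
        simpa using this
    exact this (L i) [] (s i) (fun _ h => h) (h0 i)

/-- The rule for iterations whose body also sees the input, as in `Computes.foldEnv`. -/
theorem Computes.iterEnv {B : ι → Type w} {body np sp : Prog} (eB : ∀ i, B i → Val) (n : ι → ℕ)
    (s : ∀ i, B i) (step : ∀ i, B i → B i) (Inv : ∀ i, ℕ → B i → Prop)
    (hnp : Computes O σ x np (fun i => .atom (n i)))
    (hs : Computes O σ x sp (fun i => eB i (s i)))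
    (hn : PolyBd n σ) (h0 : ∀ i, Inv i 0 (s i))
    (hstep : ∀ i k b, k < n i → Inv i k b → Inv i (k + 1) (step i b))
    {g : ι → ℕ} (hg : PolyBd g σ)
    (hB : ∀ i k b, k ≤ n i → Inv i k b → (eB i b).size ≤ g i)
    (hbody : Small (fun j : IterIdx n Inv => σ j.i) (fun j => .pair (eB j.i j.b) (x j.i)) →
      Computes (fun j : IterIdx n Inv => O j.i) (fun j => σ j.i)
        (fun j => .pair (eB j.i j.b) (x j.i)) body (fun j => eB j.i (step j.i j.b))) :
    Computes O σ x (iterE body np sp) (fun i => eB i ((step i)^[n i] (s i))) := by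
  have hx := hnp.small_in
  have hB' : Small (fun j : IterIdx n Inv => σ j.i) (fun j => eB j.i j.b) :=
    .of_le (hg.pull fun j : IterIdx n Inv => j.i) fun j => hB _ _ _ j.hk.le j.hb
  have hxp := hx.pull fun j : IterIdx n Inv => j.i
  have h1 := hbody (hB'.pair hxp)
  refine Computes.comp ((hnp.pair ((Computes.id hx).pair hs)).comp
    (Computes.iter (fun i b => .pair (x i) (eB i b)) n s step Inv h0 hstep hn
      (hnp.small.pair (hx.pair hs.small)) ?_)) ?_
  · have hin := hxp.pair hB'
    exact (Computes.simple hin rfl fun _ => rfl).pair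
      ((Computes.simple hin rfl fun _ => rfl).comp h1)
  · refine .simple (hx.pair (.of_le hg fun i => hB i (n i) _ le_rfl ?_)) rfl fun _ => rfl
    have : ∀ m ≤ n i, Inv i m ((step i)^[m] (s i)) := by
      intro m
      induction m with
      | zero => intro _; exact h0 i
      | succ m ih =>
        intro hm
        rw [Function.iterate_succ_apply']
        exact hstep i m _ (by omega) (ih (by omega))
    exact this _ le_rfl

end

/-! ### Library programs on lists -/

/-- `(a, b) ↦ a.reverse ++ b`. -/
def revAppendP : Prog := .fold .id

/-- The empty list. -/
def nilP : Prog := .const (.atom 0)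

/-- Reverse the list computed by `l`. -/
def revE (l : Prog) : Prog := .comp revAppendP (.pair l nilP)

/-- Concatenate two lists. -/
def appendE (a b : Prog) : Prog := .comp revAppendP (.pair (revE a) b)

/-- Concatenate the lists in a list of lists. -/
def flattenE (l : Prog) : Prog := revE (.comp (.fold revAppendP) (.pair l nilP))

/-- Apply the body to all items of a list; it is run on `(item, input)`. -/
def mapE (body l : Prog) : Prog :=
  revE (foldE (.pair (.comp body (.pair .fst (.comp .snd .snd))) (.comp .fst .snd)) l nilP)

/-- The list of the values of the body for `0, …, n - 1`; it is run on `(number, input)`. -/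
def tabE (body n : Prog) : Prog :=
  revE (.comp .snd (iterE
    (.pair (.comp .add (.pair (.const (.atom 1)) (.comp .fst .fst)))
      (.pair (.comp body (.pair (.comp .fst .fst) .snd)) (.comp .snd .fst)))
    n (.const (.pair (.atom 0) (.atom 0)))))

/-- The entry number `k` of the list `l`. -/
def nthE (k l : Prog) : Prog := .comp .fst (.comp (.iter .snd) (.pair k l))

/-- The length of a list. -/
def lenE (l : Prog) : Prog :=
  .comp (.fold (.comp .add (.pair (.const (.atom 1)) .snd))) (.pair l nilP)

/-- The index set of the calls of the body in a family of maps. -/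
structure MapIdx {ι : Type u} {A : ι → Type v} (L : ∀ i, List (A i)) where
  i : ι
  a : A i
  ha : a ∈ L i

/-- The index set of the calls of the body in a family of tabulations. -/
structure TabIdx {ι : Type u} (n : ι → ℕ) where
  i : ι
  k : Fin (n i)

namespace Computes

variable {ι : Type u} {O : ι → Val → Val} {σ : ι → ℕ} {x : ι → Val}

theorem revAppendRun {a b : ι → List Val}
    (hx : Small σ (fun i => .pair (.ofList (a i)) (.ofList (b i)))) :
    Computes O σ (fun i => .pair (.ofList (a i)) (.ofList (b i))) revAppendP
      (fun i => .ofList ((a i).reverse ++ b i)) := by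
  have h := Computes.fold (O := O) (σ := σ) (A := fun _ => Val) (B := fun _ => List Val)
    (body := .id) (fun _ v => v) (fun _ l => .ofList l) a b (fun _ l v => v :: l)
    (fun i pre l => l = pre.reverse ++ b i) (by simp) (by simp) (by simpa using hx) ?_
  · simp only [List.map_id'] at h
    refine h.congr fun i => ?_
    have : ∀ (l acc : List Val), l.foldl (fun l v => v :: l) acc = l.reverse ++ acc := by
      intro l
      induction l with
      | nil => simp
      | cons b l ih => intro acc; simp [ih]
    rw [this]
  · refine .simple ?_ rfl fun _ => rfl
    refine .of_le ((PolyBd.add hx hx).pull FoldIdx.i) fun j => ?_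
    have h1 := j.hb
    have h2 := size_le_size_ofList j.mem
    have h3 := size_ofList_append j.pre.reverse (b j.i)
    have h4 := size_ofList_append j.pre (j.a :: j.post)
    rw [← j.eq] at h4
    rw [size_ofList_reverse, ← h1] at h3
    simp only [Val.size]
    omega

theorem nil (hx : Small σ x) : Computes O σ x nilP (fun _ => .ofList []) :=
  .const hx _

theorem rev {l : Prog} {a : ι → List Val} (h : Computes O σ x l (fun i => .ofList (a i))) :
    Computes O σ x (revE l) (fun i => .ofList (a i).reverse) := by
  have h1 := h.pair (Computes.nil h.small_in)
  refine (h1.comp (revAppendRun h1.small)).congr fun i => by simp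

theorem append {l l' : Prog} {a b : ι → List Val} (h : Computes O σ x l (fun i => .ofList (a i)))
    (h' : Computes O σ x l' (fun i => .ofList (b i))) :
    Computes O σ x (appendE l l') (fun i => .ofList (a i ++ b i)) := by
  have h1 := h.rev.pair h'
  refine (h1.comp (revAppendRun h1.small)).congr fun i => by simp

theorem flatten {l : Prog} {a : ι → List (List Val)}
    (h : Computes O σ x l (fun i => .ofList ((a i).map .ofList))) :
    Computes O σ x (flattenE l) (fun i => .ofList (a i).flatten) := by
  have hsz : ∀ l : List (List Val),
      (Val.ofList l.flatten).size ≤ (Val.ofList (l.map .ofList)).size := by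
    intro l
    induction l with
    | nil => simp
    | cons b l ih =>
      have := size_ofList_append b l.flatten
      simp only [List.flatten_cons, List.map_cons, size_ofList_cons]
      omega
  have h1 := h.pair (Computes.nil h.small_in)
  have key : Computes O σ (fun i => .pair (.ofList ((a i).map .ofList)) (.ofList []))
      (.fold revAppendP)
      (fun i => .ofList ((a i).foldl (fun acc b => b.reverse ++ acc) [])) := by
    refine Computes.fold (A := fun _ => List Val) (B := fun _ => List Val)
      (fun _ l => .ofList l) (fun _ l => .ofList l) a (fun _ => [])
      (fun _ acc b => b.reverse ++ acc)
      (fun i pre l => l = pre.flatten.reverse) (by simp) (by simp) h1.small ?_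
    refine revAppendRun (.of_le ((PolyBd.add h.small h.small).pull FoldIdx.i) fun j => ?_)
    have h2 := size_le_size_ofList (List.mem_map_of_mem (f := Val.ofList) j.mem)
    have h3 := hsz j.pre
    have h4 := size_ofList_append (j.pre.map .ofList) ((j.a :: j.post).map .ofList)
    rw [← List.map_append, ← j.eq, List.map_cons, size_ofList_cons] at h4
    rw [← size_ofList_reverse, ← j.hb] at h3
    have h5 := (Val.ofList (j.post.map .ofList)).one_le_size
    simp only [Val.size]
    omega
  refine (h1.comp key).rev.congr fun i => ?_
  have : ∀ (l : List (List Val)) (acc : List Val),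
      l.foldl (fun acc b => b.reverse ++ acc) acc = l.flatten.reverse ++ acc := by
    intro l
    induction l with
    | nil => simp
    | cons b l ih => intro acc; simp [ih]
  simp [this]

/-- The outputs of the body are uniformly small by its time bound, and hence so are all the
partial results of the loop. -/
theorem map {A : ι → Type v} {body l : Prog} (eA : ∀ i, A i → Val) (L : ∀ i, List (A i))
    (f : ∀ i, A i → Val) (hl : Computes O σ x l (fun i => .ofList ((L i).map (eA i))))
    (hbody : Small (fun j : MapIdx L => σ j.i) (fun j => .pair (eA j.i j.a) (x j.i)) →
      Computes (fun j : MapIdx L => O j.i) (fun j => σ j.i)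
        (fun j => .pair (eA j.i j.a) (x j.i)) body (fun j => f j.i j.a)) :
    Computes O σ x (mapE body l) (fun i => .ofList ((L i).map (f i))) := by
  have hA : Small (fun j : MapIdx L => σ j.i) (fun j => eA j.i j.a) :=
    .of_le (hl.small.pull fun j : MapIdx L => j.i) fun j =>
      size_le_size_ofList (List.mem_map_of_mem j.ha)
  have h1 := hbody (hA.pair (hl.small_in.pull MapIdx.i))
  obtain ⟨c, hc⟩ := h1.small
  have hlen := hl.small.length
  simp only [List.length_map] at hlen
  have key := Computes.foldEnv (A := A) (B := fun _ => List Val)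
    (body := .pair (.comp body (.pair .fst (.comp .snd .snd))) (.comp .fst .snd))
    eA (fun _ l => .ofList l) L (fun _ => []) (fun i acc a => f i a :: acc)
    (fun i pre l => l = (pre.map (f i)).reverse) hl (Computes.nil hl.small_in)
    (by simp) (by simp)
    (g := fun i => (L i).length * ((σ i + 2) ^ c + 1) + 1)
    ((hlen.mul (PolyBd.add ⟨c, fun i => le_rfl⟩ (.const 1))).add (.const 1))
    (fun i pre b hp hb => by
      refine size_ofList_le ?_ ?_
      · rw [hb]
        simpa using hp.length_le
      · rw [hb]
        intro a ha
        obtain ⟨a', ha', rfl⟩ := List.mem_map.1 (List.mem_reverse.1 ha)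
        exact hc ⟨i, a', hp.subset ha'⟩)
    (fun hx => by
      refine Computes.pair (Computes.comp (Computes.simple hx rfl fun _ => rfl)
        (h1.pull fun j : FoldIdx L fun i pre l => l = (pre.map (f i)).reverse =>
          (⟨j.i, j.a, j.mem⟩ : MapIdx L))) ?_
      exact Computes.simple hx rfl fun _ => rfl)
  refine key.rev.congr fun i => ?_
  have : ∀ (l : List (A i)) (acc : List Val),
      l.foldl (fun acc a => f i a :: acc) acc = (l.map (f i)).reverse ++ acc := by
    intro l
    induction l with
    | nil => simp
    | cons b l ih => intro acc; simp [ih]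
  simp [this]

theorem tab {n : ι → ℕ} {body np : Prog} (f : ∀ i, Fin (n i) → Val)
    (hnp : Computes O σ x np (fun i => .atom (n i))) (hn : PolyBd n σ)
    (hbody : Small (fun j : TabIdx n => σ j.i) (fun j => .pair (.atom j.k) (x j.i)) →
      Computes (fun j : TabIdx n => O j.i) (fun j => σ j.i)
        (fun j => .pair (.atom j.k) (x j.i)) body (fun j => f j.i j.k)) :
    Computes O σ x (tabE body np) (fun i => .ofList (List.ofFn (f i))) := by
  have hA : Small (fun j : TabIdx n => σ j.i) (fun j => .atom (j.k : ℕ)) :=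
    .atom ((hn.pull fun j : TabIdx n => j.i).of_le fun j => j.k.2.le)
  have h1 := hbody (hA.pair (hnp.small_in.pull TabIdx.i))
  obtain ⟨c, hc⟩ := h1.small
  let f' : ∀ i, ℕ → Val := fun i k => if h : k < n i then f i ⟨k, h⟩ else .atom 0
  have key := Computes.iterEnv (B := fun _ => List Val)
    (body := .pair (.comp .add (.pair (.const (.atom 1)) (.comp .fst .fst)))
      (.pair (.comp body (.pair (.comp .fst .fst) .snd)) (.comp .snd .fst)))
    (fun _ l => .pair (.atom l.length) (.ofList l)) n (fun _ => [])
    (fun i acc => f' i acc.length :: acc)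
    (fun i k l => l = ((List.range k).map (f' i)).reverse) hnp (.const hnp.small_in _) hn
    (by simp) (fun i k b hk hb => by simp [hb, List.range_succ])
    (g := fun i => (n i + 1) + (n i * ((σ i + 2) ^ c + 1) + 1) + 1)
    (((hn.add (.const 1)).add ((hn.mul (PolyBd.add ⟨c, fun i => le_rfl⟩ (.const 1))).add
      (.const 1))).add (.const 1))
    (fun i k b hk hb => by
      have hlen : b.length = k := by simp [hb]
      have h1 := Val.size_atom_le k
      have h2 : (Val.ofList b).size ≤ n i * ((σ i + 2) ^ c + 1) + 1 := by
        refine size_ofList_le (by omega) ?_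
        rw [hb]
        intro a ha
        obtain ⟨a', ha', rfl⟩ := List.mem_map.1 (List.mem_reverse.1 ha)
        have ha'' : a' < n i := (List.mem_range.1 ha').trans_le hk
        simp only [f', ha'', dite_true]
        exact hc ⟨i, ⟨a', ha''⟩⟩
      simp only [hlen, Val.size] at h1 ⊢
      omega)
    (fun hx => by
      have hlen : ∀ j : IterIdx n (fun i k l => l = ((List.range k).map (f' i)).reverse),
        j.b.length = j.k := fun j => by rw [j.hb]; simp
      refine Computes.pair (Computes.simple hx rfl fun j => ?_)
        (Computes.pair ?_ (Computes.simple hx rfl fun _ => rfl))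
      · simp [Prog.out, Val.arith, Val.fst, Val.snd, Val.toNat, add_comm]
      · refine Computes.comp (y := fun j => .pair (.atom j.k) (x j.i))
          (Computes.simple hx rfl fun j => by rw [← hlen j]; rfl) ?_
        refine (h1.pull fun j : IterIdx n (fun i k l => l = ((List.range k).map (f' i)).reverse) =>
          (⟨j.i, ⟨j.k, j.hk⟩⟩ : TabIdx n)).congr fun j => ?_
        simp [f', hlen, j.hk])
  refine key.snd.rev.congr fun i => ?_
  have : ∀ m, (fun acc => f' i acc.length :: acc)^[m] [] = ((List.range m).map (f' i)).reverse := by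
    intro m
    induction m with
    | zero => simp
    | succ m ih => simp [Function.iterate_succ_apply', ih, List.range_succ]
  rw [this, List.reverse_reverse]
  congr 1
  refine List.ext_getElem (by simp) fun k h1 h2 => ?_
  simp at h1
  simp [f', h1]

/-- The entry has to exist: this also bounds the number of steps by the length of the list. -/
theorem nth {k l : Prog} {a : ι → List Val} {n : ι → ℕ} {y : ι → Val}
    (hk : Computes O σ x k (fun i => .atom (n i))) (hl : Computes O σ x l (fun i => .ofList (a i)))
    (h : ∀ i, (a i)[n i]? = some (y i)) : Computes O σ x (nthE k l) y := by
  have hn : PolyBd n σ := hl.small.length.of_le fun i => by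
    obtain ⟨h', _⟩ := List.getElem?_eq_some_iff.1 (h i)
    exact h'.le
  have key := Computes.iter (O := O) (B := fun _ => Val) (body := .snd) (fun _ v => v) n
    (fun i => .ofList (a i)) (fun _ => Val.snd) (fun i _ b => b.size ≤ (Val.ofList (a i)).size)
    (by simp) (fun i k b _ hb => b.size_snd_le.trans hb) hn (hk.small.pair hl.small)
    (.simple (.of_le (PolyBd.pull hl.small IterIdx.i) fun j => j.hb) rfl fun _ => rfl)
  refine ((hk.pair hl).comp key).comp (.simple key.small rfl fun i => ?_)
  have : ∀ (m : ℕ) (l : List Val) (v : Val), l[m]? = some v →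
      (Val.snd^[m] (.ofList l)).fst = v := by
    intro m
    induction m with
    | zero => intro l v h; cases l <;> simp_all [Val.ofList, Val.fst]
    | succ m ih =>
      intro l v h
      cases l with
      | nil => simp at h
      | cons b l => exact ih l v (by simpa using h)
  exact this _ _ _ (h i)

theorem nth_ofFn {k l : Prog} {N : ι → ℕ} {e : ∀ i, Fin (N i) → Val} {n : ∀ i, Fin (N i)}
    (hk : Computes O σ x k (fun i => .atom (n i)))
    (hl : Computes O σ x l (fun i => .ofList (List.ofFn (e i)))) :
    Computes O σ x (nthE k l) (fun i => e i (n i)) :=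
  hk.nth hl fun i => by simp

theorem len {l : Prog} {a : ι → List Val} (h : Computes O σ x l (fun i => .ofList (a i))) :
    Computes O σ x (lenE l) (fun i => .atom (a i).length) := by
  have h1 := h.pair (Computes.nil h.small_in)
  have hz := h.small
  have key := Computes.fold (O := O) (σ := σ) (A := fun _ => Val) (B := fun _ => ℕ)
    (body := .comp .add (.pair (.const (.atom 1)) .snd)) (fun _ v => v) (fun _ n => .atom n) a
    (fun _ => 0) (fun _ n _ => 1 + n) (fun i pre n => n = pre.length) (by simp)
    (by simp [add_comm]) (by simp only [List.map_id']; exact h1.small) (by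
      refine .simple ?_ rfl fun _ => rfl
      refine Small.pair (.of_le (PolyBd.pull hz FoldIdx.i) fun j => size_le_size_ofList j.mem) ?_
      exact .atom ((hz.length.pull FoldIdx.i).of_le fun j => by
        rw [j.hb]; exact j.prefix.length_le))
  simp only [List.map_id'] at key
  refine (h1.comp key).congr fun i => ?_
  have : ∀ (l : List Val) (n : ℕ), l.foldl (fun n _ => 1 + n) n = n + l.length := by
    intro l
    induction l with
    | nil => simp
    | cons b l ih => intro n; simp [ih]; omega
  simp [this]

end Computes

/-! ### Arithmetic of natural numbers -/

/-- The first component of the value computed by `a`. -/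
def fstE (a : Prog) : Prog := .comp .fst a
/-- The second component of the value computed by `a`. -/
def sndE (a : Prog) : Prog := .comp .snd a
/-- Addition of natural numbers. -/
def natAddE (a b : Prog) : Prog := .comp .add (.pair a b)
/-- Truncated subtraction of natural numbers. -/
def natSubE (a b : Prog) : Prog := .comp .sub (.pair a b)
/-- Multiplication of natural numbers. -/
def natMulE (a b : Prog) : Prog := .comp .mul (.pair a b)
/-- Division of natural numbers. -/
def natDivE (a b : Prog) : Prog := .comp .div (.pair a b)
/-- The remainder of natural numbers. -/
def natModE (a b : Prog) : Prog := .comp .mod (.pair a b)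
/-- A fixed natural number. -/
def numE (n : ℕ) : Prog := .const (.atom n)

namespace Computes

variable {ι : Type u} {O : ι → Val → Val} {σ : ι → ℕ} {x : ι → Val} {a b : Prog} {m n : ι → ℕ}

theorem natAdd (ha : Computes O σ x a (fun i => .atom (m i)))
    (hb : Computes O σ x b (fun i => .atom (n i))) :
    Computes O σ x (natAddE a b) (fun i => .atom (m i + n i)) :=
  (ha.pair hb).comp (.simple (ha.pair hb).small rfl fun _ => rfl)

theorem natSub (ha : Computes O σ x a (fun i => .atom (m i)))
    (hb : Computes O σ x b (fun i => .atom (n i))) :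
    Computes O σ x (natSubE a b) (fun i => .atom (m i - n i)) :=
  (ha.pair hb).comp (.simple (ha.pair hb).small rfl fun _ => rfl)

theorem natMul (ha : Computes O σ x a (fun i => .atom (m i)))
    (hb : Computes O σ x b (fun i => .atom (n i))) :
    Computes O σ x (natMulE a b) (fun i => .atom (m i * n i)) :=
  (ha.pair hb).comp (.simple (ha.pair hb).small rfl fun _ => rfl)

theorem natDiv (ha : Computes O σ x a (fun i => .atom (m i)))
    (hb : Computes O σ x b (fun i => .atom (n i))) :
    Computes O σ x (natDivE a b) (fun i => .atom (m i / n i)) :=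
  (ha.pair hb).comp (.simple (ha.pair hb).small rfl fun _ => rfl)

theorem natMod (ha : Computes O σ x a (fun i => .atom (m i)))
    (hb : Computes O σ x b (fun i => .atom (n i))) :
    Computes O σ x (natModE a b) (fun i => .atom (m i % n i)) :=
  (ha.pair hb).comp (.simple (ha.pair hb).small rfl fun _ => rfl)

theorem num (hx : Small σ x) (n : ℕ) : Computes O σ x (numE n) (fun _ => .atom n) :=
  .const hx _

end Computes

/-! ### Linear combinations of digit lists -/

/-- On input `(p, ((u, X), (v, Y)))` with lists of numbers `X` and `Y`, the list of the
`(u * X k + v * Y k) % p`, where `k` runs over the positions of `X`. -/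
def lcP : Prog := tabE
  (natModE (natAddE
    (natMulE (fstE (fstE (sndE .snd))) (nthE .fst (sndE (fstE (sndE .snd)))))
    (natMulE (fstE (sndE (sndE .snd))) (nthE .fst (sndE (sndE (sndE .snd))))))
    (fstE .snd))
  (lenE (sndE (fstE .snd)))

/-- The linear combination modulo `p` of two digit lists with natural coefficients. -/
def lcE (p u X v Y : Prog) : Prog := .comp lcP (.pair p (.pair (.pair u X) (.pair v Y)))

theorem Computes.lc {ι : Type u} {O : ι → Val → Val} {σ : ι → ℕ} {x : ι → Val}
    {pp up Xp vp Yp : Prog} {p u v : ι → ℕ} {N : ι → ℕ} {a b : ∀ i, Fin (N i) → ℕ}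
    {Y : ι → List Val}
    (hp : Computes O σ x pp (fun i => .atom (p i))) (hu : Computes O σ x up (fun i => .atom (u i)))
    (hX : Computes O σ x Xp (fun i => .ofList (List.ofFn fun k => .atom (a i k))))
    (hv : Computes O σ x vp (fun i => .atom (v i)))
    (hY : Computes O σ x Yp (fun i => .ofList (Y i)))
    (h : ∀ i k, (Y i)[(k : Fin (N i))]? = some (.atom (b i k))) :
    Computes O σ x (lcE pp up Xp vp Yp)
      (fun i => .ofList (List.ofFn fun k => .atom ((u i * a i k + v i * b i k) % p i))) := by
  have h0 := hp.pair ((hu.pair hX).pair (hv.pair hY))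
  have hN : PolyBd N σ := by simpa using hX.small.length
  refine h0.comp (Computes.tab _ ?_ hN fun hx => ?_)
  · have : Computes O σ _ _ _ := .simple (pr := fstE .snd) h0.small rfl fun _ => rfl
    refine (Computes.len (this.snd)).congr fun i => by simp
  · have hk : Computes (fun j : TabIdx N => O j.i) (fun j => σ j.i) _ .fst
      (fun j => .atom j.k) := .simple hx rfl fun _ => rfl
    have hXX := hk.nth_ofFn (e := fun j k => .atom (a j.i k)) (n := fun j => j.k)
      (Computes.simple (pr := sndE (fstE (sndE .snd))) hx rfl fun _ => rfl)
    have hYY := hk.nth (a := fun j => Y j.i) (y := fun j => .atom (b j.i j.k))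
      (Computes.simple (pr := sndE (sndE (sndE .snd))) hx rfl fun _ => rfl) fun j => h j.i j.k
    exact ((Computes.natMul (.simple hx rfl fun _ => rfl) hXX).natAdd
      (Computes.natMul (.simple hx rfl fun _ => rfl) hYY)).natMod (.simple hx rfl fun _ => rfl)

/-! ### Finite fields with a power basis -/

/-- A finite field `𝔽ₚ(g)`. -/
structure FieldCtx where
  p : ℕ
  [prime : Fact p.Prime]
  F : Type
  [field : Field F]
  [fintype : Fintype F]
  [algebra : Algebra (ZMod p) F]
  pb : PowerBasis (ZMod p) F

attribute [instance] FieldCtx.prime FieldCtx.field FieldCtx.fintype FieldCtx.algebra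

namespace FieldCtx

variable (K : FieldCtx)

/-- Equality is only decided classically in the mathematical functions such as `elimRows`; the
programs test it by `fNzE`. -/
noncomputable instance : DecidableEq K.F := Classical.decEq _

/-- The representation of field elements. -/
noncomputable def enc (x : K.F) : Val := encField K.pb x

/-- The description of the field. -/
noncomputable def desc : Val := descField K.pb

/-- The representation of vectors. -/
noncomputable def vec {N : ℕ} (v : Fin N → K.F) : Val := encPoint K.pb v

/-- The coordinate of `x` at `g ^ i`, as a natural number. -/
noncomputable def dig (x : K.F) (i : Fin K.pb.dim) : ℕ := (K.pb.basis.repr x i).val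

variable {K}

theorem enc_eq (x : K.F) : K.enc x = .ofList (List.ofFn fun i => .atom (K.dig x i)) := rfl

theorem vec_eq {N : ℕ} (v : Fin N → K.F) :
    K.vec v = .ofList (List.ofFn fun i => K.enc (v i)) := rfl

theorem dim_pos : 0 < K.pb.dim := K.pb.dim_pos

theorem cast_dig (x : K.F) (i : Fin K.pb.dim) :
    ((K.dig x i : ℕ) : ZMod K.p) = K.pb.basis.repr x i := ZMod.natCast_zmod_val _

theorem dig_eq_of_cast {x : K.F} {i : Fin K.pb.dim} {n : ℕ}
    (h : K.pb.basis.repr x i = n) : K.dig x i = n % K.p := by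
  rw [dig, h, ZMod.val_natCast]

theorem dig_lt (x : K.F) (i : Fin K.pb.dim) : K.dig x i < K.p := ZMod.val_lt _

/-- The digits of a linear combination with natural coefficients are computed digit by digit.
Subtraction is the case of the coefficient `p - 1`. -/
theorem dig_lc (u v : ℕ) (x y : K.F) (i : Fin K.pb.dim) :
    K.dig (u * x + v * y) i = (u * K.dig x i + v * K.dig y i) % K.p := by
  apply dig_eq_of_cast
  have h : (u : K.F) * x + v * y = (u : ZMod K.p) • x + (v : ZMod K.p) • y := by
    rw [Nat.cast_smul_eq_nsmul, Nat.cast_smul_eq_nsmul, nsmul_eq_mul, nsmul_eq_mul]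
  rw [h, map_add, map_smul, map_smul]
  simp [cast_dig]

theorem cast_p : ((K.p : ℕ) : K.F) = 0 := by
  rw [← map_natCast (algebraMap (ZMod K.p) K.F), ZMod.natCast_self, map_zero]

theorem cast_p_sub_one : ((K.p - 1 : ℕ) : K.F) = -1 := by
  rw [Nat.cast_sub K.prime.out.one_le, cast_p]
  simp

theorem cast_p_sub_dig (x : K.F) (i : Fin K.pb.dim) :
    ((K.p - K.dig x i : ℕ) : ZMod K.p) = - K.pb.basis.repr x i := by
  rw [Nat.cast_sub (dig_lt x i).le, cast_dig]
  simp

theorem sum_dig (x : K.F) : ∑ i, (K.dig x i : K.F) * K.pb.gen ^ (i : ℕ) = x := by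
  conv_rhs => rw [← K.pb.basis.sum_repr x]
  refine Finset.sum_congr rfl fun i _ => ?_
  rw [← cast_dig, K.pb.coe_basis, Nat.cast_smul_eq_nsmul, nsmul_eq_mul]

theorem dig_zero (i : Fin K.pb.dim) : K.dig 0 i = 0 := by simp [dig]

theorem dig_one (i : Fin K.pb.dim) : K.dig 1 i = if (i : ℕ) ≠ 0 then 0 else 1 := by
  have h1 : (1 : K.F) = K.pb.basis ⟨0, dim_pos⟩ := by simp
  have : Fact (1 < K.p) := ⟨K.prime.out.one_lt⟩
  rw [dig, h1, Module.Basis.repr_self, Finsupp.single_apply]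
  by_cases h : (i : ℕ) = 0
  · rw [if_pos (by ext; exact h.symm), if_neg (by simpa using h), ZMod.val_one]
  · rw [if_neg (fun h' => h (by rw [← h'])), if_pos h, ZMod.val_zero]

theorem eq_zero_iff_dig (x : K.F) : x = 0 ↔ ∀ i, K.dig x i = 0 := by
  constructor
  · rintro rfl
    exact dig_zero
  · intro h
    rw [← sum_dig x]
    simp [h]

/-- The coefficients of the minimal polynomial of the generator, as natural numbers. -/
noncomputable def mcoeff (K : FieldCtx) (i : ℕ) : ℕ := ((minpoly (ZMod K.p) K.pb.gen).coeff i).val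

theorem desc_eq : K.desc = .pair (.atom K.p)
    (.ofList (List.ofFn fun i : Fin (K.pb.dim + 1) => .atom (K.mcoeff i))) := rfl

/-- Multiplication by the generator shifts the digits and subtracts a multiple of the minimal
polynomial. -/
theorem dig_mul_gen (c : K.F) (i : Fin K.pb.dim) :
    K.dig (c * K.pb.gen) i =
      (1 * (if h : (i : ℕ) = 0 then 0 else K.dig c ⟨i - 1, by omega⟩) +
        (K.p - K.dig c ⟨K.pb.dim - 1, by have := K.dim_pos; omega⟩) * K.mcoeff i) % K.p := by
  have hk : 0 < K.pb.dim := K.dim_pos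
  set g := K.pb.gen with hg
  let A : ℕ → ZMod K.p := fun n => if h : n < K.pb.dim then K.pb.basis.repr c ⟨n, h⟩ else 0
  let s : ℕ → ZMod K.p := fun n => if n = 0 then 0 else A (n - 1)
  have hc : c = ∑ n ∈ Finset.range K.pb.dim, A n • g ^ n := by
    rw [← Fin.sum_univ_eq_sum_range (fun n => A n • g ^ n)]
    conv_lhs => rw [← K.pb.basis.sum_repr c]
    refine Finset.sum_congr rfl fun i _ => ?_
    simp [A, K.pb.coe_basis, hg]
  have hmin : g ^ K.pb.dim =
      - ∑ n ∈ Finset.range K.pb.dim, (minpoly (ZMod K.p) g).coeff n • g ^ n := by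
    have h := minpoly.aeval (ZMod K.p) g
    rw [Polynomial.aeval_eq_sum_range, K.pb.natDegree_minpoly, Finset.sum_range_succ] at h
    have hm := minpoly.monic K.pb.isIntegral_gen
    have hm' : (minpoly (ZMod K.p) g).coeff K.pb.dim = 1 := by
      rw [← K.pb.natDegree_minpoly]; exact hm
    rw [hm', one_smul] at h
    exact eq_neg_of_add_eq_zero_right h
  have hmul : c * g = ∑ n ∈ Finset.range K.pb.dim,
      (s n - A (K.pb.dim - 1) * (minpoly (ZMod K.p) g).coeff n) • g ^ n := by
    have h1 : c * g = ∑ n ∈ Finset.range (K.pb.dim + 1), s n • g ^ n := by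
      rw [Finset.sum_range_succ', hc, Finset.sum_mul]
      simp [s, pow_succ]
    rw [h1, Finset.sum_range_succ, hmin]
    simp only [sub_smul, Finset.sum_sub_distrib, mul_smul, ← Finset.smul_sum]
    simp [s, hk.ne', sub_eq_add_neg]
  apply dig_eq_of_cast
  rw [hmul, ← Fin.sum_univ_eq_sum_range
    (fun n => (s n - A (K.pb.dim - 1) * (minpoly (ZMod K.p) g).coeff n) • g ^ n)]
  have h2 : ∀ n : Fin K.pb.dim, g ^ (n : ℕ) = K.pb.basis n := fun n => by simp [hg]
  simp only [h2, Module.Basis.repr_sum_self]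
  have h3 : ((K.mcoeff i : ℕ) : ZMod K.p) = (minpoly (ZMod K.p) g).coeff i :=
    ZMod.natCast_zmod_val _
  rw [one_mul, Nat.cast_add, Nat.cast_mul, cast_p_sub_dig, h3, sub_eq_add_neg, neg_mul]
  congr 1
  · by_cases hi : (i : ℕ) = 0
    · simp [s, hi]
    · have : (i : ℕ) - 1 < K.pb.dim := by omega
      simp [s, hi, A, cast_dig, this]
  · have : K.pb.dim - 1 < K.pb.dim := by omega
    simp [A, this]

/-- Evaluation of the digits by Horner's rule gives the product. -/
theorem horner (x y : K.F) :
    (List.ofFn (K.dig x)).reverse.foldl (fun acc (a : ℕ) => acc * K.pb.gen + (a : K.F) * y) 0 =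
      x * y := by
  have : ∀ (k : ℕ) (a : Fin k → ℕ),
      (List.ofFn a).foldr (fun (a : ℕ) acc => acc * K.pb.gen + (a : K.F) * y) 0 =
        (∑ i, (a i : K.F) * K.pb.gen ^ (i : ℕ)) * y := by
    intro k
    induction k with
    | zero => simp
    | succ k ih =>
      intro a
      rw [List.ofFn_succ, List.foldr_cons, ih, Fin.sum_univ_succ]
      simp only [Fin.val_succ, pow_succ, ← mul_assoc, ← Finset.sum_mul]
      simp
      ring
  rw [List.foldl_reverse, this, sum_dig]

/-- The representation of a field element is polynomially bounded in the description of the field,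
whatever computation it comes from. -/
theorem size_enc_le (x : K.F) : (K.enc x).size ≤ K.desc.size * (K.desc.size + 1) + 1 := by
  have h1 : Nat.size K.p + 1 + 1 ≤ K.desc.size := by
    have := (Val.ofList (List.ofFn fun i : Fin (K.pb.dim + 1) =>
      Val.atom (K.mcoeff i))).one_le_size
    rw [desc_eq]
    simp only [Val.size] at this ⊢
    omega
  have h2 : K.pb.dim ≤ K.desc.size := by
    have := length_le_size_ofList (List.ofFn fun i : Fin (K.pb.dim + 1) =>
      Val.atom (K.mcoeff i))
    rw [desc_eq]
    simp only [Val.size, List.length_ofFn] at this ⊢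
    omega
  refine size_ofList_le (by simpa using h2) ?_
  intro a ha
  obtain ⟨i, rfl⟩ := (List.mem_ofFn' _ _).1 ha
  have := Nat.size_le_size (dig_lt x i).le
  simp only [Val.size]
  exact le_trans (by simpa [dig] using this) (by omega : Nat.size K.p + 1 ≤ _)

end FieldCtx

/-! ### Field arithmetic -/

/-- The zero of the field with description `D`. -/
def fZeroE (D : Prog) : Prog := tabE (numE 0) (natSubE (lenE (sndE D)) (numE 1))
/-- The one of the field with description `D`. -/
def fOneE (D : Prog) : Prog :=
  tabE (.ite .fst (numE 0) (numE 1)) (natSubE (lenE (sndE D)) (numE 1))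
/-- Addition in the field with description `D`. -/
def fAddE (D a b : Prog) : Prog := lcE (fstE D) (numE 1) a (numE 1) b
/-- Subtraction in the field with description `D`. -/
def fSubE (D a b : Prog) : Prog := lcE (fstE D) (numE 1) a (natSubE (fstE D) (numE 1)) b

/-- On input `(D, c)`, the product of `c` and the generator. -/
def mulGenP : Prog :=
  lcE (fstE .fst) (numE 1)
    (tabE (.ite .fst (nthE (natSubE .fst (numE 1)) (sndE .snd)) (numE 0)) (lenE .snd))
    (natSubE (fstE .fst) (nthE (natSubE (lenE .snd) (numE 1)) .snd))
    (sndE .fst)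

/-- On input `(D, (x, y))`, the product of `x` and `y`, by Horner's rule. -/
def fMulP : Prog :=
  foldE
    (lcE (fstE (fstE (sndE .snd))) (numE 1)
      (.comp mulGenP (.pair (fstE (sndE .snd)) (fstE .snd)))
      .fst (sndE (sndE (sndE .snd))))
    (revE (fstE .snd)) (fZeroE .fst)

/-- Multiplication in the field with description `D`. -/
def fMulE (D a b : Prog) : Prog := .comp fMulP (.pair D (.pair a b))

/-- `1` for a nonzero field element and `0` for zero. -/
def fNzE (a : Prog) : Prog :=
  .comp (.fold (.ite .fst (numE 1) .snd)) (.pair a (numE 0))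

/-- On input `(D, (c, e))`, the power `c ^ e`, by repeated squaring; the state is
`(exponent, (base, accumulator))`. -/
def fPowP : Prog :=
  sndE (sndE (iterE
    (.pair (natDivE (fstE .fst) (numE 2))
      (.pair (fMulE (fstE .snd) (fstE (sndE .fst)) (fstE (sndE .fst)))
        (.ite (natModE (fstE .fst) (numE 2))
          (fMulE (fstE .snd) (sndE (sndE .fst)) (fstE (sndE .fst)))
          (sndE (sndE .fst)))))
    (.comp .size (sndE .snd))
    (.pair (sndE .snd) (.pair (fstE .snd) (fOneE .fst)))))

/-- Powers in the field with description `D`. -/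
def fPowE (D c e : Prog) : Prog := .comp fPowP (.pair D (.pair c e))

section

variable {ι : Type u} {O : ι → Val → Val} {σ : ι → ℕ} {x : ι → Val} {K : ι → FieldCtx}
  {D a b : Prog} {X Y : ∀ i, (K i).F}

theorem Small.enc (hD : Small σ (fun i => (K i).desc)) (X : ∀ i, (K i).F) :
    Small σ (fun i => (K i).enc (X i)) :=
  .of_le ((hD.mul (hD.add (.const 1))).add (.const 1)) fun i => (K i).size_enc_le (X i)

theorem Small.dim (hD : Small σ (fun i => (K i).desc)) : PolyBd (fun i => (K i).pb.dim) σ := by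
  have := Small.length (σ := σ) (Small.snd hD)
  exact PolyBd.of_le this fun i => by simp

namespace Computes

theorem desc_p (hD : Computes O σ x D (fun i => (K i).desc)) :
    Computes O σ x (fstE D) (fun i => .atom (K i).p) := Computes.fst hD

theorem desc_dim (hD : Computes O σ x D (fun i => (K i).desc)) :
    Computes O σ x (natSubE (lenE (sndE D)) (numE 1))
      (fun i => .atom (K i).pb.dim) := by
  refine (((Computes.snd hD).len).natSub (.num hD.small_in 1)).congr fun i => ?_
  simp

theorem fZero (hD : Computes O σ x D (fun i => (K i).desc)) :
    Computes O σ x (fZeroE D) (fun i => (K i).enc 0) := by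
  refine (Computes.tab (fun i k => .atom 0) hD.desc_dim hD.small.dim fun hx => .num hx 0).congr
    fun i => ?_
  rw [FieldCtx.enc_eq]
  simp [FieldCtx.dig_zero]

theorem fOne (hD : Computes O σ x D (fun i => (K i).desc)) :
    Computes O σ x (fOneE D) (fun i => (K i).enc 1) := by
  refine Computes.tab (fun i k => .atom ((K i).dig 1 k)) hD.desc_dim hD.small.dim
    fun hx => .simple hx rfl fun i => ?_
  rw [FieldCtx.dig_one]
  simp only [Prog.out, numE, Val.fst, Val.toNat]
  split_ifs <;> rfl

theorem encLC {up vp : Prog} {u v : ι → ℕ} (hD : Computes O σ x D (fun i => (K i).desc))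
    (hu : Computes O σ x up (fun i => .atom (u i))) (hv : Computes O σ x vp (fun i => .atom (v i)))
    (ha : Computes O σ x a (fun i => (K i).enc (X i)))
    (hb : Computes O σ x b (fun i => (K i).enc (Y i))) :
    Computes O σ x (lcE (fstE D) up a vp b)
      (fun i => (K i).enc (u i * X i + v i * Y i)) := by
  refine (Computes.lc (a := fun i => (K i).dig (X i)) (b := fun i => (K i).dig (Y i))
    (Y := fun i => List.ofFn fun k => .atom ((K i).dig (Y i) k))
    hD.desc_p hu ha hv hb fun i k => by simp).congr fun i => ?_
  rw [FieldCtx.enc_eq]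
  simp only [FieldCtx.dig_lc]

theorem fAdd (hD : Computes O σ x D (fun i => (K i).desc))
    (ha : Computes O σ x a (fun i => (K i).enc (X i)))
    (hb : Computes O σ x b (fun i => (K i).enc (Y i))) :
    Computes O σ x (fAddE D a b) (fun i => (K i).enc (X i + Y i)) :=
  (encLC hD (.num hD.small_in 1) (.num hD.small_in 1) ha hb).congr fun i => by simp

theorem fSub (hD : Computes O σ x D (fun i => (K i).desc))
    (ha : Computes O σ x a (fun i => (K i).enc (X i)))
    (hb : Computes O σ x b (fun i => (K i).enc (Y i))) :
    Computes O σ x (fSubE D a b) (fun i => (K i).enc (X i - Y i)) :=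
  (encLC hD (.num hD.small_in 1) (hD.desc_p.natSub (.num hD.small_in 1)) ha hb).congr fun i => by
    rw [FieldCtx.cast_p_sub_one]
    simp [sub_eq_add_neg]

theorem mulGenRun (hD : Small σ (fun i => (K i).desc)) (X : ∀ i, (K i).F) :
    Computes O σ (fun i => .pair (K i).desc ((K i).enc (X i))) mulGenP
      (fun i => (K i).enc (X i * (K i).pb.gen)) := by
  have hx := hD.pair (hD.enc X)
  have hDp : Computes O σ _ .fst (fun i => (K i).desc) := .simple hx rfl fun _ => rfl
  have hc : Computes O σ (fun i => .pair (K i).desc ((K i).enc (X i))) .snd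
    (fun i => .ofList (List.ofFn fun k => .atom ((K i).dig (X i) k))) := .simple hx rfl fun _ => rfl
  have hlen : Computes O σ (fun i => .pair (K i).desc ((K i).enc (X i))) (lenE .snd)
    (fun i => .atom (K i).pb.dim) := hc.len.congr fun i => by simp
  refine (Computes.lc
    (a := fun i k => if h : (k : ℕ) = 0 then 0 else (K i).dig (X i) ⟨k - 1, by omega⟩)
    (b := fun i k => (K i).mcoeff k)
    (Y := fun i => List.ofFn fun k : Fin ((K i).pb.dim + 1) => .atom ((K i).mcoeff k))
    (N := fun i => (K i).pb.dim)
    hDp.desc_p (.num hx 1) (Computes.tab _ hlen hD.dim fun hx' => ?_)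
    (hDp.desc_p.natSub
      (n := fun i => (K i).dig (X i) ⟨(K i).pb.dim - 1, by have := (K i).dim_pos; omega⟩)
      ((hlen.natSub (.num hx 1)).nth hc fun i => ?_))
    hDp.snd fun i k => ?_).congr fun i => ?_
  · refine Computes.ite (fun j => (j.k : ℕ) ≠ 0) (Computes.simple hx' rfl fun _ => rfl)
      (fun _ => Iff.rfl) ?_ ?_
    · refine Computes.nth (n := fun j => j.1.k - 1)
        (a := fun j => List.ofFn fun k => .atom ((K j.1.i).dig (X j.1.i) k))
        (Computes.natSub (m := fun j => j.1.k) (.simple (hx'.pull Subtype.val) rfl fun _ => rfl)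
          (.num (hx'.pull Subtype.val) 1))
        (.simple (hx'.pull Subtype.val) rfl fun _ => rfl) fun j => ?_
      have h1 := j.1.k.2
      have h2 := j.2
      have h3 : (j.1.k : ℕ) - 1 < (K j.1.i).pb.dim := by omega
      simp [h2, h3]
    · refine (Computes.num (hx'.pull Subtype.val) 0).congr fun j => ?_
      have h2 := not_not.1 j.2
      simp [h2]
  · have := (K i).dim_pos
    have h3 : (K i).pb.dim - 1 < (K i).pb.dim := by omega
    simp [h3]
  · have h3 : (k : ℕ) < (K i).pb.dim + 1 := by omega
    exact (List.getElem?_eq_some_iff.2 ⟨by simp, by simp only [List.getElem_ofFn]⟩)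
  · rw [FieldCtx.enc_eq]
    simp only [FieldCtx.dig_mul_gen]

theorem fMulRun (hD : Small σ (fun i => (K i).desc)) (X Y : ∀ i, (K i).F) :
    Computes O σ (fun i => .pair (K i).desc (.pair ((K i).enc (X i)) ((K i).enc (Y i)))) fMulP
      (fun i => (K i).enc (X i * Y i)) := by
  have hx := hD.pair ((hD.enc X).pair (hD.enc Y))
  have key := Computes.foldEnv (O := O) (σ := σ) (A := fun _ => ℕ) (B := fun i => (K i).F)
    (x := fun i => .pair (K i).desc (.pair ((K i).enc (X i)) ((K i).enc (Y i))))
    (body := lcE (fstE (fstE (sndE .snd))) (numE 1)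
      (.comp mulGenP (.pair (fstE (sndE .snd)) (fstE .snd)))
      .fst (sndE (sndE (sndE .snd))))
    (l := revE (fstE .snd)) (sp := fZeroE .fst)
    (fun _ n => .atom n) (fun i => (K i).enc) (fun i => (List.ofFn ((K i).dig (X i))).reverse)
    (fun i => 0) (fun i acc a => acc * (K i).pb.gen + (a : (K i).F) * Y i) (fun _ _ _ => True)
    (by
      refine (Computes.rev (Computes.simple hx rfl fun _ => rfl)).congr fun i => ?_
      rw [List.map_reverse, List.map_ofFn]
      rfl)
    (.fZero (.simple hx rfl fun _ => rfl)) (fun _ => trivial) (fun _ _ _ _ _ _ => trivial)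
    ((hD.mul (hD.add (.const 1))).add (.const 1))
    (fun i _ b _ _ => (K i).size_enc_le b) (fun hx' => by
      have hD' := hD.pull (FoldIdx.i (L := fun i => (List.ofFn ((K i).dig (X i))).reverse)
        (B := fun i => (K i).F) (Inv := fun _ _ _ => True))
      refine (encLC (D := fstE (sndE .snd)) (K := fun j => K j.i) (u := fun _ => 1)
        (v := fun j => j.a) (a := .comp mulGenP (.pair (fstE (sndE .snd)) (fstE .snd)))
        (b := sndE (sndE (sndE .snd))) (vp := .fst) (X := fun j => j.b * (K j.i).pb.gen)
        (Y := fun j => Y j.i)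
        (.simple hx' rfl fun _ => rfl) (.num hx' 1)
        (.simple hx' rfl fun _ => rfl) (.comp (.simple hx' rfl fun _ => rfl) (mulGenRun hD' _))
        (.simple hx' rfl fun _ => rfl)).congr fun j => ?_
      simp)
  exact key.congr fun i => by rw [FieldCtx.horner]

theorem fMul (hD : Computes O σ x D (fun i => (K i).desc))
    (ha : Computes O σ x a (fun i => (K i).enc (X i)))
    (hb : Computes O σ x b (fun i => (K i).enc (Y i))) :
    Computes O σ x (fMulE D a b) (fun i => (K i).enc (X i * Y i)) :=
  (hD.pair (ha.pair hb)).comp (fMulRun hD.small X Y)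

theorem fNz (ha : Computes O σ x a (fun i => (K i).enc (X i))) :
    Computes O σ x (fNzE a) (fun i => .atom (if X i = 0 then 0 else 1)) := by
  have h1 := ha.pair (.num ha.small_in 0)
  have hlist : ∀ i, (K i).enc (X i) = .ofList ((List.ofFn ((K i).dig (X i))).map .atom) := by
    intro i
    rw [FieldCtx.enc_eq, List.map_ofFn]
    rfl
  simp only [hlist] at h1 ha
  have key := Computes.fold (O := O) (σ := σ) (A := fun _ => ℕ) (B := fun _ => ℕ)
    (body := .ite .fst (numE 1) .snd)
    (fun _ => .atom) (fun _ => .atom) (fun i => List.ofFn ((K i).dig (X i))) (fun _ => 0)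
    (fun _ b a => if a ≠ 0 then 1 else b) (fun _ _ b => b ≤ 1) (by simp)
    (by intro i pre a b _ hb; split_ifs <;> omega) h1.small (by
      refine .simple (Small.pair ?_ ?_) rfl fun j => ?_
      · exact .of_le (PolyBd.pull ha.small FoldIdx.i) fun j =>
          size_le_size_ofList (List.mem_map_of_mem j.mem)
      · exact .atom ((PolyBd.const 1).of_le fun j => j.hb)
      · simp only [Prog.out, Val.fst, Val.toNat, numE, Val.snd]
        split_ifs <;> rfl)
  refine (h1.comp key).congr fun i => ?_
  have : ∀ (l : List ℕ) (b : ℕ), b ≤ 1 → l.foldl (fun b a => if a ≠ 0 then 1 else b) b =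
      if b = 0 ∧ ∀ a ∈ l, a = 0 then 0 else 1 := by
    intro l
    induction l with
    | nil => intro b hb; by_cases h : b = 0 <;> simp [h]; omega
    | cons a l ih =>
      intro b hb
      rw [List.foldl_cons, ih _ (by split_ifs <;> omega)]
      by_cases ha : a = 0 <;> simp [ha]
  rw [this _ _ (by omega)]
  simp [FieldCtx.eq_zero_iff_dig]

/-- The number of squarings is the bit size of the exponent, which therefore may be as large as
the field. -/
theorem fPowRun (hD : Small σ (fun i => (K i).desc)) (X : ∀ i, (K i).F) (e : ι → ℕ)
    (he : Small σ (fun i => .atom (e i))) :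
    Computes O σ (fun i => .pair (K i).desc (.pair ((K i).enc (X i)) (.atom (e i)))) fPowP
      (fun i => (K i).enc (X i ^ e i)) := by
  have hx := hD.pair ((hD.enc X).pair he)
  have key := Computes.iterEnv (O := O) (σ := σ) (B := fun i => ℕ × (K i).F × (K i).F)
    (x := fun i => .pair (K i).desc (.pair ((K i).enc (X i)) (.atom (e i))))
    (body := .pair (natDivE (fstE .fst) (numE 2))
      (.pair (fMulE (fstE .snd) (fstE (sndE .fst)) (fstE (sndE .fst)))
        (.ite (natModE (fstE .fst) (numE 2))
          (fMulE (fstE .snd) (sndE (sndE .fst)) (fstE (sndE .fst)))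
          (sndE (sndE .fst)))))
    (np := .comp .size (sndE .snd))
    (sp := .pair (sndE .snd) (.pair (fstE .snd) (fOneE .fst)))
    (fun i s => .pair (.atom s.1) (.pair ((K i).enc s.2.1) ((K i).enc s.2.2)))
    (fun i => (Val.atom (e i)).size) (fun i => (e i, X i, 1))
    (fun i s => (s.1 / 2, s.2.1 * s.2.1, if s.1 % 2 ≠ 0 then s.2.2 * s.2.1 else s.2.2))
    (fun i _ s => s.1 ≤ e i)
    (.simple hx rfl fun _ => rfl)
    (.pair (.simple hx rfl fun _ => rfl) (.pair (.simple hx rfl fun _ => rfl)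
      (.fOne (.simple hx rfl fun _ => rfl))))
    he (fun _ => le_rfl) (fun i k s _ hs => (Nat.div_le_self _ _).trans hs)
    (he.add (((hD.mul (hD.add (.const 1))).add (.const 1)).add
      (((hD.mul (hD.add (.const 1))).add (.const 1)).add (.const 2))))
    (fun i k s _ hs => by
      have h1 := (K i).size_enc_le s.2.1
      have h2 := (K i).size_enc_le s.2.2
      have h3 := Nat.size_le_size hs
      simp only [Val.size] at h1 h2 ⊢
      omega) (fun hx' => by
      refine Computes.pair (Computes.natDiv (.simple hx' rfl fun _ => rfl) (.num hx' 2))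
        (.pair (.fMul (K := fun j => K j.i) (X := fun j => j.b.2.1) (Y := fun j => j.b.2.1)
          (.simple hx' rfl fun _ => rfl) (.simple hx' rfl fun _ => rfl)
          (.simple hx' rfl fun _ => rfl)) ?_)
      refine Computes.ite (fun j => j.b.1 % 2 ≠ 0) (Computes.natMod
        (.simple hx' rfl fun _ => rfl) (.num hx' 2)) (fun _ => Iff.rfl) ?_ ?_
      · have hx2 := hx'.pull (Subtype.val : {j : IterIdx (B := fun i => ℕ × (K i).F × (K i).F)
          (fun i => (Val.atom (e i)).size) fun i _ s => s.1 ≤ e i // j.b.1 % 2 ≠ 0} → _)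
        refine (Computes.fMul (K := fun j => K j.1.i) (X := fun j => j.1.b.2.2)
          (Y := fun j => j.1.b.2.1) (.simple hx2 rfl fun _ => rfl)
          (.simple hx2 rfl fun _ => rfl) (.simple hx2 rfl fun _ => rfl)).congr fun j => ?_
        rw [if_pos j.2]
      · refine .simple (hx'.pull Subtype.val) rfl fun j => ?_
        rw [if_neg j.2]
        rfl)
  refine (key.snd.snd).congr fun i => ?_
  have : ∀ (n m : ℕ) (c acc : (K i).F), m < 2 ^ n →
      ((fun s : ℕ × (K i).F × (K i).F =>
        (s.1 / 2, s.2.1 * s.2.1, if s.1 % 2 ≠ 0 then s.2.2 * s.2.1 else s.2.2))^[n]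
          (m, c, acc)).2.2 = acc * c ^ m := by
    intro n
    induction n with
    | zero => intro m c acc hm; simp at hm; simp [hm]
    | succ n ih =>
      intro m c acc hm
      rw [Function.iterate_succ_apply, ih _ _ _ (by rw [pow_succ] at hm; omega)]
      conv_rhs => rw [← Nat.div_add_mod m 2, pow_add, pow_mul, pow_two]
      rcases Nat.mod_two_eq_zero_or_one m with h | h <;> simp [h]
      ring
  rw [this _ _ _ _ ((Nat.lt_size_self _).trans_le
    (Nat.pow_le_pow_right (by omega) (by simp [Val.size])))]
  simp

theorem fPow {ep : Prog} {e : ι → ℕ} (hD : Computes O σ x D (fun i => (K i).desc))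
    (ha : Computes O σ x a (fun i => (K i).enc (X i)))
    (he : Computes O σ x ep (fun i => .atom (e i))) :
    Computes O σ x (fPowE D a ep) (fun i => (K i).enc (X i ^ e i)) :=
  (hD.pair (ha.pair he)).comp (fPowRun hD.small X e he.small)

end Computes
end

/-! ### Division-free elimination -/

section

open Matrix

variable {F : Type*} [Field F] {N : ℕ} {τ : Type*}

/-- The vectors that are orthogonal to all rows in `Z`. -/
def rowKer (Z : List (Fin N → F)) : Submodule F (Fin N → F) where
  carrier := {w | ∀ z ∈ Z, z ⬝ᵥ w = 0}
  add_mem' := fun hv hw z hz => by rw [dotProduct_add, hv z hz, hw z hz, add_zero]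
  zero_mem' := fun z _ => dotProduct_zero z
  smul_mem' := fun c w hw z hz => by rw [dotProduct_smul, hw z hz, smul_zero]

theorem mem_rowKer {Z : List (Fin N → F)} {w : Fin N → F} :
    w ∈ rowKer Z ↔ ∀ z ∈ Z, z ⬝ᵥ w = 0 := Iff.rfl

/-- One step of the elimination of `b`: the first row `z` with `z ⬝ᵥ b ≠ 0` is taken out as the
pivot and is used to make the later rows orthogonal to `b`, by cross multiplication. -/
def elimStep [DecidableEq F] (b : Fin N → F)
    (st : Option (F × (Fin N → F)) × List (Fin N → F)) (z : Fin N → F) :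
    Option (F × (Fin N → F)) × List (Fin N → F) :=
  match st.1 with
  | none => if z ⬝ᵥ b = 0 then (none, z :: st.2) else (some (z ⬝ᵥ b, z), st.2)
  | some (c, y) => (some (c, y), (fun k => c * z k - (z ⬝ᵥ b) * y k) :: st.2)

/-- The pivot (if there is one) and the new rows after the elimination of `b`. -/
def elimRows [DecidableEq F] (b : Fin N → F) (Z : List (Fin N → F)) :
    Option (F × (Fin N → F)) × List (Fin N → F) :=
  Z.foldl (elimStep b) (none, [])

/-- What is known after the elimination has gone through the rows `Z`. -/
theorem elimRows_spec [DecidableEq F] (b : Fin N → F) (Z : List (Fin N → F)) :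
    ((elimRows b Z).1 = none ∧ b ∈ rowKer Z ∧ (elimRows b Z).2 = Z.reverse) ∨
    ∃ y ∈ Z, y ⬝ᵥ b ≠ 0 ∧ (elimRows b Z).1 = some (y ⬝ᵥ b, y) ∧
      (elimRows b Z).2.length + 1 = Z.length ∧
      ∀ w, w ∈ rowKer (elimRows b Z).2 ↔
        ∀ z ∈ Z, (y ⬝ᵥ b) * (z ⬝ᵥ w) = (z ⬝ᵥ b) * (y ⬝ᵥ w) := by
  induction Z using List.reverseRecOn with
  | nil => left; simp [elimRows, mem_rowKer]
  | append_singleton Z z ih =>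
    have hstep : elimRows b (Z ++ [z]) = elimStep b (elimRows b Z) z := by
      simp [elimRows, List.foldl_append]
    rcases ih with ⟨h1, h2, h3⟩ | ⟨y, hy, hyb, h1, h2, h3⟩
    · by_cases hz : z ⬝ᵥ b = 0
      · left
        rw [hstep]
        simp only [elimStep, h1, hz, if_true, h3, true_and, List.reverse_append]
        refine ⟨fun z' hz' => ?_, rfl⟩
        rcases List.mem_append.1 hz' with h | h
        · exact h2 z' h
        · rw [List.mem_singleton.1 h, hz]
      · right
        refine ⟨z, by simp, hz, ?_, ?_, ?_⟩
        · rw [hstep]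
          simp only [elimStep, h1, hz, if_false]
        · rw [hstep]
          simp only [elimStep, h1, hz, if_false, h3, List.length_reverse, List.length_append,
            List.length_singleton]
        · intro w
          rw [hstep]
          simp only [elimStep, h1, hz, if_false, h3, mem_rowKer, List.mem_reverse,
            List.mem_append, List.mem_singleton]
          constructor
          · rintro h z' (hz' | rfl)
            · rw [h z' hz', h2 z' hz']
              simp
            · rfl
          · intro h z' hz'
            have := h z' (Or.inl hz')
            rw [h2 z' hz', zero_mul] at this
            exact (mul_eq_zero.1 this).resolve_left hz
    · right
      refine ⟨y, by simp [hy], hyb, ?_, ?_, ?_⟩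
      · rw [hstep]
        simp only [elimStep, h1]
      · rw [hstep]
        simp only [elimStep, h1, List.length_cons, List.length_append, List.length_nil]
        omega
      · intro w
        rw [hstep]
        have hlin : (fun k => (y ⬝ᵥ b) * z k - (z ⬝ᵥ b) * y k) =
            (y ⬝ᵥ b) • z - (z ⬝ᵥ b) • y := rfl
        simp only [elimStep, h1, hlin, List.mem_append, List.mem_singleton]
        rw [mem_rowKer, List.forall_mem_cons]
        change _ ∧ w ∈ rowKer (elimRows b Z).2 ↔ _
        rw [h3 w, sub_dotProduct, smul_dotProduct, smul_dotProduct, sub_eq_zero]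
        constructor
        · rintro ⟨h, h'⟩ z' (hz' | rfl)
          · exact h' z' hz'
          · exact h
        · intro h
          exact ⟨h z (Or.inr rfl), fun z' hz' => h z' (Or.inl hz')⟩

/-- The elimination of a vector outside the kernel adds it to the kernel. -/
theorem rowKer_elimRows [DecidableEq F] (b : Fin N → F) (Z : List (Fin N → F)) :
    rowKer (elimRows b Z).2 = rowKer Z ⊔ Submodule.span F {b} := by
  rcases elimRows_spec b Z with ⟨_, h2, h3⟩ | ⟨y, hy, hyb, _, _, h3⟩
  · have : rowKer (elimRows b Z).2 = rowKer Z := by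
      ext w
      simp [h3, mem_rowKer]
    rw [this, left_eq_sup, Submodule.span_singleton_le_iff_mem]
    exact h2
  · ext w
    rw [h3, Submodule.mem_sup]
    constructor
    · intro h
      -- subtract the multiple of `b` that makes `w` orthogonal to the pivot `y`
      refine ⟨w - ((y ⬝ᵥ w) / (y ⬝ᵥ b)) • b, fun z hz => ?_, _,
        Submodule.smul_mem _ ((y ⬝ᵥ w) / (y ⬝ᵥ b)) (Submodule.mem_span_singleton_self b), by simp⟩
      rw [dotProduct_sub, dotProduct_smul, smul_eq_mul, sub_eq_zero, div_mul_eq_mul_div,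
        eq_div_iff hyb]
      linear_combination h z hz
    · rintro ⟨v, hv, u, hu, rfl⟩ z hz
      obtain ⟨c, rfl⟩ := Submodule.mem_span_singleton.1 hu
      rw [dotProduct_add, dotProduct_add, hv z hz, hv y hy, dotProduct_smul, dotProduct_smul,
        smul_eq_mul, smul_eq_mul]
      ring

/-- Process one tagged vector: eliminate it, and keep it if it enlarges the kernel. -/
def reduceStep [DecidableEq F] (st : List (Fin N → F) × List (τ × (Fin N → F)))
    (c : τ × (Fin N → F)) :
    List (Fin N → F) × List (τ × (Fin N → F)) :=
  ((elimRows c.2 st.1).2, if (elimRows c.2 st.1).1.isSome then c :: st.2 else st.2)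

/-- Process a list of tagged vectors. The result consists of the rows of a matrix whose kernel is
spanned by the vectors, and of a sublist that is a basis of the span (in reversed order). -/
def reduceList [DecidableEq F] (l : List (τ × (Fin N → F))) :
    List (Fin N → F) × List (τ × (Fin N → F)) :=
  l.foldl reduceStep (List.ofFn fun (i k : Fin N) => if (k : ℕ) = i then 1 else 0, [])

/-- The span of the vectors in a list of tagged vectors. -/
def tagSpan (l : List (τ × (Fin N → F))) : Submodule F (Fin N → F) :=
  Submodule.span F {v | ∃ c ∈ l, c.2 = v}

theorem tagSpan_cons (c : τ × (Fin N → F)) (l : List (τ × (Fin N → F))) :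
    tagSpan (c :: l) = tagSpan l ⊔ Submodule.span F {c.2} := by
  rw [tagSpan, tagSpan, ← Submodule.span_union]
  congr 1
  ext v
  simp only [List.mem_cons, Set.mem_ofPred_eq, Set.mem_union, Set.mem_singleton_iff]
  constructor
  · rintro ⟨c', rfl | h, rfl⟩
    · right; rfl
    · left; exact ⟨c', h, rfl⟩
  · rintro (⟨c', h, rfl⟩ | rfl)
    · exact ⟨c', Or.inr h, rfl⟩
    · exact ⟨c, Or.inl rfl, rfl⟩

theorem tagSpan_congr {l l' : List (τ × (Fin N → F))} (h : ∀ c, c ∈ l ↔ c ∈ l') :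
    tagSpan l = tagSpan l' := by
  simp only [tagSpan, h]

/-- After a list of vectors has been processed, the rows have the span as their kernel, the kept
vectors form a sublist with the same span, and each kept vector has used up one of the `N` initial
rows. The last fact bounds the number of kept vectors by `N`. -/
theorem reduceList_spec [DecidableEq F] (l : List (τ × (Fin N → F))) :
    rowKer (reduceList l).1 = tagSpan l ∧ tagSpan (reduceList l).2 = tagSpan l ∧
      (reduceList l).2.reverse.Sublist l ∧
      (reduceList l).1.length + (reduceList l).2.length = N := by
  induction l using List.reverseRecOn with
  | nil =>
    refine ⟨?_, rfl, List.Sublist.refl _, by simp [reduceList]⟩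
    have : tagSpan ([] : List (τ × (Fin N → F))) = ⊥ := by simp [tagSpan]
    rw [this, eq_bot_iff]
    intro w hw
    rw [Submodule.mem_bot]
    ext i
    have := hw (fun k => if (k : ℕ) = i then 1 else 0) ((List.mem_ofFn' _ _).2 ⟨i, rfl⟩)
    simpa [dotProduct, ← Fin.ext_iff] using this
  | append_singleton l c ih =>
    obtain ⟨h1, h2, h3, h4⟩ := ih
    have hstep : reduceList (l ++ [c]) = reduceStep (reduceList l) c := by
      simp [reduceList, List.foldl_append]
    have hcomm : tagSpan (l ++ [c]) = tagSpan l ⊔ Submodule.span F {c.2} := by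
      rw [← tagSpan_cons]
      exact tagSpan_congr fun _ => by simp [or_comm]
    rw [hstep, hcomm]
    have hk := rowKer_elimRows c.2 (reduceList l).1
    rw [h1] at hk
    rcases elimRows_spec c.2 (reduceList l).1 with ⟨e1, e2, e3⟩ | ⟨y, hy, hyb, e1, e2, _⟩
    · simp only [reduceStep, e1, Option.isSome_none, Bool.false_eq_true, if_false]
      refine ⟨hk, ?_, h3.trans (List.sublist_append_left _ _), ?_⟩
      · rw [h2, left_eq_sup, Submodule.span_singleton_le_iff_mem, ← h1]
        exact e2
      · rw [e3, List.length_reverse, h4]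
    · simp only [reduceStep, e1, Option.isSome_some, if_true]
      refine ⟨hk, ?_, ?_, ?_⟩
      · rw [tagSpan_cons, h2]
      · rw [List.reverse_cons]
        exact h3.append (List.Sublist.refl _)
      · rw [List.length_cons]
        omega

/-- All products of a vector in `l` with a vector in `M`. -/
def tensor (l : List (List F × (Fin N → F))) (M : List (F × (Fin N → F))) :
    List (List F × (Fin N → F)) :=
  (l.map fun sb => M.map fun tv => (tv.1 :: sb.1, fun k => tv.2 k * sb.2 k)).flatten

theorem mem_tensor {l : List (List F × (Fin N → F))} {M : List (F × (Fin N → F))}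
    {c : List F × (Fin N → F)} : c ∈ tensor l M ↔
      ∃ sb ∈ l, ∃ tv ∈ M, c = (tv.1 :: sb.1, tv.2 * sb.2) := by
  simp only [tensor, List.mem_flatten, List.mem_map]
  constructor
  · rintro ⟨_, ⟨sb, hsb, rfl⟩, h⟩
    obtain ⟨tv, htv, rfl⟩ := List.mem_map.1 h
    exact ⟨sb, hsb, tv, htv, rfl⟩
  · rintro ⟨sb, hsb, tv, htv, rfl⟩
    exact ⟨_, ⟨sb, hsb, rfl⟩, List.mem_map.2 ⟨tv, htv, rfl⟩⟩

/-- The span of the products is the product of the spans in the algebra of functions with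
pointwise operations. -/
theorem tagSpan_tensor (l : List (List F × (Fin N → F))) (M : List (F × (Fin N → F))) :
    tagSpan (tensor l M) = tagSpan M * tagSpan l := by
  rw [tagSpan, tagSpan, tagSpan, Submodule.span_mul_span]
  congr 1
  ext v
  simp only [mem_tensor, Set.mem_ofPred_eq, Set.mem_mul]
  constructor
  · rintro ⟨c, ⟨sb, hsb, tv, htv, rfl⟩, rfl⟩
    exact ⟨tv.2, ⟨tv, htv, rfl⟩, sb.2, ⟨sb, hsb, rfl⟩, rfl⟩
  · rintro ⟨_, ⟨tv, htv, rfl⟩, _, ⟨sb, hsb, rfl⟩, rfl⟩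
    exact ⟨_, ⟨sb, hsb, tv, htv, rfl⟩, rfl⟩

/-- Multiply the spans of the lists in `Ms` one after the other, and reduce to a basis after each
step, so that the lists never get long. -/
def tensorReduce [DecidableEq F] (Ms : List (List (F × (Fin N → F)))) :
    List (Fin N → F) × List (List F × (Fin N → F)) :=
  Ms.foldr (fun M st => reduceList (tensor st.2 M)) (reduceList [([], fun _ => 1)])

theorem tensorReduce_cons [DecidableEq F] (M : List (F × (Fin N → F)))
    (Ms : List (List (F × (Fin N → F)))) :
    tensorReduce (M :: Ms) = reduceList (tensor (tensorReduce Ms).2 M) := rfl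

/-- Replacing a list by a list with the same span does not change the span of the products with
another list. So the reductions do not affect the span of the products of one vector from each
list. -/
theorem tensorReduce_span [DecidableEq F] (Ms : List (List (F × (Fin N → F)))) :
    rowKer (tensorReduce Ms).1 = (Ms.map tagSpan).prod ∧
      tagSpan (tensorReduce Ms).2 = (Ms.map tagSpan).prod := by
  induction Ms with
  | nil =>
    obtain ⟨h1, h2, _, _⟩ := reduceList_spec [(([] : List F), (fun _ => 1 : Fin N → F))]
    have : tagSpan [(([] : List F), (fun _ => 1 : Fin N → F))] = 1 := by
      rw [tagSpan_cons, Submodule.one_eq_span]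
      have : tagSpan ([] : List (List F × (Fin N → F))) = ⊥ := by simp [tagSpan]
      rw [this, bot_sup_eq]
      rfl
    rw [List.map_nil, List.prod_nil, ← this]
    exact ⟨h1, h2⟩
  | cons M Ms ih =>
    obtain ⟨h1, h2, _, _⟩ := reduceList_spec (tensor (tensorReduce Ms).2 M)
    rw [tensorReduce_cons, List.map_cons, List.prod_cons, ← ih.2, ← tagSpan_tensor]
    exact ⟨h1, h2⟩

/-- In particular there are at most `N` kept vectors. -/
theorem tensorReduce_length [DecidableEq F] (Ms : List (List (F × (Fin N → F)))) :
    (tensorReduce Ms).1.length + (tensorReduce Ms).2.length = N := by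
  cases Ms with
  | nil => exact (reduceList_spec _).2.2.2
  | cons M Ms => exact (reduceList_spec _).2.2.2

end

/-! ### Polynomials of bounded degree -/

section

open Matrix

variable {F : Type*} [Field F] {N m : ℕ}

/-- The polynomials of degree at most `d i` in the `i`-th variable. -/
def degLE (F : Type*) [Field F] (d : Fin m → ℕ) : Submodule F (MvPolynomial (Fin m) F) where
  carrier := {q | ∀ i, q.degreeOf i ≤ d i}
  add_mem' := fun hp hq i =>
    (MvPolynomial.degreeOf_add_le i _ _).trans (max_le (hp i) (hq i))
  zero_mem' := fun i => by simp
  smul_mem' := fun c q hq i => by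
    rw [MvPolynomial.smul_eq_C_mul]
    exact (MvPolynomial.degreeOf_C_mul_le q i c).trans (hq i)

/-- The evaluation of polynomials at a family of points. -/
noncomputable def evalAt {ι : Type*} (pts : ι → Fin m → F) :
    MvPolynomial (Fin m) F →ₗ[F] (ι → F) :=
  LinearMap.pi fun k => (MvPolynomial.aeval (pts k)).toLinearMap

theorem evalAt_apply {ι : Type*} (pts : ι → Fin m → F) (q : MvPolynomial (Fin m) F) (k : ι) :
    evalAt pts q k = MvPolynomial.eval (pts k) q := by
  simp [evalAt, MvPolynomial.aeval_eq_eval]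

/-- The vectors of the powers up to `d` of the coordinates in `col`; the tags are irrelevant. -/
def powMults (d : ℕ) (col : Fin N → F) : List (F × (Fin N → F)) :=
  List.ofFn fun l : Fin (d + 1) => (0, fun k => col k ^ (l : ℕ))

/-- The rows that come out of `tensorReduce` for the power vectors of all coordinates are the
linear constraints on the values at `pts` of the polynomials of degree at most `d`. -/
theorem rowKer_powMults [DecidableEq F] (d : Fin m → ℕ) (pts : Fin N → Fin m → F) :
    rowKer (tensorReduce (List.ofFn fun j => powMults (d j) (fun k => pts k j))).1 =
      (degLE F d).map (evalAt pts) := by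
  rw [(tensorReduce_span _).1, List.map_ofFn, List.prod_ofFn]
  simp only [Function.comp_apply, tagSpan]
  rw [Submodule.prod_span]
  apply le_antisymm
  · rw [Submodule.span_le]
    intro v hv
    obtain ⟨u, hu, rfl⟩ := (Set.mem_fintype_prod _ _).1 hv
    have : ∀ j, ∃ l ≤ d j, (fun k => pts k j ^ l) = u j := by
      intro j
      obtain ⟨c, hc, hcu⟩ := hu j
      obtain ⟨l, rfl⟩ := (List.mem_ofFn' _ _).1 hc
      exact ⟨l, Nat.lt_succ_iff.1 l.2, hcu⟩
    choose e he heu using this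
    refine ⟨MvPolynomial.monomial (Finsupp.equivFunOnFinite.symm e) 1, fun i => ?_, ?_⟩
    · rw [MvPolynomial.degreeOf_le_iff]
      intro e' he'
      have := MvPolynomial.support_monomial_subset he'
      rw [Finset.mem_singleton.1 this]
      exact he i
    · ext k
      rw [evalAt_apply, MvPolynomial.eval_monomial, Finset.prod_apply]
      simp [← heu, Finsupp.prod_fintype]
  · rintro _ ⟨q, hq, rfl⟩
    have : evalAt pts q = ∑ e ∈ q.support, q.coeff e • fun k => ∏ i, pts k i ^ e i := by
      ext k
      rw [evalAt_apply, MvPolynomial.eval_eq', Finset.sum_apply]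
      rfl
    rw [this]
    refine Submodule.sum_mem _ fun e he => Submodule.smul_mem _ _ (Submodule.subset_span ?_)
    refine (Set.mem_fintype_prod _ _).2 ⟨fun j k => pts k j ^ e j, fun j => ?_, ?_⟩
    · have := MvPolynomial.degreeOf_le_iff.1 (hq j) e he
      exact ⟨_, (List.mem_ofFn' _ _).2 ⟨⟨e j, by omega⟩, rfl⟩, rfl⟩
    · ext k
      rw [Finset.prod_apply]

/-! ### Interpolation on grids -/

/-- The product of the linear factors `x - z` for `z` in the list other than `t`. -/
def delta [DecidableEq F] (L : List F) (t x : F) : F :=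
  L.foldl (fun acc z => if z = t then acc else acc * (x - z)) 1

theorem delta_eq [DecidableEq F] {L : List F} {S : Finset F} (hL : L.Nodup)
    (hS : ∀ x, x ∈ L ↔ x ∈ S) (t x : F) : delta L t x = ∏ z ∈ S.erase t, (x - z) := by
  have h1 : ∀ (L : List F) (a : F), L.foldl (fun acc z => if z = t then acc else acc * (x - z)) a =
      a * (L.map fun z => if z = t then 1 else x - z).prod := by
    intro L
    induction L with
    | nil => simp
    | cons z L ih =>
      intro a
      rw [List.foldl_cons, ih, List.map_cons, List.prod_cons]
      split_ifs <;> ring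
  have h2 : S = L.toFinset := by ext x; simp [hS]
  rw [delta, h1, one_mul, h2, ← List.prod_toFinset _ hL,
    ← Finset.prod_erase (a := t) _ (by simp)]
  exact Finset.prod_congr rfl fun z hz => if_neg (Finset.ne_of_mem_erase hz)

/-- The vectors of the values of the interpolation polynomials of the list, up to a factor; they
are tagged with the points of interpolation. -/
def deltaMults [DecidableEq F] (L : List F) (col : Fin N → F) : List (F × (Fin N → F)) :=
  L.map fun t => (t, fun k => delta L t (col k))

/-- The polynomial of minimal degree that is nonzero at `s` and vanishes on the rest of the grid,
up to a factor. -/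
noncomputable def gridDelta [DecidableEq F] (S : Fin m → Finset F) (s : Fin m → F) :
    MvPolynomial (Fin m) F :=
  ∏ i, ∏ z ∈ (S i).erase (s i), (MvPolynomial.X i - MvPolynomial.C z)

theorem eval_gridDelta [DecidableEq F] (S : Fin m → Finset F) (s x : Fin m → F) :
    MvPolynomial.eval x (gridDelta S s) = ∏ i, ∏ z ∈ (S i).erase (s i), (x i - z) := by
  simp [gridDelta, map_prod]

theorem gridDelta_mem [DecidableEq F] {S : Fin m → Finset F} {s : Fin m → F}
    (hs : ∀ i, s i ∈ S i) : gridDelta S s ∈ degLE F fun i => (S i).card - 1 := by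
  intro j
  refine (MvPolynomial.degreeOf_prod_le _ _ _).trans ?_
  calc ∑ i, MvPolynomial.degreeOf j
          (∏ z ∈ (S i).erase (s i), (MvPolynomial.X i - MvPolynomial.C z))
      ≤ ∑ i, if i = j then (S j).card - 1 else 0 := by
        refine Finset.sum_le_sum fun i _ => ?_
        refine (MvPolynomial.degreeOf_prod_le _ _ _).trans ?_
        have hfac : ∀ z : F, (MvPolynomial.X i - MvPolynomial.C z).degreeOf j ≤
            if i = j then 1 else 0 := by
          intro z
          refine (MvPolynomial.degreeOf_sub_le _ _ _).trans ?_
          rw [MvPolynomial.degreeOf_C, MvPolynomial.degreeOf_X]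
          by_cases h : i = j
          · subst h; simp
          · simp [h, Ne.symm h]
        refine (Finset.sum_le_sum fun z _ => hfac z).trans ?_
        by_cases h : i = j
        · subst h
          simp [Finset.card_erase_of_mem (hs i)]
        · simp [h]
    _ = (S j).card - 1 := by simp

theorem eval_gridDelta_self [DecidableEq F] (S : Fin m → Finset F) (s : Fin m → F) :
    MvPolynomial.eval s (gridDelta S s) ≠ 0 := by
  rw [eval_gridDelta]
  exact Finset.prod_ne_zero_iff.2 fun i _ => Finset.prod_ne_zero_iff.2 fun z hz =>
    sub_ne_zero.2 (Finset.ne_of_mem_erase hz).symm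

theorem eval_gridDelta_ne [DecidableEq F] {S : Fin m → Finset F} {s x : Fin m → F}
    (hx : ∀ i, x i ∈ S i) (h : s ≠ x) : MvPolynomial.eval x (gridDelta S s) = 0 := by
  obtain ⟨i, hi⟩ := Function.ne_iff.1 h
  rw [eval_gridDelta]
  refine Finset.prod_eq_zero (Finset.mem_univ i) ?_
  exact Finset.prod_eq_zero (Finset.mem_erase.2 ⟨Ne.symm hi, hx i⟩) (sub_self _)

/-- Tagged vectors that consist of grid points `s` and the values of `gridDelta S s` at `pts`. -/
def IsDeltaList [DecidableEq F] (S : Fin m → Finset F) (pts : Fin N → Fin m → F)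
    (l : List (List F × (Fin N → F))) : Prop :=
  ∀ c ∈ l, ∃ s : Fin m → F, (∀ i, s i ∈ S i) ∧ c = (List.ofFn s, evalAt pts (gridDelta S s))

/-- If the values of `gridDelta S s` at `pts` are a linear combination of the vectors in the list
`l`, and the grid point `s` is not among its tags, then the corresponding combination of
polynomials vanishes at `pts` and not at `s`. -/
theorem exists_separating_of_mem [DecidableEq F] {S : Fin m → Finset F} {pts : Fin N → Fin m → F}
    {l : List (List F × (Fin N → F))} (hl : IsDeltaList S pts l) {s : Fin m → F}
    (hs : ∀ i, s i ∈ S i) (hsl : ∀ c ∈ l, c.1 ≠ List.ofFn s)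
    (hspan : evalAt pts (gridDelta S s) ∈ tagSpan l) :
    ∃ h ∈ degLE F fun i => (S i).card - 1, (∀ k, MvPolynomial.eval (pts k) h = 0) ∧
      MvPolynomial.eval s h ≠ 0 := by
  -- the polynomials of low degree that vanish at `s`; among them are those for the tags in `l`
  let V : Submodule F (MvPolynomial (Fin m) F) :=
    (degLE F fun i => (S i).card - 1) ⊓ LinearMap.ker (evalAt fun _ : Unit => s)
  have hV : tagSpan l ≤ V.map (evalAt pts) := by
    rw [tagSpan, Submodule.span_le]
    rintro _ ⟨c, hc, rfl⟩
    obtain ⟨r, hr, hcr⟩ := hl c hc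
    have hne : r ≠ s := by
      rintro rfl
      exact hsl c hc (by rw [hcr])
    refine ⟨gridDelta S r, ⟨gridDelta_mem hr, ?_⟩, by rw [hcr]⟩
    rw [SetLike.mem_coe, LinearMap.mem_ker]
    ext
    rw [evalAt_apply, eval_gridDelta_ne hs hne]
    rfl
  obtain ⟨g, ⟨hg1, hg2⟩, hg⟩ := hV hspan
  refine ⟨gridDelta S s - g, Submodule.sub_mem _ (gridDelta_mem hs) hg1, fun k => ?_, ?_⟩
  · rw [map_sub, ← evalAt_apply, ← evalAt_apply, hg, sub_self]
  · have : MvPolynomial.eval s g = 0 := by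
      have := congrFun hg2 ()
      rwa [evalAt_apply] at this
    rw [map_sub, this, sub_zero]
    exact eval_gridDelta_self S s

/-- The kept vectors for the lists `deltaMults` belong to grid points, and every other grid point
can be separated from `pts` by a polynomial of low degree. The reason is that a point that is lost
in one coordinate step is separated by a polynomial in the coordinates seen so far. -/
theorem tensorReduce_deltaMults [DecidableEq F] {S : Fin m → Finset F} {L : Fin m → List F}
    (hL : ∀ i, (L i).Nodup) (hS : ∀ i x, x ∈ L i ↔ x ∈ S i) (pts : Fin N → Fin m → F) :
    IsDeltaList S pts
        (tensorReduce (List.ofFn fun j => deltaMults (L j) (fun k => pts k j))).2 ∧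
      ((tensorReduce (List.ofFn fun j => deltaMults (L j) (fun k => pts k j))).2.map
        Prod.fst).Nodup ∧
      ∀ s : Fin m → F, (∀ i, s i ∈ S i) →
        (∀ c ∈ (tensorReduce (List.ofFn fun j => deltaMults (L j) (fun k => pts k j))).2,
          c.1 ≠ List.ofFn s) →
        ∃ h ∈ degLE F fun i => (S i).card - 1, (∀ k, MvPolynomial.eval (pts k) h = 0) ∧
          MvPolynomial.eval s h ≠ 0 := by
  induction m with
  | zero =>
    obtain ⟨_, h2, h3, _⟩ := reduceList_spec [(([] : List F), (fun _ => 1 : Fin N → F))]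
    have hone : ∀ s : Fin 0 → F, evalAt pts (gridDelta S s) = fun _ => 1 := by
      intro s
      ext k
      rw [evalAt_apply, eval_gridDelta]
      simp
    have hA : IsDeltaList S pts (reduceList [(([] : List F), (fun _ => 1 : Fin N → F))]).2 := by
      intro c hc
      have := h3.subset (List.mem_reverse.2 hc)
      refine ⟨finZeroElim, fun i => i.elim0, ?_⟩
      rw [List.mem_singleton.1 this, hone]
      simp
    refine ⟨hA, ?_, fun s hs hsl => exists_separating_of_mem hA hs hsl ?_⟩
    · rw [List.ofFn_zero, ← List.nodup_reverse, ← List.map_reverse]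
      exact (h3.map Prod.fst).nodup (by simp)
    · rw [h2, hone]
      exact Submodule.subset_span ⟨_, List.mem_singleton_self _, rfl⟩
  | succ m ih =>
    obtain ⟨ihA, ihB, ihC⟩ := ih (S := fun i => S i.succ) (L := fun i => L i.succ)
      (fun i => hL _) (fun i => hS _) (fun k i => pts k i.succ)
    rw [List.ofFn_succ, tensorReduce_cons]
    set K' := (tensorReduce (List.ofFn fun j : Fin m =>
      deltaMults (L j.succ) (fun k => pts k j.succ))).2 with hK'
    obtain ⟨_, h2, h3, _⟩ := reduceList_spec (tensor K' (deltaMults (L 0) (fun k => pts k 0)))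
    have hprod : ∀ (t : F) (s : Fin m → F), evalAt pts (gridDelta S (Fin.cons t s)) =
        (fun k => delta (L 0) t (pts k 0)) *
          evalAt (fun k i => pts k (Fin.succ i)) (gridDelta (fun i => S i.succ) s) := by
      intro t s
      ext k
      rw [Pi.mul_apply, evalAt_apply, evalAt_apply, eval_gridDelta, eval_gridDelta,
        Fin.prod_univ_succ, delta_eq (hL 0) (hS 0)]
      simp
    have hA : IsDeltaList S pts
        (reduceList (tensor K' (deltaMults (L 0) (fun k => pts k 0)))).2 := by
      intro c hc
      obtain ⟨sb, hsb, tv, htv, rfl⟩ := mem_tensor.1 (h3.subset (List.mem_reverse.2 hc))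
      obtain ⟨s, hs, rfl⟩ := ihA sb hsb
      obtain ⟨t, ht, rfl⟩ := List.mem_map.1 htv
      refine ⟨Fin.cons t s, fun i => ?_, ?_⟩
      · refine Fin.cases ?_ (fun i => ?_) i
        · exact (hS 0 t).1 ht
        · exact hs i
      · rw [hprod, List.ofFn_cons]
    refine ⟨hA, ?_, fun s hs hsl => ?_⟩
    · rw [← List.nodup_reverse, ← List.map_reverse]
      refine (h3.map Prod.fst).nodup ?_
      have htags : (tensor K' (deltaMults (L 0) (fun k => pts k 0))).map Prod.fst =
          (List.product (K'.map Prod.fst) (L 0)).map fun p => p.2 :: p.1 := by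
        simp only [tensor, deltaMults, List.product, List.map_flatten, List.flatMap_def,
          List.map_map]
        congr 1
        refine List.map_congr_left fun c _ => ?_
        simp
      rw [htags]
      refine (ihB.product (hL 0)).map fun p q h => ?_
      simp only [List.cons.injEq] at h
      exact Prod.ext h.2 h.1
    · by_cases hc : ∃ c ∈ K', c.1 = List.ofFn fun i => s i.succ
      · -- the tail of `s` was kept, so `s` is lost in the last reduction
        obtain ⟨c, hc, hcs⟩ := hc
        obtain ⟨s', hs', rfl⟩ := ihA c hc
        have hs'' : s' = fun i => s i.succ := List.ofFn_injective hcs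
        refine exists_separating_of_mem hA hs hsl ?_
        rw [h2]
        refine Submodule.subset_span ⟨_, mem_tensor.2 ⟨_, hc, _,
          List.mem_map.2 ⟨s 0, (hS 0 _).2 (hs 0), rfl⟩, rfl⟩, ?_⟩
        rw [hs'']
        have := hprod (s 0) (fun i => s i.succ)
        rw [← this]
        change evalAt pts (gridDelta S (Fin.cons (s 0) (Fin.tail s))) = _
        rw [Fin.cons_self_tail]
      · -- the tail of `s` was lost before, and the polynomial that separates it also separates `s`
        push Not at hc
        obtain ⟨h, h1, h2, h3⟩ := ihC (fun i => s i.succ) (fun i => hs _) hc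
        refine ⟨MvPolynomial.rename Fin.succ h, fun i => ?_, fun k => ?_, ?_⟩
        · refine Fin.cases ?_ (fun i => ?_) i
          · rw [MvPolynomial.degreeOf_le_iff]
            intro e he
            rw [MvPolynomial.support_rename_of_injective (Fin.succ_injective m)] at he
            obtain ⟨e', _, rfl⟩ := Finset.mem_image.1 he
            have : Finsupp.mapDomain Fin.succ e' 0 = 0 := by
              refine Finsupp.mapDomain_of_notMem_range _ _ ?_
              rintro ⟨i, hi⟩
              exact Fin.succ_ne_zero i hi
            rw [this]
            exact Nat.zero_le _
          · rw [MvPolynomial.degreeOf_rename_of_injective (Fin.succ_injective m)]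
            exact h1 i
        · rw [MvPolynomial.eval_rename]
          exact h2 k
        · rw [MvPolynomial.eval_rename]
          exact h3

end

open scoped ENNReal

/-! ### Uniform distributions -/

section

variable {α β : Type*}

theorem pmf_map_apply_of_injective {g : α → β} (hg : Function.Injective g) (p : PMF α) (a : α) :
    p.map g (g a) = p a := by
  rw [PMF.map_apply, tsum_eq_single a]
  · simp
  · intro b hb
    rw [if_neg fun h => hb (hg h).symm]

/-- A probability mass function that is constant on a finite set and zero elsewhere is uniform. -/
theorem pmf_eq_uniformOfFinset {p : PMF α} {s : Finset α} (hs : s.Nonempty) (c : ℝ≥0∞)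
    (h1 : ∀ a ∈ s, p a = c) (h0 : ∀ a ∉ s, p a = 0) : p = PMF.uniformOfFinset s hs := by
  have hsum := p.tsum_coe
  rw [tsum_eq_sum (s := s) fun a ha => h0 a ha, Finset.sum_congr rfl h1, Finset.sum_const,
    nsmul_eq_mul, mul_comm] at hsum
  have hc := ENNReal.eq_inv_of_mul_eq_one_left hsum
  ext a
  by_cases ha : a ∈ s
  · rw [h1 a ha, PMF.uniformOfFinset_apply_of_mem hs ha, hc]
  · rw [h0 a ha, PMF.uniformOfFinset_apply_of_notMem hs ha]

/-- An injective map sends the uniform distribution on `s` to the one on its image `t`. -/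
theorem uniformOfFinset_map_of_injective {g : α → β} (hg : Function.Injective g) {s : Finset α}
    (hs : s.Nonempty) {t : Finset β} (ht : t.Nonempty) (h : ∀ b, b ∈ t ↔ ∃ a ∈ s, g a = b) :
    (PMF.uniformOfFinset s hs).map g = PMF.uniformOfFinset t ht := by
  refine pmf_eq_uniformOfFinset ht (s.card : ℝ≥0∞)⁻¹ (fun b hb => ?_) fun b hb => ?_
  · obtain ⟨a, ha, rfl⟩ := (h b).1 hb
    rw [pmf_map_apply_of_injective hg, PMF.uniformOfFinset_apply_of_mem hs ha]
  · rw [PMF.apply_eq_zero_iff, PMF.mem_support_map_iff]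
    rintro ⟨a, ha, rfl⟩
    exact hb ((h _).2 ⟨a, (PMF.mem_support_uniformOfFinset_iff hs a).1 ha, rfl⟩)

theorem uniformOfFintype_map_of_bijective [Fintype α] [Nonempty α] [Fintype β] [Nonempty β]
    {g : α → β} (hg : Function.Bijective g) :
    (PMF.uniformOfFintype α).map g = PMF.uniformOfFintype β :=
  uniformOfFinset_map_of_injective hg.1 _ _ fun b => by simpa using hg.2 b

/-- The law of a function that is constant on the support. -/
theorem pmf_map_eq_pure {p : PMF α} {g : α → β} {b : β} (h : ∀ a ∈ p.support, g a = b) :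
    p.map g = PMF.pure b := by
  have hsupp : (p.map g).support = {b} := by
    rw [PMF.support_map]
    ext b'
    constructor
    · rintro ⟨a, ha, rfl⟩
      exact h a ha
    · rintro rfl
      obtain ⟨a, ha⟩ := p.support_nonempty
      exact ⟨a, ha, h a ha⟩
  ext b'
  by_cases hb : b' = b
  · subst hb
    rw [(PMF.apply_eq_one_iff _ _).2 hsupp]
    simp
  · rw [(PMF.apply_eq_zero_iff _ _).2 (by rw [hsupp]; exact hb)]
    simp [PMF.pure_apply, hb]

/-- A translation-invariant distribution on a finite group is uniform. -/
theorem pmf_eq_uniformOfFintype [AddGroup α] [Fintype α] {p : PMF α}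
    (h : ∀ a c, p (a + c) = p a) : p = PMF.uniformOfFintype α :=
  pmf_eq_uniformOfFinset _ (p 0) (fun a _ => by rw [← h 0 a, zero_add]) fun a ha =>
    absurd (Finset.mem_univ a) ha

end

/-! ### The encoding as a linear randomised encoding -/

section

variable {F : Type} [Field F] [Finite F] {m : ℕ} {d : Fin m → ℕ} {S : Fin m → Finset F}
  (hd : ∀ i, 2 * ((S i).card - 1) ≤ d i)

theorem mem_support_rmEnc {f : Grid S → F} {c : (Fin m → F) → F} :
    c ∈ (rmEnc d S hd f).support ↔ ∃ q ∈ LD d S f, (fun x => MvPolynomial.eval x q) = c := by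
  rw [rmEnc, PMF.mem_support_map_iff]
  simp

/-- A linear section `g` of the restriction of polynomials to the grid, plus a uniformly random
element of its kernel `W`, gives a uniformly random extension. -/
theorem isLinear_rmEnc [Fintype F] : IsLinear (rmEnc d S hd) := by
  classical
  let ev : degLE F d →ₗ[F] (Grid S → F) :=
    (evalAt fun x : Grid S => x.1).comp (degLE F d).subtype
  have hev : ∀ (q : degLE F d) (x : Grid S), ev q x = MvPolynomial.eval x.1 q.1 := fun q x =>
    evalAt_apply _ _ _
  have hsurj : LinearMap.range ev = ⊤ := by
    rw [LinearMap.range_eq_top]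
    intro f
    obtain ⟨q, hq⟩ := LD_nonempty d S hd f
    exact ⟨⟨q, hq.1⟩, funext fun x => (hev _ x).trans (hq.2 x)⟩
  obtain ⟨g, hg⟩ := ev.exists_rightInverse_of_surjective hsurj
  let W : Submodule F (MvPolynomial (Fin m) F) :=
    degLE F d ⊓ LinearMap.ker (evalAt fun x : Grid S => x.1)
  have hW : ∀ {q}, q ∈ W ↔ q ∈ degLE F d ∧ ∀ x : Grid S, MvPolynomial.eval x.1 q = 0 := by
    intro q
    rw [Submodule.mem_inf, LinearMap.mem_ker, funext_iff]
    simp only [evalAt_apply, Pi.zero_apply]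
  have : Finite W :=
    (LD_finite d S fun _ => 0).subset fun q hq => ⟨(hW.1 hq).1, (hW.1 hq).2⟩
  let e : (Fin (Module.finrank F W) → F) ≃ₗ[F] W := (Module.finBasis F W).equivFun.symm
  let tot : ((Grid S → F) × (Fin (Module.finrank F W) → F)) →ₗ[F] MvPolynomial (Fin m) F :=
    ((degLE F d).subtype.comp g).coprod (W.subtype.comp e.toLinearMap)
  have htot : ∀ f μ, tot (f, μ) = (g f).1 + (e μ).1 := fun f μ => by simp [tot]
  refine ⟨_, (evalAt fun x : Fin m → F => x).comp tot, fun f => ?_⟩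
  have hgf : ∀ x : Grid S, MvPolynomial.eval x.1 (g f).1 = f x := fun x => by
    rw [← hev]
    exact congrFun (LinearMap.congr_fun hg f) x
  have hinj : Function.Injective fun μ => tot (f, μ) := by
    intro μ ν h
    simp only [htot, add_right_inj] at h
    exact e.injective (Subtype.ext h)
  have key : (PMF.uniformOfFintype _).map (fun μ => tot (f, μ)) =
      PMF.uniformOfFinset (LD_finite d S f).toFinset
        ((LD_finite d S f).toFinset_nonempty.2 (LD_nonempty d S hd f)) := by
    refine uniformOfFinset_map_of_injective hinj _ _ fun q => ?_
    rw [Set.Finite.mem_toFinset]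
    constructor
    · intro hq
      have hk : q - (g f).1 ∈ W := hW.2 ⟨Submodule.sub_mem _ hq.1 (g f).2, fun x => by
        rw [map_sub, hq.2, hgf, sub_self]⟩
      refine ⟨e.symm ⟨_, hk⟩, Finset.mem_univ _, ?_⟩
      rw [htot]
      simp
    · rintro ⟨μ, _, rfl⟩
      obtain ⟨h1, h2⟩ := hW.1 (e μ).2
      rw [htot]
      refine ⟨Submodule.add_mem _ (g f).2 h1, fun x => ?_⟩
      rw [map_add, hgf, h2, add_zero]
  rw [rmEnc, ← key, PMF.map_comp]
  congr 1

/-- If all grid points outside `R` are separated from the points `I` by polynomials of low degree,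
then the values outside `R` impose no constraint on the values at `I`. -/
theorem exists_mem_LD_iff [DecidableEq F] (hd : ∀ i, 2 * ((S i).card - 1) ≤ d i)
    {ι : Type*} {I : ι → Fin m → F} {R : List (Grid S)}
    (hR : ∀ s : Grid S, s ∉ R → ∃ h ∈ degLE F fun i => (S i).card - 1,
      (∀ k, MvPolynomial.eval (I k) h = 0) ∧ MvPolynomial.eval s.1 h ≠ 0)
    (f : Grid S → F) (β : ι → F) :
    (∃ q ∈ LD d S f, ∀ k, MvPolynomial.eval (I k) q = β k) ↔
      ∃ q ∈ degLE F d, (∀ r ∈ R, MvPolynomial.eval r.1 q = f r) ∧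
        ∀ k, MvPolynomial.eval (I k) q = β k := by
  constructor
  · rintro ⟨q, hq, h⟩
    exact ⟨q, hq.1, fun r _ => hq.2 r, h⟩
  rintro ⟨q, hq, hqR, hqI⟩
  -- multiplying a separating polynomial by an interpolation polynomial isolates a grid point
  have hcorr : ∀ s : Grid S, ∃ e ∈ degLE F d, s ∉ R → (∀ k, MvPolynomial.eval (I k) e = 0) ∧
      (∀ x : Grid S, x ≠ s → MvPolynomial.eval x.1 e = 0) ∧ MvPolynomial.eval s.1 e = 1 := by
    intro s
    by_cases hs : s ∈ R
    · exact ⟨0, Submodule.zero_mem _, fun h => absurd hs h⟩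
    obtain ⟨h, h1, h2, h3⟩ := hR s hs
    have h4 := eval_gridDelta_self S s.1
    refine ⟨(MvPolynomial.eval s.1 h * MvPolynomial.eval s.1 (gridDelta S s.1))⁻¹ •
      (h * gridDelta S s.1), Submodule.smul_mem _ _ fun i => ?_, fun _ => ⟨fun k => ?_,
        fun x hx => ?_, ?_⟩⟩
    · refine (MvPolynomial.degreeOf_mul_le i _ _).trans ?_
      have h5 : h.degreeOf i ≤ (S i).card - 1 := h1 i
      have h6 : (gridDelta S s.1).degreeOf i ≤ (S i).card - 1 := gridDelta_mem s.2 i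
      have := hd i
      omega
    · rw [MvPolynomial.smul_eval, map_mul, h2 k, zero_mul, mul_zero]
    · rw [MvPolynomial.smul_eval, map_mul,
        eval_gridDelta_ne x.2 fun h => hx (Subtype.ext h.symm), mul_zero, mul_zero]
    · rw [MvPolynomial.smul_eval, map_mul, inv_mul_cancel₀ (mul_ne_zero h3 h4)]
  choose e he1 he2 using hcorr
  let _ : Fintype (Grid S) := Fintype.ofFinite _
  let c : Grid S → F := fun s => if s ∈ R then 0 else f s - MvPolynomial.eval s.1 q
  refine ⟨q + ∑ s, c s • e s, ⟨Submodule.add_mem _ hq (Submodule.sum_mem _ fun s _ =>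
    Submodule.smul_mem _ _ (he1 s)), fun x => ?_⟩, fun k => ?_⟩
  · rw [map_add, map_sum, Finset.sum_eq_single x]
    · rw [MvPolynomial.smul_eval]
      by_cases hx : x ∈ R
      · simp [c, hx, hqR x hx]
      · simp [c, hx, (he2 x hx).2.2]
    · intro s _ hs
      rw [MvPolynomial.smul_eval]
      by_cases hsR : s ∈ R
      · simp [c, hsR]
      · rw [(he2 s hsR).2.1 x hs.symm, mul_zero]
    · simp
  · rw [map_add, map_sum, hqI k, Finset.sum_eq_zero, add_zero]
    intro s _
    rw [MvPolynomial.smul_eval]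
    by_cases hsR : s ∈ R
    · simp [c, hsR]
    · rw [(he2 s hsR).1 k, mul_zero]

/-- Translation by a polynomial that vanishes on the grid preserves the law of the encoding. -/
theorem rmEnc_apply_add (f : Grid S → F) {h : MvPolynomial (Fin m) F} (h1 : h ∈ degLE F d)
    (h2 : ∀ x : Grid S, MvPolynomial.eval x.1 h = 0) (c : (Fin m → F) → F) :
    rmEnc d S hd f (c + fun x => MvPolynomial.eval x h) = rmEnc d S hd f c := by
  have hinj : Function.Injective fun q : MvPolynomial (Fin m) F => q + h := add_left_injective h
  have hmap : (rmEnc d S hd f).map (· + fun x => MvPolynomial.eval x h) = rmEnc d S hd f := by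
    have hne := (LD_finite d S f).toFinset_nonempty.2 (LD_nonempty d S hd f)
    have key := uniformOfFinset_map_of_injective hinj hne hne fun q => by
      simp only [Set.Finite.mem_toFinset]
      constructor
      · intro hq
        refine ⟨q - h, ⟨Submodule.sub_mem (degLE F d) hq.1 h1, fun x => ?_⟩, by simp⟩
        rw [map_sub, hq.2, h2, sub_zero]
      · rintro ⟨q, hq, rfl⟩
        refine ⟨Submodule.add_mem (degLE F d) hq.1 h1, fun x => ?_⟩
        rw [map_add, hq.2, h2, add_zero]
    conv_rhs => rw [rmEnc, ← key, PMF.map_comp]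
    rw [rmEnc, PMF.map_comp]
    congr 1
    funext q x
    simp
  conv_lhs => rw [← hmap]
  exact pmf_map_apply_of_injective (add_left_injective _) _ c

/-- The conditional law of a value that is determined by the condition. -/
theorem filter_rmEnc_map_of_unique {f : Grid S → F} {T : List ((Fin m → F) × F)} {α : Fin m → F}
    (hT : ∃ c ∈ consistent T, c ∈ (rmEnc d S hd f).support) {β : F}
    (h : ∀ q ∈ LD d S f, (∀ xy ∈ T, MvPolynomial.eval xy.1 q = xy.2) →
      MvPolynomial.eval α q = β) :
    ((rmEnc d S hd f).filter (consistent T) hT).map (fun c => c α) = PMF.pure β := by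
  refine pmf_map_eq_pure fun c hc => ?_
  obtain ⟨hcT, hc⟩ := (PMF.mem_support_filter_iff hT).1 hc
  obtain ⟨q, hq, rfl⟩ := (mem_support_rmEnc hd).1 hc
  exact h q hq hcT

/-- The conditional law of a value that is not determined by the condition is uniform. -/
theorem filter_rmEnc_map_of_ne [Fintype F] {f : Grid S → F} {T : List ((Fin m → F) × F)}
    {α : Fin m → F} (hT : ∃ c ∈ consistent T, c ∈ (rmEnc d S hd f).support)
    {h : MvPolynomial (Fin m) F} (h1 : h ∈ degLE F d)
    (h2 : ∀ x : Grid S, MvPolynomial.eval x.1 h = 0)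
    (h3 : ∀ xy ∈ T, MvPolynomial.eval xy.1 h = 0) (h4 : MvPolynomial.eval α h ≠ 0) :
    ((rmEnc d S hd f).filter (consistent T) hT).map (fun c => c α) = PMF.uniformOfFintype F := by
  refine pmf_eq_uniformOfFintype fun a b => ?_
  set P := (rmEnc d S hd f).filter (consistent T) hT with hP
  set g := (b / MvPolynomial.eval α h) • h with hg
  have hgα : MvPolynomial.eval α g = b := by
    rw [hg, MvPolynomial.smul_eval, div_mul_cancel₀ _ h4]
  have hg1 : g ∈ degLE F d := Submodule.smul_mem _ _ h1
  have hg2 : ∀ x : Grid S, MvPolynomial.eval x.1 g = 0 := fun x => by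
    rw [hg, MvPolynomial.smul_eval, h2, mul_zero]
  have hg3 : ∀ xy ∈ T, MvPolynomial.eval xy.1 g = 0 := fun xy hxy => by
    rw [hg, MvPolynomial.smul_eval, h3 xy hxy, mul_zero]
  have hPg : ∀ c, P (c + fun x => MvPolynomial.eval x g) = P c := by
    intro c
    have hmem : (c + fun x => MvPolynomial.eval x g) ∈ consistent T ↔ c ∈ consistent T := by
      refine forall₂_congr fun xy hxy => ?_
      rw [Pi.add_apply, hg3 xy hxy, add_zero]
    rw [hP, PMF.filter_apply, PMF.filter_apply]
    congr 1
    by_cases hc : c ∈ consistent T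
    · rw [Set.indicator_of_mem hc, Set.indicator_of_mem (hmem.2 hc), rmEnc_apply_add hd f hg1 hg2]
    · rw [Set.indicator_of_notMem hc, Set.indicator_of_notMem (mt hmem.1 hc)]
  let E : ((Fin m → F) → F) ≃ ((Fin m → F) → F) := Equiv.addRight fun x => MvPolynomial.eval x g
  rw [PMF.map_apply, PMF.map_apply, ← E.tsum_eq]
  refine tsum_congr fun c => ?_
  have hE : E c = c + fun x => MvPolynomial.eval x g := rfl
  have hc' : a + b = E c α ↔ a = c α := by
    rw [hE, Pi.add_apply, hgα, add_left_inj]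
  by_cases hc : a = c α
  · rw [if_pos (hc'.2 hc), if_pos hc, hE, hPg]
  · rw [if_neg (mt hc'.1 hc), if_neg hc]

end

/-! ### Vectors -/

/-- On input `(D, (a, b))`, the entrywise product of two vectors. -/
def vmulRunP : Prog :=
  tabE (fMulE (fstE .snd) (nthE .fst (fstE (sndE .snd))) (nthE .fst (sndE (sndE .snd))))
    (lenE (fstE .snd))

/-- On input `(D, (z, b))`, the inner product of two vectors. -/
def dotRunP : Prog :=
  foldE (fAddE (fstE (sndE .snd)) (fstE .snd) .fst)
    vmulRunP (fZeroE .fst)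

/-- The inner product of two vectors. -/
def dotE (D z b : Prog) : Prog := .comp dotRunP (.pair D (.pair z b))

/-- On input `(D, ((c, z), (e, y)))`, the vector `c z - e y`. -/
def crossRunP : Prog :=
  tabE (fSubE (fstE .snd)
    (fMulE (fstE .snd) (fstE (fstE (sndE .snd))) (nthE .fst (sndE (fstE (sndE .snd)))))
    (fMulE (fstE .snd) (fstE (sndE (sndE .snd))) (nthE .fst (sndE (sndE (sndE .snd))))))
    (lenE (sndE (fstE .snd)))

/-- The difference of two multiples of vectors. -/
def crossE (D c z e y : Prog) : Prog := .comp crossRunP (.pair D (.pair (.pair c z) (.pair e y)))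

/-- The entrywise product of two vectors. -/
def vmulE (D a b : Prog) : Prog := .comp vmulRunP (.pair D (.pair a b))

namespace FieldCtx

variable (K : FieldCtx)

/-- A bound for the size of field elements. -/
noncomputable def elemSize : ℕ := K.desc.size * (K.desc.size + 1) + 1

/-- A bound for the size of vectors of length `N`. -/
noncomputable def vecSize (N : ℕ) : ℕ := N * (K.elemSize + 1) + 1

variable {K}

theorem size_vec_le {N : ℕ} (v : Fin N → K.F) : (K.vec v).size ≤ K.vecSize N := by
  refine size_ofList_le (by simp) fun a ha => ?_
  obtain ⟨i, rfl⟩ := (List.mem_ofFn' _ _).1 ha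
  exact K.size_enc_le _

theorem vec_eq_map {N : ℕ} (v : Fin N → K.F) :
    K.vec v = .ofList ((List.ofFn v).map K.enc) := by
  rw [vec_eq, List.map_ofFn]
  rfl

end FieldCtx

section

variable {ι : Type u} {O : ι → Val → Val} {σ : ι → ℕ} {x : ι → Val} {K : ι → FieldCtx}
  {N : ι → ℕ} {D a b : Prog}

theorem PolyBd.elemSize (hD : Small σ (fun i => (K i).desc)) :
    PolyBd (fun i => (K i).elemSize) σ := (hD.mul (hD.add (.const 1))).add (.const 1)

theorem PolyBd.vecSize (hD : Small σ (fun i => (K i).desc)) (hN : PolyBd N σ) :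
    PolyBd (fun i => (K i).vecSize (N i)) σ :=
  (hN.mul ((PolyBd.elemSize hD).add (.const 1))).add (.const 1)

theorem Small.vec (hD : Small σ (fun i => (K i).desc)) (hN : PolyBd N σ)
    (v : ∀ i, Fin (N i) → (K i).F) : Small σ (fun i => (K i).vec (v i)) :=
  .of_le (PolyBd.vecSize hD hN) fun i => FieldCtx.size_vec_le (v i)

namespace Computes

variable {y z : ∀ i, Fin (N i) → (K i).F}

theorem vecLen (ha : Computes O σ x a (fun i => (K i).vec (y i))) :
    Computes O σ x (lenE a) (fun i => .atom (N i)) :=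
  (Computes.len (a := fun i => List.ofFn fun k => (K i).enc (y i k)) ha).congr fun i => by simp

theorem _root_.LocalSim.Small.vecLen (ha : Small σ (fun i => (K i).vec (y i))) : PolyBd N σ :=
  (Small.length (l := fun i => List.ofFn fun k => (K i).enc (y i k)) ha).of_le fun i => by simp

theorem vecNth {kp : Prog} {k : ∀ i, Fin (N i)} (hk : Computes O σ x kp (fun i => .atom (k i)))
    (ha : Computes O σ x a (fun i => (K i).vec (y i))) :
    Computes O σ x (nthE kp a) (fun i => (K i).enc (y i (k i))) :=
  hk.nth_ofFn (e := fun i k => (K i).enc (y i k)) ha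

theorem vmulRun (hD : Small σ (fun i => (K i).desc)) (hN : PolyBd N σ)
    (y z : ∀ i, Fin (N i) → (K i).F) :
    Computes O σ (fun i => .pair (K i).desc (.pair ((K i).vec (y i)) ((K i).vec (z i)))) vmulRunP
      (fun i => (K i).vec fun k => y i k * z i k) := by
  have hx := hD.pair ((hD.vec hN y).pair (hD.vec hN z))
  unfold vmulRunP
  refine Computes.tab (n := N) (fun i k => (K i).enc (y i k * z i k))
    (vecLen (y := y) (.simple hx rfl fun _ => rfl)) hN fun hx' => ?_
  refine .fMul (K := fun j : TabIdx N => K j.i) (X := fun j => y j.i j.k) (Y := fun j => z j.i j.k)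
    ?_ ?_ ?_
  · exact .simple hx' rfl fun _ => rfl
  · refine .vecNth (K := fun j : TabIdx N => K j.i) (y := fun j => y j.i)
      (k := fun j => j.k) ?_ ?_ <;>
      exact .simple hx' rfl fun _ => rfl
  · refine .vecNth (K := fun j : TabIdx N => K j.i) (y := fun j => z j.i)
      (k := fun j => j.k) ?_ ?_ <;>
      exact .simple hx' rfl fun _ => rfl

theorem vmul (hD : Computes O σ x D (fun i => (K i).desc))
    (ha : Computes O σ x a (fun i => (K i).vec (y i)))
    (hb : Computes O σ x b (fun i => (K i).vec (z i))) :
    Computes O σ x (vmulE D a b) (fun i => (K i).vec fun k => y i k * z i k) :=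
  (hD.pair (ha.pair hb)).comp (vmulRun hD.small ha.small.vecLen y z)

theorem dotRun (hD : Small σ (fun i => (K i).desc)) (hN : PolyBd N σ)
    (y z : ∀ i, Fin (N i) → (K i).F) :
    Computes O σ (fun i => .pair (K i).desc (.pair ((K i).vec (y i)) ((K i).vec (z i)))) dotRunP
      (fun i => (K i).enc (y i ⬝ᵥ z i)) := by
  have hx := hD.pair ((hD.vec hN y).pair (hD.vec hN z))
  have h1 := vmulRun (O := O) hD hN y z
  unfold dotRunP
  refine Computes.congr (Computes.foldEnv (fun i => (K i).enc) (fun i => (K i).enc)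
    (fun i => List.ofFn fun k => y i k * z i k) (fun i => 0) (fun i s a => s + a)
    (fun _ _ _ => True) ?_ (.fZero (.simple hx rfl fun _ => rfl)) (fun _ => trivial)
    (fun _ _ _ _ _ _ => trivial) (PolyBd.elemSize hD) (fun i _ b _ _ => (K i).size_enc_le b)
    fun hx' => ?_) fun i => ?_
  · exact h1.congr fun i => FieldCtx.vec_eq_map _
  · refine .fAdd (K := fun j : FoldIdx (A := fun i => (K i).F) (B := fun i => (K i).F) _ _ => K j.i)
      (X := fun j => j.b) (Y := fun j => j.a) ?_ ?_ ?_ <;>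
      exact .simple hx' rfl fun _ => rfl
  · rw [← List.sum_eq_foldl, List.sum_ofFn]
    rfl

theorem dot (hD : Computes O σ x D (fun i => (K i).desc))
    (ha : Computes O σ x a (fun i => (K i).vec (y i)))
    (hb : Computes O σ x b (fun i => (K i).vec (z i))) :
    Computes O σ x (dotE D a b) (fun i => (K i).enc (y i ⬝ᵥ z i)) :=
  (hD.pair (ha.pair hb)).comp (dotRun hD.small ha.small.vecLen y z)

theorem cross {cp ep : Prog} {c e : ∀ i, (K i).F} (hD : Computes O σ x D (fun i => (K i).desc))
    (hc : Computes O σ x cp (fun i => (K i).enc (c i)))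
    (ha : Computes O σ x a (fun i => (K i).vec (y i)))
    (he : Computes O σ x ep (fun i => (K i).enc (e i)))
    (hb : Computes O σ x b (fun i => (K i).vec (z i))) :
    Computes O σ x (crossE D cp a ep b)
      (fun i => (K i).vec fun k => c i * y i k - e i * z i k) := by
  have h := hD.pair ((hc.pair ha).pair (he.pair hb))
  have hx := h.small
  refine h.comp ?_
  unfold crossRunP
  refine (Computes.tab (n := N) (fun i k => (K i).enc (c i * y i k - e i * z i k))
    (vecLen (y := y) (.simple hx rfl fun _ => rfl)) ha.small.vecLen fun hx' => ?_)
  refine .fSub (K := fun j : TabIdx N => K j.i) (X := fun j => c j.i * y j.i j.k)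
    (Y := fun j => e j.i * z j.i j.k) ?_ ?_ ?_
  · exact .simple hx' rfl fun _ => rfl
  · refine .fMul (K := fun j : TabIdx N => K j.i) (X := fun j => c j.i)
      (Y := fun j => y j.i j.k) ?_ ?_
      (.vecNth (K := fun j : TabIdx N => K j.i) (y := fun j => y j.i) (k := fun j => j.k) ?_ ?_) <;>
      exact .simple hx' rfl fun _ => rfl
  · refine .fMul (K := fun j : TabIdx N => K j.i) (X := fun j => e j.i)
      (Y := fun j => z j.i j.k) ?_ ?_
      (.vecNth (K := fun j : TabIdx N => K j.i) (y := fun j => z j.i) (k := fun j => j.k) ?_ ?_) <;>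
      exact .simple hx' rfl fun _ => rfl

end Computes
end

/-! ### Elimination -/

namespace FieldCtx

variable (K : FieldCtx)

/-- The representation of lists of vectors. -/
noncomputable def rows {N : ℕ} (Z : List (Fin N → K.F)) : Val := .ofList (Z.map K.vec)

/-- The representation of the state of an elimination. The number `0` stands for a pivot that has
not been found yet; pivots are pairs. -/
noncomputable def elimState {N : ℕ} (s : Option (K.F × (Fin N → K.F)) × List (Fin N → K.F)) : Val :=
  .pair (s.1.elim (.atom 0) fun c => .pair (K.enc c.1) (K.vec c.2)) (K.rows s.2)

/-- The representation of a vector with a list of field elements as its tag. -/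
noncomputable def tagged {N : ℕ} (c : List K.F × (Fin N → K.F)) : Val :=
  .pair (.ofList (c.1.map K.enc)) (K.vec c.2)

/-- The representation of the result of a reduction. -/
noncomputable def redState {N : ℕ}
    (s : List (Fin N → K.F) × List (List K.F × (Fin N → K.F))) : Val :=
  .pair (K.rows s.1) (.ofList (s.2.map K.tagged))

/-- The representation of a vector with a field element as its tag. -/
noncomputable def factor {N : ℕ} (c : K.F × (Fin N → K.F)) : Val := .pair (K.enc c.1) (K.vec c.2)

end FieldCtx

/-- On input `(D, (b, Z))`, the elimination of `b` from the rows `Z`. -/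
def elimRowsP : Prog :=
  foldE
    (.ite (.comp .isPair (fstE (fstE .snd)))
      (.pair (fstE (fstE .snd)) (.pair
        (crossE (fstE (sndE .snd)) (fstE (fstE (fstE .snd))) .fst
          (dotE (fstE (sndE .snd)) .fst (fstE (sndE (sndE .snd)))) (sndE (fstE (fstE .snd))))
        (sndE (fstE .snd))))
      (.ite (fNzE (dotE (fstE (sndE .snd)) .fst (fstE (sndE (sndE .snd)))))
        (.pair (.pair (dotE (fstE (sndE .snd)) .fst (fstE (sndE (sndE .snd)))) .fst)
          (sndE (fstE .snd)))
        (.pair (fstE (fstE .snd)) (.pair .fst (sndE (fstE .snd))))))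
    (sndE .snd) (.const (.pair (.atom 0) (.atom 0)))

section

variable {ι : Type u} {O : ι → Val → Val} {σ : ι → ℕ} {x : ι → Val} {K : ι → FieldCtx}
  {N : ι → ℕ}

theorem Computes.elimRowsRun (hD : Small σ (fun i => (K i).desc)) (hN : PolyBd N σ)
    (y : ∀ i, Fin (N i) → (K i).F) (Z : ∀ i, List (Fin (N i) → (K i).F))
    (hZ : PolyBd (fun i => (Z i).length) σ) :
    Computes O σ (fun i => .pair (K i).desc (.pair ((K i).vec (y i)) ((K i).rows (Z i))))
      elimRowsP (fun i => (K i).elimState (elimRows (y i) (Z i))) := by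
  have hV := PolyBd.vecSize hD hN
  have hx : Small σ (fun i => .pair (K i).desc (.pair ((K i).vec (y i)) ((K i).rows (Z i)))) := by
    refine hD.pair ((hD.vec hN y).pair (Small.list hZ hV (fun i => by simp) fun i a ha => ?_))
    obtain ⟨v, _, rfl⟩ := List.mem_map.1 ha
    exact FieldCtx.size_vec_le v
  refine Computes.foldEnv (fun i => (K i).vec) (fun i => (K i).elimState) Z (fun _ => (none, []))
    (fun i => elimStep (y i)) (fun i pre s => s.2.length ≤ pre.length)
    (.simple hx rfl fun _ => rfl) (.const hx _) (by simp)
    (fun i pre z s _ hs => ?_)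
    (g := fun i => ((K i).elemSize + (K i).vecSize (N i) + 1) +
      ((Z i).length * ((K i).vecSize (N i) + 1) + 1) + 1)
    ((((PolyBd.elemSize hD).add hV).add (.const 1)).add
      ((hZ.mul (hV.add (.const 1))).add (.const 1)) |>.add (.const 1))
    (fun i pre s hpre hs => ?_) fun hx' => ?_
  · rcases s with ⟨_ | c, l⟩ <;> simp only [elimStep]
    · split_ifs <;> simp at hs ⊢ <;> omega
    · simp at hs ⊢; omega
  · have h1 : (Val.ofList (s.2.map (K i).vec)).size ≤
        (Z i).length * ((K i).vecSize (N i) + 1) + 1 := by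
      refine size_ofList_le ?_ fun a ha => ?_
      · rw [List.length_map]
        exact hs.trans hpre.length_le
      · obtain ⟨v, _, rfl⟩ := List.mem_map.1 ha
        exact FieldCtx.size_vec_le v
    rcases s with ⟨_ | c, l⟩
    · simp only [FieldCtx.elimState, FieldCtx.rows, Val.size, Option.elim] at h1 ⊢
      simp
      omega
    · have h2 := (K i).size_enc_le c.1
      have h3 := FieldCtx.size_vec_le c.2
      simp only [FieldCtx.elimState, FieldCtx.rows, FieldCtx.elemSize, Val.size, Option.elim] at *
      omega
  · refine Computes.ite (fun j => j.b.1.isSome = true)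
      (b := fun j => if j.b.1.isSome then 1 else 0)
      (.simple hx' rfl fun j => ?_) (fun j => by simp [Option.isSome_iff_ne_none]) ?_ ?_
    · rcases j with ⟨_, _, _, _, _, ⟨_ | _, _⟩, _⟩ <;> rfl
    · -- the pivot is known
      have hx2 := hx'.pull (Subtype.val :
        {j : FoldIdx Z (B := fun i => Option ((K i).F × (Fin (N i) → (K i).F)) ×
          List (Fin (N i) → (K i).F)) (fun i pre s => s.2.length ≤ pre.length) //
            j.b.1.isSome = true} → _)
      have hsome : ∀ j : {j : FoldIdx Z (B := fun i => Option ((K i).F × (Fin (N i) → (K i).F)) ×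
          List (Fin (N i) → (K i).F)) (fun i pre s => s.2.length ≤ pre.length) //
            j.b.1.isSome = true}, j.1.b.1 = some (j.1.b.1.get j.2) := fun j => by simp
      have hpair := fun j => congrArg
        (fun o : Option ((K j.1.i).F × (Fin (N j.1.i) → (K j.1.i).F)) =>
        o.elim (Val.atom 0) fun c => .pair ((K j.1.i).enc c.1) ((K j.1.i).vec c.2)) (hsome j)
      refine Computes.congr (Computes.pair (.simple hx2 rfl fun _ => rfl)
        (.pair (.cross (K := fun j => K j.1.i) (c := fun j => (j.1.b.1.get j.2).1)
          (y := fun j => j.1.a) (z := fun j => (j.1.b.1.get j.2).2)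
          (e := fun j => j.1.a ⬝ᵥ y j.1.i)
          (.simple hx2 rfl fun _ => rfl) (.simple hx2 rfl fun j => ?_)
          (.simple hx2 rfl fun _ => rfl)
          (.dot (K := fun j => K j.1.i) (y := fun j => j.1.a) (z := fun j => y j.1.i)
            (.simple hx2 rfl fun _ => rfl) (.simple hx2 rfl fun _ => rfl)
            (.simple hx2 rfl fun _ => rfl)) (.simple hx2 rfl fun j => ?_))
          (.simple hx2 rfl fun _ => rfl))) fun j => ?_
      · exact (congrArg Val.fst (hpair j))
      · exact (congrArg Val.snd (hpair j))
      · obtain ⟨⟨_, _, _, _, _, ⟨_ | _, _⟩, _⟩, h⟩ := j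
        · exact absurd h (by simp)
        · rfl
    · have hx2 := hx'.pull (Subtype.val :
        {j : FoldIdx Z (B := fun i => Option ((K i).F × (Fin (N i) → (K i).F)) ×
          List (Fin (N i) → (K i).F)) (fun i pre s => s.2.length ≤ pre.length) //
            ¬ j.b.1.isSome = true} → _)
      have hdot := Computes.dot (O := fun j => O j.1.i) (D := fstE (sndE .snd)) (a := .fst)
        (b := fstE (sndE (sndE .snd))) (K := fun j => K j.1.i) (y := fun j => j.1.a)
        (z := fun j => y j.1.i) (.simple hx2 rfl fun _ => rfl) (.simple hx2 rfl fun _ => rfl)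
        (.simple hx2 rfl fun _ => rfl)
      refine Computes.ite (fun j => j.1.a ⬝ᵥ y j.1.i ≠ 0) hdot.fNz (fun j => by simp) ?_ ?_
      · refine Computes.congr (((hdot.pull Subtype.val).pair
          (.simple (hx2.pull Subtype.val) rfl fun _ => rfl)).pair
          (.simple (hx2.pull Subtype.val) rfl fun _ => rfl)) fun j => ?_
        obtain ⟨⟨⟨_, _, _, _, _, ⟨_ | _, _⟩, _⟩, h⟩, h'⟩ := j
        · simp only [elimStep]
          rw [if_neg h']
          rfl
        · exact absurd rfl h
      · refine Computes.simple (hx2.pull Subtype.val) rfl fun j => ?_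
        obtain ⟨⟨⟨_, _, _, _, _, ⟨_ | _, _⟩, _⟩, h⟩, h'⟩ := j
        · simp only [elimStep]
          rw [if_pos (not_not.1 h')]
          rfl
        · exact absurd rfl h

end

/-! ### Reduction of lists of tagged vectors -/

/-- On input `(D, (c, s))`, the step of the reduction for the tagged vector `c` in the state `s`. -/
def reduceStepP : Prog :=
  .comp (.pair (sndE .fst) (.ite (.comp .isPair (fstE .fst))
      (.pair (fstE .snd) (sndE (sndE .snd))) (sndE (sndE .snd))))
    (.pair (.comp elimRowsP (.pair .fst (.pair (sndE (fstE .snd)) (fstE (sndE .snd))))) .snd)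

/-- On input `(D, N)`, the rows of the identity matrix. Two indices are equal if and only if both
truncated differences are zero. -/
def idRowsP : Prog :=
  tabE (tabE (.ite (natAddE (natSubE .fst (fstE .snd)) (natSubE (fstE .snd) .fst))
    (fZeroE (fstE (sndE .snd))) (fOneE (fstE (sndE .snd)))) (sndE .snd)) .snd

/-- On input `(D, (N, l))`, the reduction of the list `l` of tagged vectors of length `N`. -/
def reduceListP : Prog :=
  foldE (.comp reduceStepP (.pair (fstE (sndE .snd)) (.pair .fst (fstE .snd))))
    (sndE .snd) (.pair (.comp idRowsP (.pair .fst (fstE .snd))) nilP)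

/-- On input `(D, (l, M))`, all products of the tagged vectors in `l` with the factors in `M`. -/
def tensorP : Prog :=
  flattenE (mapE (mapE (.pair (.pair (fstE .fst) (fstE (fstE .snd)))
    (vmulE (fstE (sndE .snd)) (sndE .fst) (sndE (fstE .snd)))) (sndE (sndE .snd))) (fstE .snd))

/-- On input `(D, (N, Ms))`, the iterated tensor product with reductions. -/
def tensorReduceP : Prog :=
  foldE (.comp reduceListP (.pair (fstE (sndE .snd)) (.pair (fstE (sndE (sndE .snd)))
      (.comp tensorP (.pair (fstE (sndE .snd)) (.pair (sndE (fstE .snd)) .fst))))))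
    (revE (sndE .snd))
    (.comp reduceListP (.pair .fst (.pair (fstE .snd)
      (.pair (.pair nilP (tabE (fOneE (fstE .snd)) (fstE .snd))) nilP))))

section

variable {ι : Type u} {O : ι → Val → Val} {σ : ι → ℕ} {x : ι → Val} {K : ι → FieldCtx}
  {N : ι → ℕ}

theorem Computes.reduceStepRun (c : ∀ i, List (K i).F × (Fin (N i) → (K i).F))
    (s : ∀ i, List (Fin (N i) → (K i).F) × List (List (K i).F × (Fin (N i) → (K i).F)))
    (hx : Small σ (fun i => .pair (K i).desc (.pair ((K i).tagged (c i)) ((K i).redState (s i))))) :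
    Computes O σ (fun i => .pair (K i).desc (.pair ((K i).tagged (c i)) ((K i).redState (s i))))
      reduceStepP (fun i => (K i).redState (reduceStep (s i) (c i))) := by
  have hN : PolyBd N σ := hx.snd.fst.snd.vecLen
  have h1 := Computes.elimRowsRun (O := O) hx.fst hN (fun i => (c i).2) (fun i => (s i).1)
    (hx.snd.snd.fst.length.of_le fun i => by simp)
  have h2 : Computes O σ (fun i => .pair (K i).desc
      (.pair ((K i).tagged (c i)) ((K i).redState (s i))))
      (.pair .fst (.pair (sndE (fstE .snd)) (fstE (sndE .snd))))
      (fun i => .pair (K i).desc (.pair ((K i).vec (c i).2) ((K i).rows (s i).1))) :=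
    .simple hx rfl fun _ => rfl
  have h3 := (h2.comp h1).pair (.simple (y := fun i => .pair ((K i).tagged (c i))
    ((K i).redState (s i))) (pr := .snd) hx rfl fun _ => rfl)
  refine h3.comp ?_
  have hx3 := h3.small
  refine .pair (.simple hx3 rfl fun _ => rfl) ?_
  refine .ite (fun i => (elimRows (c i).2 (s i).1).1.isSome = true)
    (b := fun i => if (elimRows (c i).2 (s i).1).1.isSome then 1 else 0)
    (.simple hx3 rfl fun i => ?_) (fun i => by simp [Option.isSome_iff_ne_none]) ?_ ?_
  · simp only [FieldCtx.elimState]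
    rcases (elimRows (c i).2 (s i).1).1 with _ | _ <;> rfl
  · refine .simple (hx3.pull Subtype.val) rfl fun i => ?_
    simp only [reduceStep, if_pos i.2]
    rfl
  · refine .simple (hx3.pull Subtype.val) rfl fun i => ?_
    simp only [reduceStep, if_neg i.2]
    rfl

theorem Computes.idRowsRun (hD : Small σ (fun i => (K i).desc)) (hN : PolyBd N σ) :
    Computes O σ (fun i => .pair (K i).desc (.atom (N i))) idRowsP
      (fun i => (K i).rows (List.ofFn fun (a b : Fin (N i)) => if (b : ℕ) = a then 1 else 0)) := by
  have hx := hD.pair (Small.atom hN)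
  unfold idRowsP
  refine Computes.congr (Computes.tab (n := N) (fun i a => (K i).vec fun b : Fin (N i) =>
    if (b : ℕ) = a then 1 else 0) (.simple hx rfl fun _ => rfl) hN fun hx1 => ?_) fun i => ?_
  · refine Computes.tab (n := fun j : TabIdx N => N j.i)
      (fun j b => (K j.i).enc (if (b : ℕ) = j.k then 1 else 0))
      (.simple hx1 rfl fun _ => rfl) (hN.pull TabIdx.i) fun hx2 => ?_
    have h1 : Computes (fun j : TabIdx (fun j : TabIdx N => N j.i) => O j.i.i) (fun j => σ j.i.i) _
      (natAddE (natSubE .fst (fstE .snd)) (natSubE (fstE .snd) .fst))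
      (fun j => .atom (((j.k : ℕ) - j.i.k) + (j.i.k - j.k))) :=
      .natAdd (.natSub (.simple hx2 rfl fun _ => rfl) (.simple hx2 rfl fun _ => rfl))
        (.natSub (.simple hx2 rfl fun _ => rfl) (.simple hx2 rfl fun _ => rfl))
    refine .ite (fun j => (j.k : ℕ) ≠ j.i.k) h1 (fun j => by omega) ?_ ?_
    · refine Computes.congr (.fZero (K := fun j => K j.1.i.i)
        (.simple (hx2.pull Subtype.val) rfl fun _ => rfl)) fun j => ?_
      rw [if_neg j.2]
    · refine Computes.congr (.fOne (K := fun j => K j.1.i.i)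
        (.simple (hx2.pull Subtype.val) rfl fun _ => rfl)) fun j => ?_
      rw [if_pos (not_not.1 j.2)]
  · rw [FieldCtx.rows, List.map_ofFn]
    rfl

theorem FieldCtx.size_redState_le {K : FieldCtx} {N B : ℕ}
    {s : List (Fin N → K.F) × List (List K.F × (Fin N → K.F))}
    (hs : s.1.length + s.2.length = N) (hB : ∀ c ∈ s.2, (K.tagged c).size ≤ B) :
    (K.redState s).size ≤ (N * (K.vecSize N + 1) + 1) + (N * (B + 1) + 1) + 1 := by
  have h1 : (K.rows s.1).size ≤ N * (K.vecSize N + 1) + 1 := by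
    refine size_ofList_le (by simp; omega) fun a ha => ?_
    obtain ⟨v, _, rfl⟩ := List.mem_map.1 ha
    exact size_vec_le v
  have h2 : (Val.ofList (s.2.map K.tagged)).size ≤ N * (B + 1) + 1 := by
    refine size_ofList_le (by simp; omega) fun a ha => ?_
    obtain ⟨v, hv, rfl⟩ := List.mem_map.1 ha
    exact hB v hv
  simp only [redState, Val.size]
  omega

theorem PolyBd.redState {B : ι → ℕ} (hD : Small σ (fun i => (K i).desc)) (hN : PolyBd N σ)
    (hB : PolyBd B σ) : PolyBd (fun i => (N i * ((K i).vecSize (N i) + 1) + 1) +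
      (N i * (B i + 1) + 1) + 1) σ :=
  (((hN.mul ((PolyBd.vecSize hD hN).add (.const 1))).add (.const 1)).add
    ((hN.mul (hB.add (.const 1))).add (.const 1))).add (.const 1)

/-- The state after any initial segment of the list is a reduction of that segment, so it has at
most `N` rows and at most `N` kept vectors, which are items of the list. -/
theorem Computes.reduceListRun (l : ∀ i, List (List (K i).F × (Fin (N i) → (K i).F)))
    (hx : Small σ (fun i => .pair (K i).desc
      (.pair (.atom (N i)) (.ofList ((l i).map (K i).tagged))))) (hN : PolyBd N σ) :
    Computes O σ (fun i => .pair (K i).desc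
      (.pair (.atom (N i)) (.ofList ((l i).map (K i).tagged))))
      reduceListP (fun i => (K i).redState (reduceList (l i))) := by
  unfold reduceListP
  have h0 : Computes O σ (fun i => .pair (K i).desc
      (.pair (.atom (N i)) (.ofList ((l i).map (K i).tagged)))) (.pair .fst (fstE .snd))
      (fun i => .pair (K i).desc (.atom (N i))) := .simple hx rfl fun _ => rfl
  have hs := (h0.comp (Computes.idRowsRun hx.fst hN)).pair (.nil hx)
  refine Computes.foldEnv (fun i => (K i).tagged) (fun i => (K i).redState) l
    (fun i => (List.ofFn fun (a b : Fin (N i)) => if (b : ℕ) = a then 1 else 0, []))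
    (fun i => reduceStep) (fun i pre s => s = reduceList pre)
    (.simple hx rfl fun _ => rfl) hs (fun _ => rfl)
    (fun i pre a s _ hs => ?_) (PolyBd.redState hx.fst hN hx.snd.snd)
    (fun i pre s hpre hs => ?_) fun hx' => ?_
  · rw [hs, reduceList, reduceList, List.foldl_append]
    rfl
  · subst hs
    obtain ⟨_, _, h3, h4⟩ := reduceList_spec pre
    refine FieldCtx.size_redState_le h4 fun c hc => ?_
    exact size_le_size_ofList (List.mem_map_of_mem
      (hpre.subset (h3.subset (List.mem_reverse.2 hc))))
  · have h1 : Computes (fun j : FoldIdx l (B := fun i => List (Fin (N i) → (K i).F) ×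
        List (List (K i).F × (Fin (N i) → (K i).F))) (fun i pre s => s = reduceList pre) =>
          O j.i) (fun j => σ j.i) _ (.pair (fstE (sndE .snd)) (.pair .fst (fstE .snd)))
        (fun j => .pair (K j.i).desc (.pair ((K j.i).tagged j.a) ((K j.i).redState j.b))) :=
      .simple hx' rfl fun _ => rfl
    exact h1.comp (Computes.reduceStepRun _ _ h1.small)

theorem Computes.tensorRun (l : ∀ i, List (List (K i).F × (Fin (N i) → (K i).F)))
    (M : ∀ i, List ((K i).F × (Fin (N i) → (K i).F)))
    (hx : Small σ (fun i => .pair (K i).desc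
      (.pair (.ofList ((l i).map (K i).tagged)) (.ofList ((M i).map (K i).factor))))) :
    Computes O σ (fun i => .pair (K i).desc
      (.pair (.ofList ((l i).map (K i).tagged)) (.ofList ((M i).map (K i).factor))))
      tensorP (fun i => .ofList ((tensor (l i) (M i)).map (K i).tagged)) := by
  unfold tensorP
  refine Computes.congr (Computes.flatten (a := fun i => (l i).map fun sb => (M i).map fun tv =>
    (K i).tagged (tv.1 :: sb.1, fun k => tv.2 k * sb.2 k)) ?_) fun i => ?_
  · refine Computes.congr (Computes.map (fun i => (K i).tagged) l (fun i sb => .ofList ((M i).map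
      fun tv => (K i).tagged (tv.1 :: sb.1, fun k => tv.2 k * sb.2 k)))
      (.simple hx rfl fun _ => rfl) fun hx1 => ?_) fun i => ?_
    · refine Computes.map (fun j : MapIdx l => (K j.i).factor) (fun j => M j.i)
        (fun j tv => (K j.i).tagged (tv.1 :: j.a.1, fun k => tv.2 k * j.a.2 k))
        ?_ fun hx2 => ?_
      · exact .simple hx1 rfl fun _ => rfl
      have hv := Computes.vmul (O := fun j => O j.i.i) (D := fstE (sndE .snd)) (a := sndE .fst)
        (b := sndE (fstE .snd))
        (K := fun j : MapIdx (ι := MapIdx l) (fun j => M j.i) => K j.i.i) (N := fun j => N j.i.i)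
        (y := fun j => j.a.2) (z := fun j => j.i.a.2)
        (.simple hx2 rfl fun _ => rfl) (.simple hx2 rfl fun _ => rfl) (.simple hx2 rfl fun _ => rfl)
      have ht : Computes (fun j : MapIdx (ι := MapIdx l) (fun j => M j.i) => O j.i.i)
          (fun j => σ j.i.i) _ (.pair (fstE .fst) (fstE (fstE .snd)))
          (fun j => .ofList ((j.a.1 :: j.i.a.1).map (K j.i.i).enc)) :=
        .simple hx2 rfl fun _ => rfl
      exact ht.pair hv
    · rw [List.map_map]
      rfl
  · rw [tensor, List.map_flatten, List.map_map]
    congr 2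
    refine List.map_congr_left fun sb _ => ?_
    rw [Function.comp, List.map_map]
    rfl

/-- A kept vector is tagged with one entry for each factor. -/
theorem tensorReduce_tag_length {F : Type*} [Field F] [DecidableEq F] {N : ℕ}
    (Ms : List (List (F × (Fin N → F)))) :
    ∀ c ∈ (tensorReduce Ms).2, c.1.length = Ms.length := by
  induction Ms with
  | nil =>
    intro c hc
    have := (reduceList_spec _).2.2.1.subset (List.mem_reverse.2 hc)
    rw [List.mem_singleton.1 this]
    rfl
  | cons M Ms ih =>
    intro c hc
    obtain ⟨sb, hsb, tv, _, rfl⟩ :=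
      mem_tensor.1 ((reduceList_spec _).2.2.1.subset (List.mem_reverse.2 hc))
    simp [ih sb hsb]

/-- The time is polynomial although the full tensor product is exponentially large: before each
step the list has at most `N` items, by `tensorReduce_length`. -/
theorem Computes.tensorReduceRun (Ms : ∀ i, List (List ((K i).F × (Fin (N i) → (K i).F))))
    (hx : Small σ (fun i => .pair (K i).desc (.pair (.atom (N i))
      (.ofList ((Ms i).map fun M => .ofList (M.map (K i).factor)))))) (hN : PolyBd N σ) :
    Computes O σ (fun i => .pair (K i).desc (.pair (.atom (N i))
      (.ofList ((Ms i).map fun M => .ofList (M.map (K i).factor)))))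
      tensorReduceP (fun i => (K i).redState (tensorReduce (Ms i))) := by
  unfold tensorReduceP
  have hD := hx.fst
  have hlen : PolyBd (fun i => (Ms i).length) σ := hx.snd.snd.length.of_le fun i => by simp
  have hl := Computes.rev (O := O) (a := fun i => (Ms i).map fun M => .ofList (M.map (K i).factor))
    (l := sndE .snd) (.simple hx rfl fun _ => rfl)
  have hone : Computes O σ _ (tabE (fOneE (fstE .snd)) (fstE .snd))
      (fun i => (K i).vec fun _ : Fin (N i) => 1) :=
    Computes.tab (n := N) (fun i _ => (K i).enc 1) (.simple hx rfl fun _ => rfl) hN fun hx1 =>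
      .fOne (.simple hx1 rfl fun _ => rfl)
  have hnil : Computes O σ _ nilP (fun i => .ofList (([] : List (K i).F).map (K i).enc)) :=
    .nil hx
  have hs := (Computes.simple (pr := .fst) hx rfl fun _ => rfl).pair
    ((Computes.simple (pr := fstE .snd) hx rfl fun _ => rfl).pair
      ((hnil.pair hone).pair (.nil (O := O) hx)))
  have hs2 := hs.comp (Computes.reduceListRun (O := O) (K := K) (N := N)
    (fun i => [([], fun _ => 1)]) hs.small hN)
  refine Computes.congr (Computes.foldEnv (fun i M => .ofList (M.map (K i).factor))
    (fun i => (K i).redState) (fun i => (Ms i).reverse)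
    (fun i => reduceList [([], fun _ => 1)])
    (fun i st M => reduceList (tensor st.2 M))
    (fun i pre s => s = tensorReduce pre.reverse)
    (hl.congr fun i => by rw [List.map_reverse]) hs2 (fun _ => rfl)
    (fun i pre a s _ hs => ?_)
    (PolyBd.redState hD hN (B := fun i => ((Ms i).length * ((K i).elemSize + 1) + 1) +
      (K i).vecSize (N i) + 1) ((((hlen.mul ((PolyBd.elemSize hD).add (.const 1))).add
        (.const 1)).add (PolyBd.vecSize hD hN)).add (.const 1)))
    (fun i pre s hpre hs => ?_) fun hx' => ?_) fun i => ?_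
  · rw [hs, List.reverse_append]
    rfl
  · subst hs
    refine FieldCtx.size_redState_le (tensorReduce_length _) fun c hc => ?_
    have h1 : (Val.ofList (c.1.map (K i).enc)).size ≤
        (Ms i).length * ((K i).elemSize + 1) + 1 := by
      refine size_ofList_le ?_ fun a ha => ?_
      · rw [List.length_map, tensorReduce_tag_length _ c hc, List.length_reverse]
        simpa using hpre.length_le
      · obtain ⟨v, _, rfl⟩ := List.mem_map.1 ha
        exact (K i).size_enc_le v
    have h2 := FieldCtx.size_vec_le c.2
    simp only [FieldCtx.tagged, Val.size]
    omega
  · have h1 : Computes (fun j : FoldIdx (fun i => (Ms i).reverse)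
        (B := fun i => List (Fin (N i) → (K i).F) ×
          List (List (K i).F × (Fin (N i) → (K i).F)))
        (fun i pre s => s = tensorReduce pre.reverse) => O j.i) (fun j => σ j.i) _
        (.pair (fstE (sndE .snd)) (.pair (sndE (fstE .snd)) .fst))
        (fun j => .pair (K j.i).desc (.pair (.ofList (j.b.2.map (K j.i).tagged))
          (.ofList (j.a.map (K j.i).factor)))) := .simple hx' rfl fun _ => rfl
    have h2 := h1.comp (Computes.tensorRun _ _ h1.small)
    have h3 := (Computes.simple (pr := fstE (sndE .snd)) hx' rfl fun _ => rfl).pair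
      ((Computes.simple (pr := fstE (sndE (sndE .snd))) hx' rfl fun _ => rfl).pair h2)
    exact h3.comp (Computes.reduceListRun _ h3.small
      (hN.pull FoldIdx.i))
  · rw [List.foldl_reverse]
    rfl

end

/-! ### The constraint locator -/

/-- On input `(D, (L, (t, x)))`, the product of the differences `x - z` for the items `z ≠ t` of
the list `L`. -/
def deltaP : Prog :=
  foldE (.ite (fNzE (fSubE (fstE (sndE .snd)) .fst (fstE (sndE (sndE (sndE .snd))))))
    (fMulE (fstE (sndE .snd)) (fstE .snd)
      (fSubE (fstE (sndE .snd)) (sndE (sndE (sndE (sndE .snd)))) .fst))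
    (fstE .snd)) (fstE .snd) (fOneE .fst)

/-- On input `(D, (L, col))`, the values at the coordinates `col` of the interpolation factors of
the items of `L`. -/
def deltaMultsP : Prog :=
  mapE (.pair .fst (tabE (.comp deltaP (.pair (fstE (sndE .snd)) (.pair (fstE (sndE (sndE .snd)))
    (.pair (fstE .snd) (nthE .fst (sndE (sndE (sndE .snd)))))))) (lenE (sndE (sndE .snd)))))
    (fstE .snd)

/-- On input `(D, (d, col))`, the powers up to `d` of the coordinates `col`. -/
def powMultsP : Prog :=
  tabE (.pair (fZeroE (fstE .snd)) (tabE (fPowE (fstE (sndE .snd))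
      (nthE .fst (sndE (sndE (sndE .snd)))) (fstE .snd)) (lenE (sndE (sndE .snd)))))
    (natAddE (fstE .snd) (numE 1))

/-- On input `(j, pts)`, the coordinates number `j` of the points. -/
def colP : Prog := tabE (nthE (fstE .snd) (nthE .fst (sndE .snd))) (lenE .snd)

/-- On input `(par, pts)`, the interpolation factors of all coordinates. -/
def deltaAllP : Prog :=
  tabE (.comp deltaMultsP (.pair (fstE (fstE .snd)) (.pair (nthE .fst (sndE (sndE (fstE .snd))))
    (.comp colP (.pair .fst (sndE .snd)))))) (lenE (fstE (sndE .fst)))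

/-- On input `(par, pts)`, the powers of all coordinates. -/
def powAllP : Prog :=
  tabE (.comp powMultsP (.pair (fstE (fstE .snd)) (.pair (nthE .fst (fstE (sndE (fstE .snd))))
    (.comp colP (.pair .fst (sndE .snd)))))) (lenE (fstE (sndE .fst)))

/-- On input `(par, pts)`, the relevant message locations. -/
def selectP : Prog :=
  mapE (fstE .fst) (sndE (.comp tensorReduceP
    (.pair (fstE .fst) (.pair (lenE .snd) deltaAllP))))

/-- On input `(par, pts)`, the linear constraints on the values at the points of the polynomials of
the given degree. -/
def constraintP : Prog :=
  fstE (.comp tensorReduceP (.pair (fstE .fst) (.pair (lenE .snd) powAllP)))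

/-- The constraint locator. -/
def locatorP : Prog :=
  .comp (.pair .fst (.comp constraintP (.pair (fstE .snd) (appendE .fst (sndE .snd)))))
    (.pair (.comp selectP (.pair .fst .snd)) .id)

theorem Val.ofList_ofFn_map {A : Type*} {n : ℕ} (f : A → Val) (g : Fin n → A) :
    Val.ofList (List.ofFn fun k => f (g k)) = .ofList ((List.ofFn g).map f) := by
  rw [List.map_ofFn]
  rfl

/-- The parameters of an encoding by polynomials of restricted degree. -/
structure LDParams where
  K : FieldCtx
  m : ℕ
  d : Fin m → ℕ
  L : Fin m → List K.F

namespace LDParams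

variable (P : LDParams)

/-- The representation of parameters. -/
noncomputable def val : Val :=
  .pair P.K.desc (.pair (.ofList (List.ofFn fun i => .atom (P.d i)))
    (.ofList (List.ofFn fun i => .ofList ((P.L i).map P.K.enc))))

/-- The representation of a list of points. -/
noncomputable def points {N : ℕ} (pts : Fin N → Fin P.m → P.K.F) : Val :=
  .ofList (List.ofFn fun k => P.K.vec (pts k))

/-- The interpolation factors at a list of points. -/
noncomputable def deltaAll {N : ℕ} (pts : Fin N → Fin P.m → P.K.F) :
    List (List (P.K.F × (Fin N → P.K.F))) :=
  List.ofFn fun j => deltaMults (P.L j) fun k => pts k j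

/-- The powers of the coordinates of a list of points. -/
noncomputable def powAll {N : ℕ} (pts : Fin N → Fin P.m → P.K.F) :
    List (List (P.K.F × (Fin N → P.K.F))) :=
  List.ofFn fun j => powMults (P.d j) fun k => pts k j

/-- The message locations that matter for the values at a list of points. -/
noncomputable def select {N : ℕ} (pts : Fin N → Fin P.m → P.K.F) : List (Fin P.m → P.K.F) :=
  (tensorReduce (P.deltaAll pts)).2.map fun c j => c.1.getD j 0

/-- Reading a tag as a point loses nothing, since its length is the number of coordinates; the
default value in `select` is never used. -/
theorem ofFn_select {N : ℕ} (pts : Fin N → Fin P.m → P.K.F) :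
    ∀ c ∈ (tensorReduce (P.deltaAll pts)).2,
      (List.ofFn fun j : Fin P.m => c.1.getD j 0) = c.1 := by
  intro c hc
  have h := tensorReduce_tag_length _ c hc
  rw [deltaAll, List.length_ofFn] at h
  refine List.ext_getElem (by simp [h]) fun n h1 h2 => ?_
  simp [h2]

theorem select_length_le {N : ℕ} (pts : Fin N → Fin P.m → P.K.F) :
    (P.select pts).length ≤ N := by
  have := tensorReduce_length (P.deltaAll pts)
  rw [select, List.length_map]
  omega

/-- The linear constraints on the values at a list of points. -/
noncomputable def constraints {N : ℕ} (pts : Fin N → Fin P.m → P.K.F) : List (Fin N → P.K.F) :=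
  (tensorReduce (P.powAll pts)).1

/-- The selected message locations followed by the points. -/
noncomputable def allPoints {N : ℕ} (pts : Fin N → Fin P.m → P.K.F) :
    Fin ((P.select pts).length + N) → Fin P.m → P.K.F := Fin.append (P.select pts).get pts

theorem points_allPoints {N : ℕ} (pts : Fin N → Fin P.m → P.K.F) :
    P.points (P.allPoints pts) = .ofList ((P.select pts).map P.K.vec ++
      List.ofFn fun k => P.K.vec (pts k)) := by
  rw [points, Val.ofList_ofFn_map, allPoints, List.ofFn_fin_append, List.map_append, List.ofFn_get,
    List.map_ofFn]
  rfl

end LDParams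

section

variable {ι : Type u} {O : ι → Val → Val} {σ : ι → ℕ} {x : ι → Val} {K : ι → FieldCtx}
  {N : ι → ℕ}

namespace Computes

theorem deltaRun (L : ∀ i, List (K i).F) (t X : ∀ i, (K i).F)
    (hx : Small σ (fun i => .pair (K i).desc (.pair (.ofList ((L i).map (K i).enc))
      (.pair ((K i).enc (t i)) ((K i).enc (X i)))))) :
    Computes O σ (fun i => .pair (K i).desc (.pair (.ofList ((L i).map (K i).enc))
      (.pair ((K i).enc (t i)) ((K i).enc (X i))))) deltaP
      (fun i => (K i).enc (delta (L i) (t i) (X i))) := by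
  unfold deltaP
  refine Computes.foldEnv (fun i => (K i).enc) (fun i => (K i).enc) L (fun i => 1)
    (fun i acc z => if z = t i then acc else acc * (X i - z)) (fun _ _ _ => True)
    (.simple hx rfl fun _ => rfl) (.fOne (.simple hx rfl fun _ => rfl)) (fun _ => trivial)
    (fun _ _ _ _ _ _ => trivial) (PolyBd.elemSize hx.fst) (fun i _ b _ _ => (K i).size_enc_le b)
    fun hx' => ?_
  refine .ite (fun j => j.a ≠ t j.i) (.fNz (K := fun j : FoldIdx L _ => K j.i)
    (X := fun j => j.a - t j.i) (.fSub (K := fun j : FoldIdx L _ => K j.i)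
      (X := fun j => j.a) (Y := fun j => t j.i) ?_ ?_ ?_)) (fun j => by simp [sub_eq_zero]) ?_ ?_
  · exact .simple hx' rfl fun _ => rfl
  · exact .simple hx' rfl fun _ => rfl
  · exact .simple hx' rfl fun _ => rfl
  · have hx2 := hx'.pull (Subtype.val : {j : FoldIdx L (fun _ _ (_ : (K _).F) => True) //
      j.a ≠ t j.i} → _)
    have h1 := Computes.fMul (O := fun j => O j.1.i) (K := fun j => K j.1.i)
      (D := fstE (sndE .snd)) (a := fstE .snd)
      (b := fSubE (fstE (sndE .snd)) (sndE (sndE (sndE (sndE .snd)))) .fst)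
      (X := fun j => j.1.b) (Y := fun j => X j.1.i - j.1.a)
      (.simple hx2 rfl fun _ => rfl) (.simple hx2 rfl fun _ => rfl)
      (.fSub (.simple hx2 rfl fun _ => rfl) (.simple hx2 rfl fun _ => rfl)
        (.simple hx2 rfl fun _ => rfl))
    exact h1.congr fun j => by rw [if_neg j.2]
  · refine .simple (hx'.pull Subtype.val) rfl fun j => ?_
    rw [if_pos (not_not.1 j.2)]
    rfl

theorem deltaMultsRun (L : ∀ i, List (K i).F) (y : ∀ i, Fin (N i) → (K i).F)
    (hx : Small σ (fun i => .pair (K i).desc (.pair (.ofList ((L i).map (K i).enc))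
      ((K i).vec (y i))))) :
    Computes O σ (fun i => .pair (K i).desc (.pair (.ofList ((L i).map (K i).enc))
      ((K i).vec (y i)))) deltaMultsP
      (fun i => .ofList ((deltaMults (L i) (y i)).map (K i).factor)) := by
  have hN : PolyBd N σ := hx.snd.snd.vecLen
  unfold deltaMultsP
  refine Computes.congr (Computes.map (fun i => (K i).enc) L
    (fun i t => (K i).factor (t, fun k => delta (L i) t (y i k)))
    (.simple hx rfl fun _ => rfl) fun hx1 => ?_) fun i => ?_
  · have hlen := Computes.vecLen (O := fun j => O j.i) (K := fun j => K j.i)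
      (y := fun j => y j.i) (a := sndE (sndE .snd)) (.simple hx1 rfl fun _ => rfl)
    have ht := Computes.tab (n := fun j : MapIdx L => N j.i)
      (body := .comp deltaP (.pair (fstE (sndE .snd)) (.pair (fstE (sndE (sndE .snd)))
        (.pair (fstE .snd) (nthE .fst (sndE (sndE (sndE .snd))))))))
      (fun j k => (K j.i).enc (delta (L j.i) j.a (y j.i k))) hlen (hN.pull MapIdx.i) fun hx2 => by
        have h1 := Computes.vecNth (O := fun j => O j.i.i) (K := fun j => K j.i.i)
          (y := fun j => y j.i.i) (k := fun j => j.k) (kp := .fst)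
          (a := sndE (sndE (sndE .snd))) (.simple hx2 rfl fun _ => rfl)
          (.simple hx2 rfl fun _ => rfl)
        have h2 := (Computes.simple (y := fun j => (K j.i.i).desc) (pr := fstE (sndE .snd))
          hx2 rfl fun _ => rfl).pair
          ((Computes.simple (y := fun j => .ofList ((L j.i.i).map (K j.i.i).enc))
            (pr := fstE (sndE (sndE .snd))) hx2 rfl fun _ => rfl).pair
          ((Computes.simple (y := fun j => (K j.i.i).enc j.i.a) (pr := fstE .snd)
            hx2 rfl fun _ => rfl).pair h1))
        exact h2.comp (Computes.deltaRun _ _ _ h2.small)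
    exact (Computes.simple (pr := .fst) (y := fun j => (K j.i).enc j.a) hx1 rfl
      fun _ => rfl).pair ht
  · rw [deltaMults, List.map_map]
    rfl

theorem powMultsRun (d : ι → ℕ) (hd : PolyBd d σ) (y : ∀ i, Fin (N i) → (K i).F)
    (hx : Small σ (fun i => .pair (K i).desc (.pair (.atom (d i)) ((K i).vec (y i))))) :
    Computes O σ (fun i => .pair (K i).desc (.pair (.atom (d i)) ((K i).vec (y i)))) powMultsP
      (fun i => .ofList ((powMults (d i) (y i)).map (K i).factor)) := by
  have hN : PolyBd N σ := hx.snd.snd.vecLen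
  unfold powMultsP
  refine Computes.congr (Computes.tab (n := fun i => d i + 1)
    (fun i l => (K i).factor (0, fun k => y i k ^ (l : ℕ)))
    (.natAdd (.simple hx rfl fun _ => rfl) (.num hx 1)) (hd.add (.const 1))
    fun hx1 => ?_) fun i => ?_
  · have hlen := Computes.vecLen (O := fun j => O j.i) (K := fun j => K j.i)
      (y := fun j => y j.i) (a := sndE (sndE .snd)) (.simple hx1 rfl fun _ => rfl)
    have ht := Computes.tab (n := fun j : TabIdx (fun i => d i + 1) => N j.i)
      (body := fPowE (fstE (sndE .snd)) (nthE .fst (sndE (sndE (sndE .snd)))) (fstE .snd))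
      (fun j k => (K j.i).enc (y j.i k ^ (j.k : ℕ))) hlen (hN.pull TabIdx.i) fun hx2 => by
        have h1 := Computes.vecNth (O := fun j => O j.i.i) (K := fun j => K j.i.i)
          (y := fun j => y j.i.i) (k := fun j => j.k) (kp := .fst)
          (a := sndE (sndE (sndE .snd))) (.simple hx2 rfl fun _ => rfl)
          (.simple hx2 rfl fun _ => rfl)
        exact .fPow (.simple hx2 rfl fun _ => rfl) h1 (.simple hx2 rfl fun _ => rfl)
    exact (Computes.fZero (K := fun j => K j.i) (D := fstE .snd)
      (.simple hx1 rfl fun _ => rfl)).pair ht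
  · rw [powMults, List.map_ofFn]
    rfl

variable {P : ι → LDParams}

theorem colRun (j : ∀ i, Fin (P i).m) (pts : ∀ i, Fin (N i) → Fin (P i).m → (P i).K.F)
    (hx : Small σ (fun i => .pair (.atom (j i)) ((P i).points (pts i)))) :
    Computes O σ (fun i => .pair (.atom (j i)) ((P i).points (pts i))) colP
      (fun i => (P i).K.vec fun k => pts i k (j i)) := by
  have hlen := Computes.len (O := O) (a := fun i => List.ofFn fun k => (P i).K.vec (pts i k))
    (l := .snd) (.simple hx rfl fun _ => rfl)
  simp only [List.length_ofFn] at hlen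
  have hN : PolyBd N σ := PolyBd.of_le (Small.length (Small.snd hx)) fun i => by simp
  refine Computes.tab (n := N) (fun i k => (P i).K.enc (pts i k (j i))) hlen hN fun hx1 => ?_
  have h1 := Computes.nth_ofFn (O := fun j => O j.i) (k := .fst) (l := sndE .snd)
    (e := fun (j : TabIdx N) k => (P j.i).K.vec (pts j.i k)) (n := fun j => j.k)
    (.simple hx1 rfl fun _ => rfl) (.simple hx1 rfl fun _ => rfl)
  exact Computes.vecNth (kp := fstE .snd) (K := fun j => (P j.i).K) (y := fun i => pts i.i i.k)
    (k := fun i => j i.i) (.simple hx1 rfl fun _ => rfl) h1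

theorem pointsLen {a : Prog} {pts : ∀ i, Fin (N i) → Fin (P i).m → (P i).K.F}
    (ha : Computes O σ x a (fun i => (P i).points (pts i))) :
    Computes O σ x (lenE a) (fun i => .atom (N i)) :=
  (Computes.len (a := fun i => List.ofFn fun k => (P i).K.vec (pts i k)) ha).congr fun i => by simp

theorem _root_.LocalSim.Small.pointsLen {pts : ∀ i, Fin (N i) → Fin (P i).m → (P i).K.F}
    (ha : Small σ (fun i => (P i).points (pts i))) : PolyBd N σ :=
  PolyBd.of_le (Small.length ha) fun i => by simp

theorem paramsLen {p : Prog} (h : Computes O σ x p (fun i => (P i).val)) :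
    Computes O σ x (lenE (fstE (sndE p))) (fun i => .atom (P i).m) :=
  (Computes.len (a := fun i => List.ofFn fun k => .atom ((P i).d k)) h.snd.fst).congr
    fun i => by simp

theorem _root_.LocalSim.Small.paramsLen (h : Small σ (fun i => (P i).val)) :
    PolyBd (fun i => (P i).m) σ :=
  PolyBd.of_le (Small.length (Small.fst (Small.snd h))) fun i => by simp

theorem deltaAllRun (pts : ∀ i, Fin (N i) → Fin (P i).m → (P i).K.F)
    (hx : Small σ (fun i => .pair (P i).val ((P i).points (pts i)))) :
    Computes O σ (fun i => .pair (P i).val ((P i).points (pts i))) deltaAllP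
      (fun i => .ofList (((P i).deltaAll (pts i)).map fun M =>
        .ofList (M.map (P i).K.factor))) := by
  unfold deltaAllP
  refine Computes.congr (Computes.tab (n := fun i => (P i).m)
    (fun i j => .ofList ((deltaMults ((P i).L j) fun k => pts i k j).map (P i).K.factor))
    (Computes.paramsLen (P := P) (.simple hx rfl fun _ => rfl)) hx.fst.paramsLen
    fun hx1 => ?_) fun i => ?_
  · have h1 := Computes.nth_ofFn (O := fun j => O j.i) (k := .fst) (l := sndE (sndE (fstE .snd)))
      (e := fun (j : TabIdx fun i => (P i).m) k => .ofList (((P j.i).L k).map (P j.i).K.enc))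
      (n := fun j => j.k) (.simple hx1 rfl fun _ => rfl) (.simple hx1 rfl fun _ => rfl)
    have h2 : Computes (fun j : TabIdx (fun i => (P i).m) => O j.i) (fun j => σ j.i) _
        (.pair .fst (sndE .snd)) (fun j => .pair (.atom (j.k : ℕ)) ((P j.i).points (pts j.i))) :=
      .simple hx1 rfl fun _ => rfl
    have h3 := (Computes.simple (y := fun j => (P j.i).K.desc) (pr := fstE (fstE .snd))
      hx1 rfl fun _ => rfl).pair (h1.pair (h2.comp (Computes.colRun _ _ h2.small)))
    exact h3.comp (Computes.deltaMultsRun _ _ h3.small)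
  · rw [LDParams.deltaAll, List.map_ofFn]
    rfl

theorem powAllRun (hd : PolyBd (fun j : TabIdx fun i => (P i).m => (P j.i).d j.k) (fun j => σ j.i))
    (pts : ∀ i, Fin (N i) → Fin (P i).m → (P i).K.F)
    (hx : Small σ (fun i => .pair (P i).val ((P i).points (pts i)))) :
    Computes O σ (fun i => .pair (P i).val ((P i).points (pts i))) powAllP
      (fun i => .ofList (((P i).powAll (pts i)).map fun M => .ofList (M.map (P i).K.factor))) := by
  unfold powAllP
  refine Computes.congr (Computes.tab (n := fun i => (P i).m)
    (fun i j => .ofList ((powMults ((P i).d j) fun k => pts i k j).map (P i).K.factor))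
    (Computes.paramsLen (P := P) (.simple hx rfl fun _ => rfl)) hx.fst.paramsLen
    fun hx1 => ?_) fun i => ?_
  · have h1 := Computes.nth_ofFn (O := fun j => O j.i) (k := .fst) (l := fstE (sndE (fstE .snd)))
      (e := fun (j : TabIdx fun i => (P i).m) k => .atom ((P j.i).d k))
      (n := fun j => j.k) (.simple hx1 rfl fun _ => rfl) (.simple hx1 rfl fun _ => rfl)
    have h2 : Computes (fun j : TabIdx (fun i => (P i).m) => O j.i) (fun j => σ j.i) _
        (.pair .fst (sndE .snd)) (fun j => .pair (.atom (j.k : ℕ)) ((P j.i).points (pts j.i))) :=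
      .simple hx1 rfl fun _ => rfl
    have h3 := (Computes.simple (y := fun j => (P j.i).K.desc) (pr := fstE (fstE .snd))
      hx1 rfl fun _ => rfl).pair (h1.pair (h2.comp (Computes.colRun _ _ h2.small)))
    exact h3.comp (Computes.powMultsRun _ hd _ h3.small)
  · rw [LDParams.powAll, List.map_ofFn]
    rfl

theorem selectRun (pts : ∀ i, Fin (N i) → Fin (P i).m → (P i).K.F)
    (hx : Small σ (fun i => .pair (P i).val ((P i).points (pts i)))) :
    Computes O σ (fun i => .pair (P i).val ((P i).points (pts i))) selectP
      (fun i => .ofList (((P i).select (pts i)).map (P i).K.vec)) := by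
  have hlen := Computes.pointsLen (O := O) (P := P) (pts := pts) (a := .snd)
    (.simple hx rfl fun _ => rfl)
  have h1 := (Computes.simple (y := fun i => (P i).K.desc) (pr := fstE .fst)
    hx rfl fun _ => rfl).pair (hlen.pair (Computes.deltaAllRun (O := O) pts hx))
  have h2 := h1.comp (Computes.tensorReduceRun _ h1.small hx.snd.pointsLen)
  refine Computes.congr (Computes.map (fun i => (P i).K.tagged)
    (fun i => (tensorReduce ((P i).deltaAll (pts i))).2) (fun i c => .ofList (c.1.map (P i).K.enc))
    h2.snd fun hx1 => .simple hx1 rfl fun _ => rfl) fun i => ?_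
  rw [LDParams.select, List.map_map]
  congr 1
  refine List.map_congr_left fun c hc => ?_
  rw [Function.comp, FieldCtx.vec_eq_map, LDParams.ofFn_select _ _ c hc]

theorem constraintRun
    (hd : PolyBd (fun j : TabIdx fun i => (P i).m => (P j.i).d j.k) (fun j => σ j.i))
    (pts : ∀ i, Fin (N i) → Fin (P i).m → (P i).K.F)
    (hx : Small σ (fun i => .pair (P i).val ((P i).points (pts i)))) :
    Computes O σ (fun i => .pair (P i).val ((P i).points (pts i))) constraintP
      (fun i => (P i).K.rows ((P i).constraints (pts i))) := by
  have hlen := Computes.pointsLen (O := O) (P := P) (pts := pts) (a := .snd)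
    (.simple hx rfl fun _ => rfl)
  have h1 := (Computes.simple (y := fun i => (P i).K.desc) (pr := fstE .fst)
    hx rfl fun _ => rfl).pair (hlen.pair (Computes.powAllRun (O := O) hd pts hx))
  exact (h1.comp (Computes.tensorReduceRun _ h1.small hx.snd.pointsLen)).fst

theorem locatorRun
    (hd : PolyBd (fun j : TabIdx fun i => (P i).m => (P j.i).d j.k) (fun j => σ j.i))
    (pts : ∀ i, Fin (N i) → Fin (P i).m → (P i).K.F)
    (hx : Small σ (fun i => .pair (P i).val ((P i).points (pts i)))) :
    Computes O σ (fun i => .pair (P i).val ((P i).points (pts i))) locatorP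
      (fun i => .pair (.ofList (((P i).select (pts i)).map (P i).K.vec))
        ((P i).K.rows ((P i).constraints ((P i).allPoints (pts i))))) := by
  have h0 : Computes O σ _ (.pair .fst .snd) (fun i => .pair (P i).val ((P i).points (pts i))) :=
    .simple hx rfl fun _ => rfl
  have h1 := (h0.comp (Computes.selectRun pts hx)).pair (.id hx)
  refine h1.comp ?_
  have hx1 := h1.small
  have h2 := Computes.append (O := O) (l := .fst) (l' := sndE .snd)
    (a := fun i => ((P i).select (pts i)).map (P i).K.vec)
    (b := fun i => List.ofFn fun k => (P i).K.vec (pts i k))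
    (.simple hx1 rfl fun _ => rfl) (.simple hx1 rfl fun _ => rfl)
  have h3 := (Computes.simple (y := fun i => (P i).val) (pr := fstE .snd)
    hx1 rfl fun _ => rfl).pair (h2.congr fun i => ((P i).points_allPoints (pts i)).symm)
  exact .pair (.simple hx1 rfl fun _ => rfl) (h3.comp (Computes.constraintRun hd _ h3.small))

end Computes
end

/-! ### Correctness of the constraint locator -/

namespace FieldCtx

variable (K : FieldCtx)

theorem card_eq : Fintype.card K.F = K.p ^ K.pb.dim := by
  have : Module.Finite (ZMod K.p) K.F := K.pb.finite
  rw [Module.card_eq_pow_finrank (K := ZMod K.p), ZMod.card, K.pb.finrank]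

theorem dim_le_log : K.pb.dim ≤ Nat.log 2 (Fintype.card K.F) := by
  refine Nat.le_log_of_pow_le (by norm_num) ?_
  rw [card_eq]
  exact Nat.pow_le_pow_left K.prime.out.two_le _

theorem size_p_le : Nat.size K.p ≤ Nat.log 2 (Fintype.card K.F) + 1 := by
  rw [Nat.size_le]
  refine lt_of_le_of_lt ?_ (Nat.lt_pow_succ_log_self (by norm_num) _)
  rw [card_eq]
  exact Nat.le_self_pow K.dim_pos.ne' _

/-- The description of the field is polynomial in `log |F|`. -/
theorem size_desc_le : K.desc.size ≤ (Nat.log 2 (Fintype.card K.F) + 2) +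
    ((Nat.log 2 (Fintype.card K.F) + 1) * ((Nat.log 2 (Fintype.card K.F) + 2) + 1) + 1) + 1 := by
  have h1 := K.size_p_le
  have h2 : (Val.ofList (List.ofFn fun i : Fin (K.pb.dim + 1) => Val.atom (K.mcoeff i))).size ≤
      (Nat.log 2 (Fintype.card K.F) + 1) * ((Nat.log 2 (Fintype.card K.F) + 2) + 1) + 1 := by
    refine size_ofList_le (by simpa using K.dim_le_log) fun a ha => ?_
    obtain ⟨i, rfl⟩ := (List.mem_ofFn' _ _).1 ha
    have := Nat.size_le_size (ZMod.val_lt ((minpoly (ZMod K.p) K.pb.gen).coeff i)).le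
    simp only [Val.size, mcoeff]
    omega
  rw [desc_eq]
  simp only [Val.size] at h2 ⊢
  omega

end FieldCtx

/-- The measure of the size of parameters. -/
noncomputable def LDParams.weight (P : LDParams) : ℕ :=
  Nat.log 2 (Fintype.card P.K.F) + P.m + Finset.univ.sup P.d

/-- Parameters, together with the sets that are listed in them. -/
structure LDCode extends LDParams where
  S : Fin m → Finset K.F
  hd : ∀ i, 2 * ((S i).card - 1) ≤ d i
  nodup : ∀ i, (L i).Nodup
  mem : ∀ i x, x ∈ L i ↔ x ∈ S i

/-- The parameters of an encoding, together with a list of points. -/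
structure LDInput extends LDCode where
  N : ℕ
  pts : Fin N → Fin m → K.F

namespace LDInput

/-- The measure of the size of an input. -/
noncomputable def weight (X : LDInput) : ℕ := X.toLDParams.weight + X.N

theorem polyBd_log : PolyBd (fun X : LDInput => Nat.log 2 (Fintype.card X.K.F)) weight :=
  (PolyBd.refl _).of_le fun X => by simp only [weight, LDParams.weight]; omega

theorem polyBd_m : PolyBd (fun X : LDInput => X.m) weight :=
  (PolyBd.refl _).of_le fun X => by simp only [weight, LDParams.weight]; omega

theorem polyBd_N : PolyBd (fun X : LDInput => X.N) weight :=
  (PolyBd.refl _).of_le fun X => by simp only [weight]; omega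

theorem polyBd_sup : PolyBd (fun X : LDInput => Finset.univ.sup X.d) weight :=
  (PolyBd.refl _).of_le fun X => by simp only [weight, LDParams.weight]; omega

theorem d_le_sup (X : LDInput) (j : Fin X.m) : X.d j ≤ Finset.univ.sup X.d :=
  Finset.le_sup (f := X.d) (Finset.mem_univ j)

theorem small_desc : Small weight (fun X : LDInput => X.K.desc) := by
  have h2 := polyBd_log.add (.const 2)
  exact .of_le ((h2.add (((polyBd_log.add (.const 1)).mul (h2.add (.const 1))).add (.const 1))).add
    (.const 1)) fun X => X.K.size_desc_le

/-- The degree hypothesis makes the listed sets small: `|S| ≤ 2 (|S| - 1) + 1`. -/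
theorem length_L_le (X : LDInput) (j : Fin X.m) : (X.L j).length ≤ Finset.univ.sup X.d + 1 := by
  have h1 : (X.L j).length = (X.S j).card := by
    have : X.S j = (X.L j).toFinset := by ext x; simp [X.mem]
    rw [this, List.toFinset_card_of_nodup (X.nodup j)]
  have := X.hd j
  have := X.d_le_sup j
  omega

theorem small_val : Small weight (fun X : LDInput => X.toLDParams.val) := by
  have he := PolyBd.elemSize small_desc
  refine small_desc.pair (.pair ?_ ?_)
  · refine .list polyBd_m (polyBd_sup.add (.const 1)) (fun X => by simp) fun X a ha => ?_
    obtain ⟨i, rfl⟩ := (List.mem_ofFn' _ _).1 ha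
    exact (Val.size_atom_le _).trans (Nat.add_le_add_right (X.d_le_sup i) 1)
  · refine .list polyBd_m (((polyBd_sup.add (.const 1)).mul (he.add (.const 1))).add (.const 1))
      (fun X => by simp) fun X a ha => ?_
    obtain ⟨i, rfl⟩ := (List.mem_ofFn' _ _).1 ha
    refine size_ofList_le (by simpa using X.length_L_le i) fun a ha => ?_
    obtain ⟨v, _, rfl⟩ := List.mem_map.1 ha
    exact X.K.size_enc_le v

theorem small_points : Small weight (fun X : LDInput => X.points X.pts) := by
  refine .list polyBd_N (PolyBd.vecSize small_desc polyBd_m) (fun X => by simp) fun X a ha => ?_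
  obtain ⟨i, rfl⟩ := (List.mem_ofFn' _ _).1 ha
  exact FieldCtx.size_vec_le _

/-- The constraint locator on all inputs. -/
theorem computes_locatorP {κ : Type u} (X : κ → LDInput) (O : κ → Val → Val) :
    Computes O (fun i => (X i).weight)
      (fun i => .pair (X i).toLDParams.val ((X i).points (X i).pts)) locatorP
      (fun i => .pair (.ofList (((X i).select (X i).pts).map (X i).K.vec))
        ((X i).K.rows ((X i).constraints ((X i).allPoints (X i).pts)))) :=
  Computes.locatorRun (P := fun i => (X i).toLDParams)
    ((polyBd_sup.pull fun j : TabIdx fun i => (X i).m => X j.i).of_le fun j => d_le_sup _ j.k) _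
    ((small_val.pair small_points).pull X)

variable (X : LDInput)

/-- The selected locations form a repetition-free list `R` of grid points, and all other grid
points are separated from the given points by polynomials of low degree. -/
theorem exists_grid_list : ∃ R : List (Grid X.S), R.map Subtype.val = X.select X.pts ∧ R.Nodup ∧
    ∀ s : Grid X.S, s ∉ R → ∃ h ∈ degLE X.K.F fun i => (X.S i).card - 1,
      (∀ k, MvPolynomial.eval (X.pts k) h = 0) ∧ MvPolynomial.eval s.1 h ≠ 0 := by
  obtain ⟨h1, h2, h3⟩ := tensorReduce_deltaMults X.nodup X.mem X.pts
  have hsel : ∀ s ∈ X.select X.pts, ∀ i, s i ∈ X.S i := by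
    intro s hs
    obtain ⟨c, hc, rfl⟩ := List.mem_map.1 hs
    obtain ⟨s, hs', rfl⟩ := h1 c hc
    intro i
    simpa using hs' i
  have hmap : (X.select X.pts).map List.ofFn =
      (tensorReduce (X.deltaAll X.pts)).2.map Prod.fst := by
    rw [LDParams.select, List.map_map]
    exact List.map_congr_left fun c hc => X.ofFn_select _ c hc
  refine ⟨(X.select X.pts).pmap Subtype.mk hsel, by simp [List.map_pmap], ?_, fun s hs => ?_⟩
  · refine List.Nodup.pmap (fun a _ b _ h => congrArg Subtype.val h) ?_
    refine List.Nodup.of_map List.ofFn ?_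
    rw [hmap]
    exact h2
  · refine h3 s.1 s.2 fun c hc hcs => hs ?_
    have : List.ofFn s.1 ∈ (X.select X.pts).map List.ofFn := by
      rw [hmap, ← hcs]
      exact List.mem_map_of_mem hc
    obtain ⟨s', hs', h⟩ := List.mem_map.1 this
    rw [List.ofFn_injective h] at hs'
    exact List.mem_pmap.2 ⟨s.1, hs', rfl⟩

/-- The vector `w` of the message at the selected locations, followed by `β`, satisfies all
constraints if and only if some extension of the message has the values `β`. The constraints only
say that there is a polynomial of degree at most `d` with these values; `exists_mem_LD_iff` makes
it agree with the message on the rest of the grid. -/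
theorem forall_constraints_iff {R : List (Grid X.S)} (hR : R.map Subtype.val = X.select X.pts)
    (hsep : ∀ s : Grid X.S, s ∉ R → ∃ h ∈ degLE X.K.F fun i => (X.S i).card - 1,
      (∀ k, MvPolynomial.eval (X.pts k) h = 0) ∧ MvPolynomial.eval s.1 h ≠ 0)
    (f : Grid X.S → X.K.F) (w : Fin (X.select X.pts).length → X.K.F) (β : Fin X.N → X.K.F)
    (hw : ∀ (k : Fin R.length) (k' : Fin (X.select X.pts).length), (k : ℕ) = k' →
      w k' = f (R.get k)) :
    (∀ z ∈ X.constraints (X.allPoints X.pts), z ⬝ᵥ Fin.append w β = 0) ↔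
      ∃ q ∈ LD X.d X.S f, ∀ k, MvPolynomial.eval (X.pts k) q = β k := by
  have hlen : R.length = (X.select X.pts).length := by rw [← hR, List.length_map]
  have hget : ∀ (k : Fin R.length) (k' : Fin (X.select X.pts).length), (k : ℕ) = k' →
      (X.select X.pts).get k' = (R.get k).1 := by
    intro k k' h
    simp only [List.get_eq_getElem, ← h, ← hR, List.getElem_map]
  rw [← mem_rowKer, LDParams.constraints, LDParams.powAll, rowKer_powMults, Submodule.mem_map,
    exists_mem_LD_iff X.hd hsep]
  refine exists_congr fun q => and_congr_right fun _ => ?_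
  rw [funext_iff, Fin.forall_fin_add]
  simp only [evalAt_apply, LDParams.allPoints, Fin.append_left, Fin.append_right]
  refine and_congr_left fun _ => ⟨fun h r hr => ?_, fun h k => ?_⟩
  · obtain ⟨k, rfl⟩ := List.mem_iff_get.1 hr
    rw [← hget k (Fin.cast hlen k) rfl, h, hw k _ rfl]
  · rw [hget (Fin.cast hlen.symm k) k rfl, hw (Fin.cast hlen.symm k) k rfl]
    exact h _ (List.get_mem _ _)

end LDInput

/-- One program and one exponent `c` serve for all fields and all parameters. -/
theorem isConstraintLocator_locatorP : ∃ c : ℕ, ∀ (X : LDCode),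
    IsConstraintLocator (rmEnc X.d X.S X.hd) (fun x => X.K.vec x.1) X.K.vec X.K.enc
      X.toLDParams.val locatorP (fun n => (X.toLDParams.weight + n + 2) ^ c) (fun n => n) := by
  obtain ⟨c, hc⟩ := (LDInput.computes_locatorP id fun _ => id).time_le
  refine ⟨c, fun X I _ => ?_⟩
  let Y : LDInput := { X with N := I.length, pts := I.get }
  obtain ⟨R, hR, hnd, hsep⟩ := Y.exists_grid_list
  have hlen : R.length = (Y.select Y.pts).length := by rw [← hR, List.length_map]
  -- the program lists the columns in a row, while `Z` has them indexed by a sum type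
  let ρ : Fin R.length ⊕ Fin I.length ≃ Fin ((Y.select Y.pts).length + I.length) :=
    (Equiv.sumCongr (finCongr hlen) (Equiv.refl _)).trans finSumFinEquiv
  have hρ : ∀ (v : Fin R.length ⊕ Fin I.length → X.K.F), v ∘ ρ.symm =
      Fin.append (fun k => v (.inl (Fin.cast hlen.symm k))) (fun k => v (.inr k)) := by
    intro v
    funext k
    refine Fin.addCases (fun k => ?_) (fun k => ?_) k
    · rw [Fin.append_left, Function.comp]
      congr 1
      rw [Equiv.symm_apply_eq]
      simp [ρ]
    · rw [Fin.append_right, Function.comp]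
      congr 1
      rw [Equiv.symm_apply_eq]
      simp [ρ]
  let rows := Y.constraints (Y.allPoints Y.pts)
  let Z : Matrix (Fin rows.length) (Fin R.length ⊕ Fin I.length) X.K.F :=
    fun i s => rows.get i (ρ s)
  have hin : Val.pair X.toLDParams.val (.ofList (I.map X.K.vec)) =
      .pair Y.toLDParams.val (Y.points Y.pts) := by
    congr 1
    rw [LDParams.points, Val.ofList_ofFn_map]
    congr 2
    exact (List.ofFn_get I).symm
  -- the running time does not depend on the oracle
  refine ⟨R, rows.length, Z, locatorP.time id (.pair Y.toLDParams.val (Y.points Y.pts)), hnd, ?_,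
    hc Y, fun O => ?_, fun f β => ?_⟩
  · rw [hlen]
    exact Y.select_length_le _
  · obtain ⟨_, h2, h3⟩ := Prog.queryFree_spec O id locatorP rfl
    rw [hin, Prog.run_eq_pure O locatorP rfl, h3, h2]
    congr 2
    refine ((LDInput.computes_locatorP (fun X : LDInput => X) fun _ => O).out_eq Y).trans ?_
    rw [encodeSystem]
    congr 2
    · rw [← hR, List.map_map]
      rfl
    · have h4 : ∀ i, Y.K.vec (rows.get i) = .ofList ((List.ofFn fun j => X.K.enc (Z i (.inl j))) ++
          List.ofFn fun j => X.K.enc (Z i (.inr j))) := by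
        intro i
        rw [FieldCtx.vec_eq, List.ofFn_add, List.ofFn_congr hlen.symm]
        rfl
      simp only [← h4]
      rw [FieldCtx.rows, Val.ofList_ofFn_map, List.ofFn_get]
  · have h5 : Z.mulVec (Sum.elim (fun j => f (R.get j)) β) = 0 ↔ ∀ z ∈ rows,
        z ⬝ᵥ Fin.append (fun k => f (R.get (Fin.cast hlen.symm k))) β = 0 := by
      have h6 : ∀ i, Z.mulVec (Sum.elim (fun j => f (R.get j)) β) i =
          rows.get i ⬝ᵥ Fin.append (fun k => f (R.get (Fin.cast hlen.symm k))) β := by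
        intro i
        have := hρ (Sum.elim (fun j => f (R.get j)) β)
        simp only [Sum.elim_inl, Sum.elim_inr] at this
        rw [← this, ← comp_equiv_dotProduct_comp_equiv _ _ ρ, Function.comp_assoc,
          Equiv.symm_comp_self]
        rfl
      rw [funext_iff]
      simp only [h6, Pi.zero_apply, List.forall_mem_iff_get]
    rw [h5, Y.forall_constraints_iff hR hsep f _ β fun k k' h =>
      congrArg (fun k => f (R.get k)) (Fin.ext h.symm)]
    simp only [mem_support_rmEnc]
    constructor
    · rintro ⟨q, hq, h⟩
      exact ⟨_, ⟨q, hq, rfl⟩, h⟩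
    · rintro ⟨_, ⟨q, hq, rfl⟩, h⟩
      exact ⟨q, hq, h⟩

/-! ### The local simulator -/

/-- On input `(p, k)`, the power `p ^ k`. -/
def npowP : Prog := iterE (natMulE .fst (fstE .snd)) .snd (numE 1)

/-- The number of elements of the field with description `D`. -/
def cardE (D : Prog) : Prog := .comp npowP (.pair (fstE D) (natSubE (lenE (sndE D)) (numE 1)))

/-- On input `(D, r)`, the element of the field whose digits are the base `p` digits of `r`. -/
def ofNatP : Prog :=
  tabE (natModE (natDivE (sndE .snd) (.comp npowP (.pair (fstE (fstE .snd)) .fst)))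
    (fstE (fstE .snd))) (natSubE (lenE (sndE .fst)) (numE 1))

/-- On input `((par, (T, α)), r)`, the data for the rest of the simulation: the locations of the
oracle queries, the known values of the encoding, and the equations. The locations are in reversed
order, because `askP` puts the answers in front of the known values one after the other. The value
at the new query, which comes first, is replaced by `0`. -/
def prepareP : Prog :=
  .comp
    (.pair
      (.pair (revE (fstE .fst))
        (.pair (fZeroE (fstE (fstE (fstE .snd)))) (mapE (sndE .fst) (fstE (sndE (fstE .snd))))))
      (.pair (fstE (fstE (fstE .snd))) (.pair (lenE (fstE .fst)) (.pair (sndE .fst)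
        (.comp ofNatP (.pair (fstE (fstE (fstE .snd))) (sndE .snd)))))))
    (.pair (.comp locatorP (.pair (fstE .fst)
      (.pair (sndE (sndE .fst)) (mapE (fstE .fst) (fstE (sndE .fst)))))) .id)

/-- On input `((l, t), e)`, put the answers to the queries `l` in front of the list `t`. -/
def askP : Prog := .pair (.comp (.fold (.pair (.comp .query .fst) .snd)) .fst) .snd

/-- On input `(w, (D, (k, (Z, s))))`, solve the linear equations with coefficients `Z` for the
unknown number `k`, where `w` has the values of the other unknowns and `0` in position `k`; the
answer is `s` if the unknown is not determined. The inverse of `c` is computed as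
`c ^ (|F| - 2)`. -/
def solveP : Prog :=
  foldE (.ite (fNzE (nthE (fstE (sndE (sndE (sndE .snd)))) .fst))
      (fMulE (fstE (sndE (sndE .snd)))
        (fSubE (fstE (sndE (sndE .snd))) (fZeroE (fstE (sndE (sndE .snd))))
          (dotE (fstE (sndE (sndE .snd))) .fst (fstE (sndE .snd))))
        (fPowE (fstE (sndE (sndE .snd))) (nthE (fstE (sndE (sndE (sndE .snd)))) .fst)
          (natSubE (cardE (fstE (sndE (sndE .snd)))) (numE 2))))
      (fstE .snd))
    (fstE (sndE (sndE .snd))) (sndE (sndE (sndE .snd)))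

/-- The local simulator, given a random number. -/
def answerP : Prog := .comp solveP (.comp askP prepareP)

/-- The local simulator. The random number is uniform in `{0, …, |F| - 1}`. -/
def simulatorP : Prog :=
  .comp answerP (.pair .id (.comp .rand (natSubE (cardE (fstE .fst)) (numE 1))))

/-- The run of a program that starts with the only random choice. -/
theorem Prog.run_comp_pair_rand (O : Val → Val) (g n : Prog) (hg : g.randFree = true)
    (hn : n.randFree = true) (x : Val) :
    (Prog.comp g (.pair .id (.comp .rand n))).run O x =
      (PMF.uniformOfFintype (Fin ((n.out O x).toNat + 1))).map fun i =>
        ⟨g.out O (.pair x (.atom i)),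
          (x.size + x.size) + (n.time O x + ((n.out O x).size + (Val.atom i).size)) + (x.size + 1) +
            g.time O (.pair x (.atom i)),
          n.queries O x + g.queries O (.pair x (.atom i))⟩ := by
  simp only [Prog.run, Prog.run_eq_pure O g hg, Prog.run_eq_pure O n hn, andThen, basic, charge,
    PMF.pure_bind, PMF.bind_bind, PMF.map]
  simp [Function.comp_def]

/-- A fold whose body makes one query makes as many queries as the list has items. -/
theorem foldCost_one (g : Val → Val) (l : List Val) (s : Val) :
    foldCost 0 g (fun _ => 1) (.ofList l) s = l.length := by
  induction l generalizing s with
  | nil => rfl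
  | cons a l ih =>
    have := ih (g (.pair a s))
    simp only [Val.ofList, foldCost, List.length_cons] at this ⊢
    omega

namespace FieldCtx

variable (K : FieldCtx)

/-- The field element with the base `p` digits of a natural number. -/
noncomputable def ofNat (r : ℕ) : K.F :=
  ∑ i : Fin K.pb.dim, ((r / K.p ^ (i : ℕ) % K.p : ℕ) : K.F) * K.pb.gen ^ (i : ℕ)

theorem dig_ofNat (r : ℕ) (i : Fin K.pb.dim) : K.dig (K.ofNat r) i = r / K.p ^ (i : ℕ) % K.p := by
  rw [← Nat.mod_mod]
  apply dig_eq_of_cast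
  have h : K.ofNat r = ∑ i : Fin K.pb.dim,
      ((r / K.p ^ (i : ℕ) % K.p : ℕ) : ZMod K.p) • K.pb.basis i := by
    refine Finset.sum_congr rfl fun i _ => ?_
    rw [K.pb.coe_basis, Nat.cast_smul_eq_nsmul, nsmul_eq_mul]
  rw [h, Module.Basis.repr_sum_self]

theorem enc_ofNat (r : ℕ) : K.enc (K.ofNat r) =
    .ofList (List.ofFn fun i : Fin K.pb.dim => .atom (r / K.p ^ (i : ℕ) % K.p)) := by
  simp only [enc_eq, dig_ofNat]

/-- A uniformly random number below `|F|` gives a uniformly random field element. -/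
theorem bijective_ofNat {q : ℕ} (hq : q = K.p ^ K.pb.dim) :
    Function.Bijective fun r : Fin q => K.ofNat r := by
  subst hq
  rw [Fintype.bijective_iff_injective_and_card]
  refine ⟨fun r s h => finFunctionFinEquiv.symm.injective (funext fun i => Fin.ext ?_), ?_⟩
  · have := congrArg (fun x => K.dig x i) h
    simpa [dig_ofNat] using this
  · rw [Fintype.card_fin, card_eq]

theorem pow_card_sub_two {x : K.F} (hx : x ≠ 0) : x ^ (K.p ^ K.pb.dim - 2) = x⁻¹ := by
  have h2 : 2 ≤ K.p ^ K.pb.dim := by rw [← card_eq]; exact Fintype.one_lt_card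
  have h := FiniteField.pow_card_sub_one_eq_one x hx
  rw [card_eq, show K.p ^ K.pb.dim - 1 = K.p ^ K.pb.dim - 2 + 1 by omega, pow_succ] at h
  exact eq_inv_of_mul_eq_one_left h

/-- One step in the solution of linear equations for the unknown number `a`, where `y` has the other
values and is `0` at `a`. -/
noncomputable def solveStep {M : ℕ} (a : Fin M) (y : Fin M → K.F) (s : K.F) (z : Fin M → K.F) :
    K.F :=
  if z a = 0 then s else (0 - z ⬝ᵥ y) * z a ^ (K.p ^ K.pb.dim - 2)

end FieldCtx

section

variable {ι : Type u} {O : ι → Val → Val} {σ : ι → ℕ} {x : ι → Val} {K : ι → FieldCtx}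

namespace Computes

theorem npowRun (p k : ι → ℕ) (hx : Small σ (fun i => .pair (.atom (p i)) (.atom (k i))))
    (hk : PolyBd k σ) :
    Computes O σ (fun i => .pair (.atom (p i)) (.atom (k i))) npowP
      (fun i => .atom (p i ^ k i)) := by
  unfold npowP
  refine Computes.congr (Computes.iterEnv (B := fun _ => ℕ) (fun _ n => .atom n) k (fun _ => 1)
    (fun i n => n * p i) (fun i j n => n = p i ^ j) (.simple hx rfl fun _ => rfl) (.num hx 1) hk
    (fun _ => (pow_zero _).symm) (fun i j n _ h => by rw [h, pow_succ])
    (g := fun i => k i * (Val.atom (p i)).size + 1 + 1)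
    (((hk.mul hx.fst).add (.const 1)).add (.const 1)) (fun i j n hj h => ?_) fun hx' => ?_)
    fun i => ?_
  · subst h
    have h1 : Nat.size (p i ^ j) ≤ k i * (Val.atom (p i)).size + 1 := by
      rw [Nat.size_le]
      have h2 : p i ≤ 2 ^ (Val.atom (p i)).size :=
        (Nat.lt_size_self _).le.trans (Nat.pow_le_pow_right (by norm_num) (by simp [Val.size]))
      calc p i ^ j ≤ (2 ^ (Val.atom (p i)).size) ^ j := Nat.pow_le_pow_left h2 _
        _ = 2 ^ ((Val.atom (p i)).size * j) := (pow_mul _ _ _).symm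
        _ < 2 ^ (k i * (Val.atom (p i)).size + 1) := by
          refine Nat.pow_lt_pow_right (by norm_num) ?_
          rw [mul_comm]
          exact Nat.lt_succ_of_le (Nat.mul_le_mul_right _ hj)
    simp only [Val.size] at h1 ⊢
    omega
  · exact .natMul (.simple hx' rfl fun _ => rfl) (.simple hx' rfl fun _ => rfl)
  · have : ∀ j n : ℕ, (fun n => n * p i)^[j] n = n * p i ^ j := by
      intro j
      induction j with
      | zero => simp
      | succ j ih => intro n; rw [Function.iterate_succ_apply, ih, pow_succ]; ring
    rw [this, one_mul]

theorem card {D : Prog} (hD : Computes O σ x D (fun i => (K i).desc)) :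
    Computes O σ x (cardE D) (fun i => .atom ((K i).p ^ (K i).pb.dim)) := by
  have h1 := hD.desc_p.pair hD.desc_dim
  exact h1.comp (Computes.npowRun _ _ h1.small hD.small.dim)

theorem ofNatRun (r : ι → ℕ) (hx : Small σ (fun i => .pair (K i).desc (.atom (r i)))) :
    Computes O σ (fun i => .pair (K i).desc (.atom (r i))) ofNatP
      (fun i => (K i).enc ((K i).ofNat (r i))) := by
  unfold ofNatP
  have hdim := Computes.desc_dim (O := O) (K := K) (D := .fst) (.simple hx rfl fun _ => rfl)
  refine Computes.congr (Computes.tab (n := fun i => (K i).pb.dim)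
    (fun i k => .atom (r i / (K i).p ^ (k : ℕ) % (K i).p)) hdim hx.fst.dim fun hx1 => ?_)
    fun i => ((K i).enc_ofNat _).symm
  have hp := Computes.desc_p (O := fun j => O j.i)
    (K := fun j : TabIdx fun i => (K i).pb.dim => K j.i) (D := fstE .snd)
    (.simple hx1 rfl fun _ => rfl)
  have h1 := hp.pair (Computes.simple (pr := .fst)
    (y := fun j : TabIdx fun i => (K i).pb.dim => .atom (j.k : ℕ)) hx1 rfl fun _ => rfl)
  have h2 := h1.comp (Computes.npowRun _ _ h1.small
    ((hx.fst.dim.pull TabIdx.i).of_le fun j => j.k.2.le))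
  exact .natMod (.natDiv (.simple hx1 rfl fun _ => rfl) h2) hp

theorem solveRun {M : ι → ℕ} (a : ∀ i, Fin (M i)) (y : ∀ i, Fin (M i) → (K i).F)
    (Z : ∀ i, List (Fin (M i) → (K i).F)) (s : ∀ i, (K i).F)
    (hx : Small σ (fun i => .pair ((K i).vec (y i)) (.pair (K i).desc
      (.pair (.atom (a i)) (.pair ((K i).rows (Z i)) ((K i).enc (s i))))))) :
    Computes O σ (fun i => .pair ((K i).vec (y i)) (.pair (K i).desc
      (.pair (.atom (a i)) (.pair ((K i).rows (Z i)) ((K i).enc (s i)))))) solveP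
      (fun i => (K i).enc ((Z i).foldl ((K i).solveStep (a i) (y i)) (s i))) := by
  unfold solveP
  refine Computes.foldEnv (fun i => (K i).vec) (fun i => (K i).enc) Z s
    (fun i => (K i).solveStep (a i) (y i)) (fun _ _ _ => True)
    (.simple hx rfl fun _ => rfl) (.simple hx rfl fun _ => rfl) (fun _ => trivial)
    (fun _ _ _ _ _ _ => trivial) (PolyBd.elemSize hx.snd.fst)
    (fun i _ b _ _ => (K i).size_enc_le b) fun hx' => ?_
  have hD : Computes (fun j : FoldIdx Z (fun _ _ (_ : (K _).F) => True) => O j.i) (fun j => σ j.i)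
      _ (fstE (sndE (sndE .snd))) (fun j => (K j.i).desc) := .simple hx' rfl fun _ => rfl
  have hz : Computes (fun j : FoldIdx Z (fun _ _ (_ : (K _).F) => True) => O j.i) (fun j => σ j.i)
      _ .fst (fun j => (K j.i).vec j.a) := .simple hx' rfl fun _ => rfl
  have ha := Computes.vecNth (kp := fstE (sndE (sndE (sndE .snd)))) (k := fun j => a j.i)
    (.simple hx' rfl fun _ => rfl) hz
  refine .ite (fun j => j.a (a j.i) ≠ 0) ha.fNz (fun j => by simp) ?_ ?_
  · have hw : Computes (fun j : FoldIdx Z (fun _ _ (_ : (K _).F) => True) => O j.i)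
        (fun j => σ j.i) _ (fstE (sndE .snd)) (fun j => (K j.i).vec (y j.i)) :=
      .simple hx' rfl fun _ => rfl
    have h1 := hD.fMul (hD.fSub hD.fZero (hD.dot hz hw))
      (hD.fPow ha (hD.card.natSub (.num hx' 2)))
    refine (h1.pull Subtype.val).congr fun j => ?_
    rw [FieldCtx.solveStep, if_neg j.2]
  · refine .simple (hx'.pull Subtype.val) rfl fun j => ?_
    rw [FieldCtx.solveStep, if_pos (not_not.1 j.2)]
    rfl

end Computes
end

/-! ### Correctness of the local simulator -/

/-- An input of the simulator: an encoding, query-answer pairs, a query, a message that is given by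
an oracle, and a random number. -/
structure SimInput extends LDCode where
  T : List ((Fin m → K.F) × K.F)
  α : Fin m → K.F
  f : Grid S → K.F
  O : Val → Val
  hO : ∀ x : Grid S, O (K.vec x.1) = K.enc (f x)
  r : ℕ
  hr : r < K.p ^ K.pb.dim

namespace SimInput

/-- The new query, followed by the previous queries. -/
abbrev toLDInput (Y : SimInput) : LDInput :=
  { Y.toLDCode with N := Y.T.length + 1, pts := Fin.cons Y.α fun k => (Y.T.get k).1 }

/-- The measure of the size of an input. -/
noncomputable def weight (Y : SimInput) : ℕ := Y.toLDInput.weight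

variable (Y : SimInput)

/-- The locations of the oracle queries. -/
noncomputable def locs : List (Grid Y.S) := Y.toLDInput.exists_grid_list.choose

theorem map_locs : Y.locs.map Subtype.val = Y.toLDInput.select Y.toLDInput.pts :=
  Y.toLDInput.exists_grid_list.choose_spec.1

theorem length_locs : Y.locs.length = (Y.toLDInput.select Y.toLDInput.pts).length := by
  rw [← map_locs, List.length_map]

/-- The known values: those of the message, and those of the encoding with `b` as the answer to the
new query. -/
noncomputable def values (b : Y.K.F) :
    Fin ((Y.toLDInput.select Y.toLDInput.pts).length + (Y.T.length + 1)) → Y.K.F :=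
  Fin.append (fun k => Y.f (Y.locs.get (Fin.cast Y.length_locs.symm k)))
    (Fin.cons b fun k => (Y.T.get k).2)

/-- The linear constraints on the known values. -/
noncomputable def eqs :
    List (Fin ((Y.toLDInput.select Y.toLDInput.pts).length + (Y.T.length + 1)) → Y.K.F) :=
  Y.toLDInput.constraints (Y.toLDInput.allPoints Y.toLDInput.pts)

/-- The position of the new query. -/
noncomputable def pos :
    Fin ((Y.toLDInput.select Y.toLDInput.pts).length + (Y.T.length + 1)) := Fin.natAdd _ 0

/-- The answer to the new query. If it is not determined, it is the random element given by `r`. -/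
noncomputable def answer : Y.K.F :=
  Y.eqs.foldl (Y.K.solveStep Y.pos (Y.values 0)) (Y.K.ofNat Y.r)

/-- The representation of the query-answer pairs. -/
noncomputable def pairs : Val := .ofList (Y.T.map fun xy => .pair (Y.K.vec xy.1) (Y.K.enc xy.2))

/-- The representation of an input. -/
noncomputable def input : Val :=
  .pair (.pair Y.toLDParams.val (.pair Y.pairs (Y.K.vec Y.α))) (.atom Y.r)

/-- The result of the preparation. -/
noncomputable def prepared : Val :=
  .pair (.pair (.ofList (Y.locs.reverse.map fun x => Y.K.vec x.1))
      (.ofList ((0 :: Y.T.map Prod.snd).map Y.K.enc)))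
    (.pair Y.K.desc (.pair (.atom Y.pos) (.pair (Y.K.rows Y.eqs) (Y.K.enc (Y.K.ofNat Y.r)))))

theorem points_eq : Y.toLDInput.points Y.toLDInput.pts =
    .pair (Y.K.vec Y.α) (.ofList (Y.T.map fun xy => Y.K.vec xy.1)) := by
  have h1 : Y.toLDInput.points Y.toLDInput.pts = .pair (Y.K.vec Y.α) (.ofList
      (List.ofFn fun k : Fin Y.T.length => Y.K.vec (Y.T.get k).1)) := by
    rw [LDParams.points]
    exact congrArg Val.ofList (List.ofFn_succ (f := fun k => Y.K.vec (Y.toLDInput.pts k)))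
  rw [h1]
  congr 2
  rw [← List.ofFn_get (Y.T.map fun xy => Y.K.vec xy.1)]
  refine List.ext_getElem (by simp) fun n h1 h2 => by simp

theorem vec_values : Y.K.vec (Y.values 0) =
    .ofList ((Y.locs.map Y.f ++ 0 :: Y.T.map Prod.snd).map Y.K.enc) := by
  rw [FieldCtx.vec_eq_map, values, List.ofFn_fin_append]
  congr 3
  · rw [List.ofFn_congr Y.length_locs.symm]
    refine List.ext_getElem (by simp) fun n h1 h2 => by simp
  · rw [List.ofFn_succ]
    congr 1
    refine List.ext_getElem (by simp) fun n h1 h2 => by simp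

theorem small_desc : Small weight (fun Y : SimInput => Y.K.desc) :=
  LDInput.small_desc.pull toLDInput

theorem polyBd_T : PolyBd (fun Y : SimInput => Y.T.length) weight :=
  (LDInput.polyBd_N.pull toLDInput).of_le fun _ => Nat.le_succ _

theorem polyBd_m : PolyBd (fun Y : SimInput => Y.m) weight :=
  LDInput.polyBd_m.pull toLDInput

theorem small_vec (v : ∀ Y : SimInput, Fin Y.m → Y.K.F) :
    Small weight (fun Y => Y.K.vec (v Y)) :=
  small_desc.vec polyBd_m v

theorem small_input : Small weight input := by
  refine .pair (.pair (LDInput.small_val.pull toLDInput) (.pair ?_ (small_vec _))) ?_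
  · have hv := PolyBd.vecSize (N := fun Y : SimInput => Y.m) small_desc polyBd_m
    refine .list polyBd_T ((hv.add (PolyBd.elemSize small_desc)).add (.const 1))
      (fun _ => by simp) fun Y a ha => ?_
    obtain ⟨xy, _, rfl⟩ := List.mem_map.1 ha
    have h1 := FieldCtx.size_vec_le xy.1
    have h2 := Y.K.size_enc_le xy.2
    simp only [Val.size, FieldCtx.elemSize]
    omega
  · refine .of_le (((LDInput.polyBd_log.pull toLDInput).add (.const 1)).add (.const 1))
      fun Y => ?_
    simp only [Val.size, Nat.add_le_add_iff_right]
    rw [Nat.size_le]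
    refine lt_of_lt_of_le Y.hr ?_
    rw [← FieldCtx.card_eq]
    exact (Nat.lt_pow_succ_log_self (by norm_num) _).le

theorem computes_prepareP : Computes O weight input prepareP prepared := by
  have hx := small_input
  have hmap := Computes.map (O := O) (body := fstE .fst) (l := fstE (sndE .fst))
    (fun (Y : SimInput) (xy : (Fin Y.m → Y.K.F) × Y.K.F) => .pair (Y.K.vec xy.1) (Y.K.enc xy.2)) T
    (fun Y xy => Y.K.vec xy.1) (.simple hx rfl fun _ => rfl)
    fun hx1 => .simple hx1 rfl fun _ => rfl
  have h1 := (Computes.simple (O := O) (pr := fstE .fst) (y := fun Y : SimInput => Y.toLDParams.val)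
    hx rfl fun _ => rfl).pair ((Computes.simple (O := O) (pr := sndE (sndE .fst))
      (y := fun Y : SimInput => Y.K.vec Y.α) hx rfl fun _ => rfl).pair hmap)
  have h2 := (h1.congr fun Y => by rw [← points_eq]).comp
    (LDInput.computes_locatorP toLDInput O)
  have h3 := h2.pair (.id hx)
  unfold prepareP
  refine h3.comp ?_
  have hx3 := h3.small
  have hD := Computes.simple (O := O) (pr := fstE (fstE (fstE .snd)))
    (y := fun Y : SimInput => Y.K.desc) hx3 rfl fun _ => rfl
  have hrev := Computes.rev (O := O) (l := fstE .fst) (a := fun Y : SimInput =>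
    (Y.toLDInput.select Y.toLDInput.pts).map Y.K.vec) (.simple hx3 rfl fun _ => rfl)
  have hlen := Computes.len (O := O) (l := fstE .fst) (a := fun Y : SimInput =>
    (Y.toLDInput.select Y.toLDInput.pts).map Y.K.vec) (.simple hx3 rfl fun _ => rfl)
  have hys := Computes.map (O := O) (body := sndE .fst) (l := fstE (sndE (fstE .snd)))
    (fun (Y : SimInput) (xy : (Fin Y.m → Y.K.F) × Y.K.F) => .pair (Y.K.vec xy.1) (Y.K.enc xy.2)) T
    (fun Y xy => Y.K.enc xy.2) (.simple hx3 rfl fun _ => rfl)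
    fun hx1 => .simple hx1 rfl fun _ => rfl
  have hr := hD.pair (Computes.simple (O := O) (pr := sndE .snd)
    (y := fun Y : SimInput => .atom Y.r)
    hx3 rfl fun _ => rfl)
  have hs := hr.comp (Computes.ofNatRun _ hr.small)
  have hrows := Computes.simple (O := O) (pr := sndE .fst) (y := fun Y : SimInput => Y.K.rows Y.eqs)
    hx3 rfl fun _ => rfl
  refine ((hrev.pair (hD.fZero.pair hys)).pair (hD.pair (hlen.pair (hrows.pair hs)))).congr
    fun Y => ?_
  rw [prepared, List.map_reverse, List.map_cons, List.map_map]
  have h4 : (Y.locs.map fun x => Y.K.vec x.1) =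
      (Y.toLDInput.select Y.toLDInput.pts).map Y.K.vec := by
    rw [← map_locs, List.map_map]
    rfl
  rw [h4, List.length_map]
  rfl

/-- The known values, and the data for the solution. -/
noncomputable def asked : Val :=
  .pair (Y.K.vec (Y.values 0)) Y.prepared.snd

theorem computes_askP : Computes O weight prepared askP asked := by
  have hx : Small weight prepared := computes_prepareP.small
  have hfold := Computes.fold (O := O) (σ := weight) (A := fun Y : SimInput => Grid Y.S)
    (B := fun Y : SimInput => List Y.K.F) (body := .pair (.comp .query .fst) .snd)
    (fun Y x => Y.K.vec x.1) (fun Y l => .ofList (l.map Y.K.enc)) (fun Y => Y.locs.reverse)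
    (fun Y => 0 :: Y.T.map Prod.snd) (fun Y l x => Y.f x :: l)
    (fun Y pre l => l.length ≤ pre.length + (Y.T.length + 1)) (fun Y => by simp)
    (fun Y pre x l _ h => by simp; omega) hx.fst ?_
  · have h1 := Computes.simple (O := O) (pr := .fst) (y := fun Y : SimInput => Y.prepared.fst)
      hx rfl fun _ => rfl
    have h2 := Computes.simple (O := O) (pr := .snd) (y := fun Y : SimInput => Y.prepared.snd)
      hx rfl fun _ => rfl
    refine ((h1.comp hfold).pair h2).congr fun Y => ?_
    rw [asked, vec_values, List.foldl_reverse, List.foldr_cons_eq_append]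
  · have ha : Small (fun j : FoldIdx (fun Y : SimInput => Y.locs.reverse)
        (B := fun Y : SimInput => List Y.K.F)
        (fun Y pre l => l.length ≤ pre.length + (Y.T.length + 1)) => weight j.i)
        (fun j => j.i.K.vec j.a.1) :=
      (small_desc.pull FoldIdx.i).vec (polyBd_m.pull FoldIdx.i) _
    have hb : Small (fun j : FoldIdx (fun Y : SimInput => Y.locs.reverse)
        (B := fun Y : SimInput => List Y.K.F)
        (fun Y pre l => l.length ≤ pre.length + (Y.T.length + 1)) => weight j.i)
        (fun j => .ofList (j.b.map j.i.K.enc)) := by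
      have hl : PolyBd (fun Y : SimInput => Y.locs.length) weight :=
        ((polyBd_T.add (.const 1))).of_le fun Y => by
          rw [length_locs]
          exact Y.toLDInput.select_length_le _
      refine .list ((hl.add (polyBd_T.add (.const 1))).pull FoldIdx.i)
        ((PolyBd.elemSize small_desc).pull FoldIdx.i) (fun j => ?_) fun j a ha => ?_
      · have h1 := j.hb
        have h2 := j.prefix.length_le
        rw [List.length_reverse] at h2
        rw [List.length_map]
        omega
      · obtain ⟨v, _, rfl⟩ := List.mem_map.1 ha
        exact j.i.K.size_enc_le v
    have hq := Computes.query (O := fun j : FoldIdx (fun Y : SimInput => Y.locs.reverse)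
        (B := fun Y : SimInput => List Y.K.F)
        (fun Y pre l => l.length ≤ pre.length + (Y.T.length + 1)) => j.i.O) ha
      ((small_desc.pull FoldIdx.i).enc fun j => j.i.f j.a) fun j => j.i.hO j.a
    have hx1 := ha.pair hb
    exact Computes.pair (Computes.comp (.simple hx1 rfl fun _ => rfl) hq)
      (.simple hx1 rfl fun _ => rfl)

theorem computes_answerP : Computes O weight input answerP (fun Y => Y.K.enc Y.answer) :=
  (computes_prepareP.comp computes_askP).comp
    (Computes.solveRun (O := O) pos (fun Y => Y.values 0) eqs (fun Y => Y.K.ofNat Y.r)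
      computes_askP.small)

/-- All queries are made in `askP`, one for each selected location, and at most as many locations
are selected as there are points: the previous queries and the new one. -/
theorem queries_answerP : answerP.queries Y.O Y.input ≤ Y.T.length + 1 := by
  have h1 : answerP.queries Y.O Y.input = prepareP.queries Y.O Y.input +
      askP.queries Y.O Y.prepared +
      solveP.queries Y.O (askP.out Y.O (prepareP.out Y.O Y.input)) := by
    rw [← computes_prepareP.out_eq Y]
    rfl
  rw [h1, (Prog.queryFree_spec Y.O Y.O prepareP rfl).2.2,
    (Prog.queryFree_spec Y.O Y.O solveP rfl).2.2, zero_add, add_zero]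
  have h2 : askP.queries Y.O Y.prepared = foldCost 0
      (fun y => Prog.out Y.O (.pair (.comp .query .fst) .snd) y) (fun _ => 1)
      (.ofList (Y.locs.reverse.map fun x => Y.K.vec x.1))
      (.ofList ((0 :: Y.T.map Prod.snd).map Y.K.enc)) := by
    simp [askP, Prog.queries, prepared, Prog.out, Val.fst, Val.snd]
  rw [h2, foldCost_one, List.length_map, List.length_reverse, length_locs]
  exact Y.toLDInput.select_length_le _

/-! ### The law of the answer -/

/-- The constraints hold for the value `b` at the new query if and only if some extension of the
message agrees with the previous answers and has the value `b` there. -/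
theorem forall_eqs_iff (b : Y.K.F) : (∀ z ∈ Y.eqs, z ⬝ᵥ Y.values b = 0) ↔
    ∃ q ∈ LD Y.d Y.S Y.f, (∀ xy ∈ Y.T, MvPolynomial.eval xy.1 q = xy.2) ∧
      MvPolynomial.eval Y.α q = b := by
  rw [eqs, values, Y.toLDInput.forall_constraints_iff Y.map_locs
    Y.toLDInput.exists_grid_list.choose_spec.2.2 Y.f _ _
    fun k k' h => congrArg (fun k => Y.f (Y.locs.get k)) (Fin.ext h.symm)]
  refine exists_congr fun q => and_congr_right fun _ => ?_
  rw [Fin.forall_fin_succ, List.forall_mem_iff_get]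
  simp only [Fin.cons_zero, Fin.cons_succ]
  exact and_comm

/-- Each constraint is an affine equation for the value `b` at the new query. -/
theorem dotProduct_values (z : Fin ((Y.toLDInput.select Y.toLDInput.pts).length +
    (Y.T.length + 1)) → Y.K.F) (b : Y.K.F) :
    z ⬝ᵥ Y.values b = z ⬝ᵥ Y.values 0 + z Y.pos * b := by
  simp only [dotProduct, values, Fin.sum_univ_add, Fin.append_left, Fin.append_right,
    Fin.sum_univ_succ, Fin.cons_zero, Fin.cons_succ, pos]
  ring

end SimInput

namespace FieldCtx

variable {K : FieldCtx}

/-- If no equation involves the unknown, the start value is returned. -/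
theorem foldl_solveStep_of_forall {M : ℕ} {a : Fin M} {y : Fin M → K.F}
    {Z : List (Fin M → K.F)} (h : ∀ z ∈ Z, z a = 0) (s : K.F) :
    Z.foldl (K.solveStep a y) s = s := by
  induction Z with
  | nil => rfl
  | cons z Z ih =>
    rw [List.foldl_cons, solveStep, if_pos (h z (by simp))]
    exact ih fun z hz => h z (by simp [hz])

/-- If the equations have the solution `b` and some equation involves the unknown, then `b` is
returned, whatever the start value. -/
theorem foldl_solveStep_of_exists {M : ℕ} {a : Fin M} {y : Fin M → K.F} {b : K.F}
    {Z : List (Fin M → K.F)} (hb : ∀ z ∈ Z, z ⬝ᵥ y + z a * b = 0) (h : ∃ z ∈ Z, z a ≠ 0)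
    (s : K.F) : Z.foldl (K.solveStep a y) s = b := by
  have hstep : ∀ z ∈ Z, z a ≠ 0 → ∀ s, K.solveStep a y s z = b := by
    intro z hz hza s
    rw [solveStep, if_neg hza, K.pow_card_sub_two hza, ← div_eq_mul_inv, div_eq_iff hza]
    linear_combination - hb z hz
  have key : ∀ Z' : List (Fin M → K.F), Z' ⊆ Z → Z'.foldl (K.solveStep a y) b = b := by
    intro Z' hZ'
    induction Z' with
    | nil => rfl
    | cons z Z' ih =>
      have h1 : K.solveStep a y b z = b := by
        by_cases hza : z a = 0
        · rw [solveStep, if_pos hza]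
        · exact hstep z (hZ' (by simp)) hza b
      rw [List.foldl_cons, h1]
      exact ih fun z hz => hZ' (by simp [hz])
  obtain ⟨z, hz, hza⟩ := h
  obtain ⟨Z₁, Z₂, rfl⟩ := List.append_of_mem hz
  rw [List.foldl_append, List.foldl_cons, hstep z hz hza]
  exact key _ fun z hz => by simp [hz]

end FieldCtx

/-- The upper end of the range of the random number. -/
theorem SimInput.computes_card_sub_one : Computes O weight (fun Y => Y.input.fst)
    (natSubE (cardE (fstE .fst)) (numE 1)) (fun Y => .atom (Y.K.p ^ Y.K.pb.dim - 1)) := by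
  have hx : Small weight (fun Y => Y.input.fst) := small_input.fst
  exact (Computes.card (.simple hx rfl fun _ => rfl)).natSub (.num hx 1)

/-- With a uniformly random start, the solution of the constraints has the conditional law of the
encoding: it is the only possible value if some constraint involves the new query, and uniformly
distributed otherwise. -/
theorem SimInput.map_solve_eq (Y : SimInput) {q : ℕ} (hq : q + 1 = Y.K.p ^ Y.K.pb.dim)
    (hT : ∃ c ∈ consistent Y.T, c ∈ (rmEnc Y.d Y.S Y.hd Y.f).support) :
    (PMF.uniformOfFintype (Fin (q + 1))).map
        (fun i : Fin (q + 1) => Y.eqs.foldl (Y.K.solveStep Y.pos (Y.values 0))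
          (Y.K.ofNat i)) =
      ((rmEnc Y.d Y.S Y.hd Y.f).filter (consistent Y.T) hT).map fun c => c Y.α := by
  obtain ⟨c0, hc0, hc0'⟩ := hT
  obtain ⟨q0, hq0, rfl⟩ := (mem_support_rmEnc Y.hd).1 hc0'
  have h0 := (Y.forall_eqs_iff (MvPolynomial.eval Y.α q0)).2 ⟨q0, hq0, hc0, rfl⟩
  by_cases hz : ∃ z ∈ Y.eqs, z Y.pos ≠ 0
  · rw [filter_rmEnc_map_of_unique Y.hd _ (β := MvPolynomial.eval Y.α q0)]
    · refine pmf_map_eq_pure fun i _ => ?_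
      exact FieldCtx.foldl_solveStep_of_exists (fun z hz => by
        rw [← Y.dotProduct_values]; exact h0 z hz) hz _
    · intro q1 hq1 hq1T
      have h1 := (Y.forall_eqs_iff (MvPolynomial.eval Y.α q1)).2 ⟨q1, hq1, hq1T, rfl⟩
      obtain ⟨z, hz, hza⟩ := hz
      have h2 := h1 z hz
      have h3 := h0 z hz
      rw [Y.dotProduct_values] at h2 h3
      exact mul_left_cancel₀ hza (by linear_combination h2 - h3)
  · push Not at hz
    have hall : ∀ b, ∃ q ∈ LD Y.d Y.S Y.f, (∀ xy ∈ Y.T, MvPolynomial.eval xy.1 q = xy.2) ∧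
        MvPolynomial.eval Y.α q = b := by
      intro b
      refine (Y.forall_eqs_iff b).1 fun z hz' => ?_
      have h3 := h0 z hz'
      rw [Y.dotProduct_values, hz z hz', zero_mul] at h3 ⊢
      exact h3
    -- two extensions with different values at the new query give a translation of the law
    obtain ⟨q1, h1, h1T, h1a⟩ := hall 1
    obtain ⟨q2, h2, h2T, h2a⟩ := hall 0
    have h3 : MvPolynomial.eval Y.α (q1 - q2) ≠ 0 := by
      rw [map_sub, h1a, h2a, sub_zero]
      exact one_ne_zero
    rw [filter_rmEnc_map_of_ne Y.hd _ (Submodule.sub_mem (degLE Y.K.F Y.d) h1.1 h2.1)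
      (fun x => by rw [map_sub, h1.2, h2.2, sub_self])
      (fun xy hxy => by rw [map_sub, h1T xy hxy, h2T xy hxy, sub_self]) h3,
      ← uniformOfFintype_map_of_bijective (Y.K.bijective_ofNat hq)]
    congr 1
    funext i
    exact FieldCtx.foldl_solveStep_of_forall hz _

/-- One program and one exponent serve for all fields and all parameters. -/
theorem isLocalSimulator_simulatorP : ∃ c : ℕ, ∀ X : LDCode,
    IsLocalSimulator (rmEnc X.d X.S X.hd) (fun x => X.K.vec x.1) X.K.vec X.K.enc
      X.toLDParams.val simulatorP (fun n => (X.toLDParams.weight + n + 2) ^ c)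
      (fun n => n + 1) := by
  have h1 := SimInput.computes_card_sub_one
  have hpoly := ((h1.small_in.add h1.small_in).add (h1.time_le.add (h1.small.add
    (SimInput.small_input.snd)))).add (h1.small_in.add (.const 1)) |>.add
      SimInput.computes_answerP.time_le
  obtain ⟨c, hc⟩ := hpoly
  -- the weight of an input counts the new query, and `w + 3 ≤ (w + 2) ^ 2`
  refine ⟨2 * c, fun X f O hO T α => ?_⟩
  have hq0 : 0 < X.K.p ^ X.K.pb.dim := pow_pos X.K.prime.out.pos _
  let Y : Fin (X.K.p ^ X.K.pb.dim) → SimInput := fun i =>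
    { X with T := T, α := α, f := f, O := O, hO := hO, r := i, hr := i.2 }
  set x : Val := .pair X.toLDParams.val
    (.pair (.ofList (T.map fun xy => .pair (X.K.vec xy.1) (X.K.enc xy.2))) (X.K.vec α)) with hx
  have hin : ∀ i, .pair x (.atom i) = (Y i).input := fun i => rfl
  have hout : (natSubE (cardE (fstE .fst)) (numE 1)).out O x =
      .atom (X.K.p ^ X.K.pb.dim - 1) := h1.out_eq (Y ⟨0, hq0⟩)
  obtain ⟨q, hq⟩ : ∃ q, X.K.p ^ X.K.pb.dim = q + 1 := ⟨_, (Nat.succ_pred_eq_of_pos hq0).symm⟩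
  have hrun : simulatorP.run O x = (PMF.uniformOfFintype (Fin (q + 1))).map fun i =>
      ⟨X.K.enc (Y (i.cast hq.symm)).answer,
        (x.size + x.size) + ((natSubE (cardE (fstE .fst)) (numE 1)).time O x +
          ((Val.atom (X.K.p ^ X.K.pb.dim - 1)).size + (Val.atom i).size)) + (x.size + 1) +
            answerP.time O (Y (i.cast hq.symm)).input,
        answerP.queries O (Y (i.cast hq.symm)).input⟩ := by
    rw [simulatorP, Prog.run_comp_pair_rand O _ _ rfl rfl, hout]
    have h2 : (Val.atom (X.K.p ^ X.K.pb.dim - 1)).toNat = q := by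
      rw [hq]
      rfl
    rw [h2]
    congr 1
    funext i
    rw [(Prog.queryFree_spec O O (natSubE (cardE (fstE .fst)) (numE 1)) rfl).2.2, zero_add]
    have h3 := SimInput.computes_answerP.out_eq (Y (i.cast hq.symm))
    rw [← h3]
    rfl
  refine ⟨fun r hr => ?_, fun hT => ?_⟩
  · rw [hrun, PMF.mem_support_map_iff] at hr
    obtain ⟨i, _, rfl⟩ := hr
    refine ⟨?_, (Y (i.cast hq.symm)).queries_answerP⟩
    refine (hc (Y (i.cast hq.symm))).trans ?_
    change _ ≤ (X.toLDParams.weight + T.length + 2) ^ (2 * c)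
    rw [pow_mul]
    refine Nat.pow_le_pow_left ?_ c
    have : (Y (i.cast hq.symm)).weight = X.toLDParams.weight + (T.length + 1) := rfl
    rw [this]
    nlinarith [Nat.zero_le (X.toLDParams.weight + T.length)]
  · have h4 := congrArg (PMF.map X.K.enc) ((Y ⟨0, hq0⟩).map_solve_eq hq.symm hT)
    rw [PMF.map_comp, PMF.map_comp] at h4
    rw [hrun, PMF.map_comp]
    exact h4

end LocalSim

theorem mainTheorem3 :
    (∃ (CL : Prog) (P : MvPolynomial (Fin 4) ℕ),
      ∀ (p : ℕ) [Fact p.Prime] (F : Type) [Field F] [Fintype F] [Algebra (ZMod p) F]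
        (pb : PowerBasis (ZMod p) F) (m : ℕ) (d : Fin m → ℕ) (S : Fin m → Finset F)
        (hd : ∀ i, 2 * ((S i).card - 1) ≤ d i)
        (L : Fin m → List F), (∀ i, (L i).Nodup) → (∀ i x, x ∈ L i ↔ x ∈ S i) →
        IsLinear (rmEnc d S hd) ∧
        IsConstraintLocator (rmEnc d S hd) (fun x => encPoint pb x.1) (encPoint pb) (encField pb)
          (encParams pb d L) CL (fun n => timeBound P F d n) (fun n => n)) ∧
    (∃ (SIM : Prog) (P : MvPolynomial (Fin 4) ℕ),
      ∀ (p : ℕ) [Fact p.Prime] (F : Type) [Field F] [Fintype F] [Algebra (ZMod p) F]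
        (pb : PowerBasis (ZMod p) F) (m : ℕ) (d : Fin m → ℕ) (S : Fin m → Finset F)
        (hd : ∀ i, 2 * ((S i).card - 1) ≤ d i)
        (L : Fin m → List F), (∀ i, (L i).Nodup) → (∀ i x, x ∈ L i ↔ x ∈ S i) →
        IsLocalSimulator (rmEnc d S hd) (fun x => encPoint pb x.1) (encPoint pb) (encField pb)
          (encParams pb d L) SIM (fun n => timeBound P F d n) (fun n => n + 1)) := by
  let poly (c : ℕ) : MvPolynomial (Fin 4) ℕ :=
    (MvPolynomial.X 0 + MvPolynomial.X 1 + MvPolynomial.X 2 + MvPolynomial.X 3 + 2) ^ c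
  have htime : ∀ (c : ℕ) (P : LDParams),
      (fun n => (P.weight + n + 2) ^ c) = fun n => timeBound (poly c) P.K.F P.d n := by
    intro c P
    funext n
    simp [poly, timeBound, LDParams.weight]
  constructor
  · obtain ⟨c, hc⟩ := isConstraintLocator_locatorP
    refine ⟨locatorP, poly c, fun p _ F _ _ _ pb m d S hd L hL hS => ⟨isLinear_rmEnc hd, ?_⟩⟩
    let X : LDCode :=
      { K := ⟨p, F, pb⟩, m := m, d := d, L := L, S := S, hd := hd, nodup := hL, mem := hS }
    have h := hc X
    rw [htime] at h
    exact h
  · obtain ⟨c, hc⟩ := isLocalSimulator_simulatorP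
    refine ⟨simulatorP, poly c, fun p _ F _ _ _ pb m d S hd L hL hS => ?_⟩
    let X : LDCode :=
      { K := ⟨p, F, pb⟩, m := m, d := d, L := L, S := S, hd := hd, nodup := hL, mem := hS }
    have h := hc X
    rw [htime] at h
    exact h
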